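/- Let $n\ge 3$ and let $X=(x_{ij})\in GL_n(\mathbb C)$. Write $[a,b]=\{a,a+1,\dots,b\}$, let $X_I$ be the submatrix of $X$ in the rows $I$, and $X_I^J$ the submatrix in the rows $I$ and the columns $J$ (both in increasing order); the determinant of a submatrix with $|I|\ne|J|$ is understood to be $0$. For a set $I$ of integers put $\gamma(I)=\{a+1: a\in I\}$ and $\gamma^*(I)=\{a-1:a\in I\}$. **The maps.** If $x_{1n}x_{n1}\neq0$, put $\Psi'(X)=X_LX_R^{-1}$, an $(n-1)\times(n-1)$ matrix, where $$X_L=X_{[2,n]}^{[1,n-1]}-X_{[2,n]}^{\{n\}}x_{1n}^{-1}X_{\{1\}}^{[1,n-1]},\qquad X_R=X_{[1,n-1]}^{[2,n]}-X_{[1,n-1]}^{\{1\}}x_{n1}^{-1}X_{\{n\}}^{[2,n]}.$$ If $x_{1n}\ne0$, let $\Psi''(X)=\bar q(\lambda)/p(\lambda)$ with $\bar q(\lambda)=\sum_{i=0}^{n-1}\frac{x_{n,i+1}}{x_{1n}}\lambda^i$ and $p(\lambda)=\sum_{i=0}^{n-1}\frac{x_{1,i+1}}{x_{1n}}\lambda^i$.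 Let $\bar{\mathcal R}_{n-1}$ be the set of rational functions $\bar q/p$ with $p$ monic of degree $n-1$ and $\bar q$ of degree at most $n-1$ and coprime with $p$. **The initial cluster variables.** For an $N\times N$ matrix $U$: * for $k,l\ge1$, $k+l\le N$, $\varphi_{kl}(U)=s^N_{kl}\det\Phi_{kl}(U)$, where the columns of $\Phi_{kl}(U)$ are the first $k$ columns of $U^0=\mathbf 1$, the first $l$ columns of $U$, and the first column of $U^p$ for $p=2,\dots,N-k-l+1$, in this order; $s_{kl}^N=(-1)^{k(l+1)}$ for $N$ even and $s_{kl}^N=(-1)^{(N-1)/2+k(k-1)/2+l(l-1)/2}$ for $N$ odd; * for $2\le j\le i\le N$, $g_{i2}(U)=\det U_{[i,N]}^{[2,N-i+2]}$, and for $j>2$ $$g_{ij}(U)=\sum_{I_1,\dots,I_{j-2}}\det U_{[i,N]}^{I_1}\,\det U_{\gamma^*(I_1)\cup[N-i+j,N]}^{I_2}\prod_{m=2}^{j-2}\det U_{\gamma^*(I_m)\cup \{N\}}^{I_{m+1}},$$ the sum being over all subsets $I_1,\dots,I_{j-2}$ of $I_{j-1}=[2,N]$ with $|I_1|=N-i+1$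 and $|I_m|=N-j+m$ for $2\le m\le j-2$; * $c_r(U)$, $1\le r\le N$, is defined by $\det(\mathbf 1_N+\lambda U)=1+\sum_{r=1}^N(-1)^{r(N-1)}\lambda^rc_r(U)$. For a rational function $\bar M(\lambda)=\sum_{i\ge0}\bar h_i\lambda^{-i}$ (expansion at infinity), put $\bar t_m^-(\bar M)=\det(\bar h_{\alpha+\beta-2})_{\alpha,\beta=1}^m$ and $\bar t_m^+(\bar M)=(-1)^m\det(\bar h_{\alpha+\beta-1})_{\alpha,\beta=1}^m$. **The block matrices in the entries of $X$.** * For $k,l\in[1,n-2]$, $k+l\le n-1$, $\mathsf\Phi_{kl}(X)$ is the square matrix of size $(n-k-l)(n+1)$ consisting of $n-k-l$ block columns of width $n+1$. The $t$-th block column consists, from top to bottom, of $(t-1)n$ zero rows, the block $[X_{I\cup\{n\}}\ \ 0]$, the block $[0\ \ X_{\{1\}\cup\gamma(J)}]$, and zero rows. Here $I=[2,n-1]$, except that $I=[l+1,n-1]$ in the last block column; $J=[2,n-1]$, except that $J=[l+1,n-1]$ in the second block column from the right and $J=[k+1,n-1]$ in the last one. Put $\phi_{kl}(X)=\det\mathsf\Phi_{kl}(X)$.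 * For $i\in[2,n-1]$, $j\in[2,i]$, $\mathtt G_{ij}(X)$ is the square matrix of size $n+j-1$ obtained by stacking, one below the other, $X_{\{1,n\}}$ ($j-2$ times), $X_{\{1\}\cup[n+j-i,n]}$ and $X_{\{1\}\cup[i+1,n]}$, each block being shifted by one column to the right with respect to the block above it, with zeros elsewhere. Put $\mathtt g_{ij}(X)=\det\mathtt G_{ij}(X)$. * $\mathtt A,\mathtt B$ are the $(n+1)\times(n+1)$ matrices with $\mathtt A_{[1,n]}^{[3,n+1]}=X_{[1,n]}^{[1,n-1]}$, $\mathtt B_{[1,n]}^{\{1\}}=X_{[1,n]}^{\{n\}}$, $\mathtt B_{[2,n+1]}^{[2,n+1]}=X$ and all other entries zero. Let $\mathtt c_r(X)$ be $(-1)^{rn}$ times the coefficient of $\lambda^r$ in $\det(\lambda\mathtt A+\mathtt B)$. * $\mathtt F(X)$ is the $(2n-1)\times(2n-1)$ matrix with $\mathtt F_{2i,j}=x_{1,j-i}$ and $\mathtt F_{2i+1,j}=x_{n,j-i}$ (with $x_{1,a}=x_{n,a}=0$ for $a\notin[1,n]$). Let $\mathtt f_m(X)$ be its $m\times m$ trailing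 (lower right) principal minor. **Theorem.** Let $n\ge3$ and $X\in GL_n(\mathbb C)$. (i) If $x_{1n}x_{n1}\ne0$, then for $k,l\in[1,n-2]$ with $k+l\le n-1$ $$\varphi_{kl}(\Psi'(X))=\mathtt s_{kl}\frac{\phi_{kl}(X)}{(x_{1n}\det X)^{n-k-l}},$$ where $\mathtt s_{kl}=(-1)^{(n-2)/2+k(k-1)/2+l(l-1)/2}$ for $n$ even and $\mathtt s_{kl}=(-1)^{(n-1)/2+k(k-1)/2+l(l-1)/2}$ for $n$ odd. (ii) If $x_{1n}x_{n1}\ne0$, then for $i\in[2,n-1]$ and $j\in[2,i]$ $$g_{ij}(\Psi'(X))=(-1)^{(n+j+1)(i+j)}\frac{\mathtt g_{ij}(X)}{x_{1n}^{j-1}\det X}.$$ (iii) If $x_{1n}x_{n1}\ne0$, then $c_r(\Psi'(X))=\dfrac{\mathtt c_r(X)}{x_{1n}\det X}$ for $r\in[1,n-1]$. In particular, $c_{n-1}(\Psi'(X))=\det\Psi'(X)=x_{n1}/x_{1n}$. (iv) If $x_{1n}\ne0$, then $$\bar t_m^-(\Psi''(X))=\frac{\mathtt f_{2m-1}(X)}{x_{1n}^{2m-1}}\quad(m\in[1,n]),\qquad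 \bar t_m^+(\Psi''(X))=\frac{\mathtt f_{2m}(X)}{x_{1n}^{2m}}\quad(m\in[1,n-1]).$$ In particular, if moreover $\Psi''(X)\in\bar{\mathcal R}_{n-1}$, then $\bar t_{n-1}^+(\Psi''(X))\ne0$ and $\bar t_n^-(\Psi''(X))/\bar t_{n-1}^+(\Psi''(X))=x_{n1}/x_{1n}$. -/

import Mathlib

namespace CGPullback

open Polynomial

/-! Conventions. Rows and columns of all matrices are numbered from 1, as in the mathematical text:
the matrix entry with (one-based) position `(i, j)` is `ent X i j`, which is `0` outside the matrix.
Index sets are finite sets of (one-based) natural numbers. -/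

section Matrices

variable {K : Type*} [CommRing K]

/-- The entry in row `i` and column `j` (numbered from `1`), extended by zero outside the matrix. -/
def ent {m n : ℕ} (X : Matrix (Fin m) (Fin n) K) (i j : ℕ) : K :=
  if h : (1 ≤ i ∧ i ≤ m) ∧ (1 ≤ j ∧ j ≤ n) then
    X ⟨i - 1, by omega⟩ ⟨j - 1, by omega⟩
  else 0

/-- The minor of `U` in the rows `I` and the columns `J`, both in increasing order; by convention it
is `0` when `I` and `J` have different sizes. -/
def minor {m n : ℕ} (U : Matrix (Fin m) (Fin n) K) (I J : Finset ℕ) : K :=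
  if h : J.card = I.card then
    (Matrix.of fun a b : Fin I.card =>
      ent U (I.orderEmbOfFin rfl a) (J.orderEmbOfFin h b)).det
  else 0

/-! ### The initial cluster on the dual group (matrices of size `N`) -/

/-- First `k` columns of `U ^ 0`, then the first `l` columns of `U`, then the first columns of
`U ^ p` for `p = 2, …, N - k - l + 1`. -/
def dualPhiMatrix {N : ℕ} (k l : ℕ) (U : Matrix (Fin N) (Fin N) K) : Matrix (Fin N) (Fin N) K :=
  Matrix.of fun r c =>
    if (c : ℕ) < k then ent (U ^ 0) (r + 1) (c + 1)
    else if (c : ℕ) < k + l then ent U (r + 1) (c - k + 1)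
    else ent (U ^ ((c : ℕ) - (k + l) + 2)) (r + 1) 1

/-- The sign `s_{kl}^N`. -/
def dualSign (N k l : ℕ) : ℤ :=
  if Even N then (-1) ^ (k * (l + 1))
  else (-1) ^ ((N - 1) / 2 + k * (k - 1) / 2 + l * (l - 1) / 2)

/-- The functions `φ_{kl}` on `N × N` matrices. -/
def varphi {N : ℕ} (k l : ℕ) (U : Matrix (Fin N) (Fin N) K) : K :=
  (dualSign N k l : K) * (dualPhiMatrix k l U).det

/-- The map `γ^*` on index sets: shift by one to the left. -/
def gammaStar (I : Finset ℕ) : Finset ℕ := I.image fun a => a - 1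

/-- The map `γ` on index sets: shift by one to the right. -/
def gammaMap (I : Finset ℕ) : Finset ℕ := I.image fun a => a + 1

/-- The tuples `(I_1, …, I_{j-2})` of subsets of `[2, N]` with `|I_1| = N - i + 1` and
`|I_m| = N - j + m` for `2 ≤ m ≤ j - 2`; the set `I_m` is stored at position `m - 1`. -/
def indexTuples (N i j : ℕ) : Finset (Fin (j - 2) → Finset ℕ) :=
  Fintype.piFinset fun m : Fin (j - 2) =>
    Finset.powersetCard (if (m : ℕ) = 0 then N - i + 1 else N - j + (m + 1)) (Finset.Icc 2 N)

/-- The set `I_m`, `1 ≤ m ≤ j - 1`, where `I_{j-1} = [2, N]`. -/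
def tupleSet (N j : ℕ) (I : Fin (j - 2) → Finset ℕ) (m : ℕ) : Finset ℕ :=
  if h : m - 1 < j - 2 then I ⟨m - 1, h⟩ else Finset.Icc 2 N

/-- The functions `g_{ij}` on `N × N` matrices, `2 ≤ j ≤ i ≤ N`. -/
def gFun {N : ℕ} (i j : ℕ) (U : Matrix (Fin N) (Fin N) K) : K :=
  if j = 2 then minor U (Finset.Icc i N) (Finset.Icc 2 (N - i + 2))
  else
    ∑ I ∈ indexTuples N i j,
      minor U (Finset.Icc i N) (tupleSet N j I 1) *
      minor U (gammaStar (tupleSet N j I 1) ∪ Finset.Icc (N - i + j) N) (tupleSet N j I 2) *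
      ∏ m ∈ Finset.Icc 2 (j - 2),
        minor U (gammaStar (tupleSet N j I m) ∪ {N}) (tupleSet N j I (m + 1))

/-- The functions `c_r` on `N × N` matrices, given by
`det (1 + λ U) = 1 + ∑_{r = 1}^N (-1) ^ (r (N - 1)) λ ^ r c_r(U)`. -/
noncomputable def cFun {N : ℕ} (r : ℕ) (U : Matrix (Fin N) (Fin N) K) : K :=
  (-1) ^ (r * (N - 1)) * ((1 + (X : K[X]) • U.map C).det).coeff r

/-! ### Matrices built from the entries of an `n × n` matrix -/

/-- The entry in position `(s, c)` (numbered from `0`) of the matrix obtained from the rows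
of `X` with indices in `I` by adding `d` zero columns on the left, and zero columns on the right. The
rows below the last one are zero. -/
def rowsEntry {n : ℕ} (X : Matrix (Fin n) (Fin n) K) (I : Finset ℕ) (d s c : ℕ) : K :=
  ent X (I.sort.getD s 0) (c + 1 - d)

/-- The set `I ∪ {n}` of rows of `X` in the second tier of the block column `t` (numbered from `0`) of
`Φ_{kl}(X)`: `I = [2, n - 1]`, or `I = [l + 1, n - 1]` in the last block column. -/
def secondTier (n k l t : ℕ) : Finset ℕ :=
  (if t + 1 = n - k - l then Finset.Icc (l + 1) (n - 1) else Finset.Icc 2 (n - 1)) ∪ {n}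

/-- The set `{1} ∪ γ(J)` of rows of `X` in the third tier of the block column `t` (numbered from `0`)
of `Φ_{kl}(X)`: `J = [2, n - 1]`, or `J = [l + 1, n - 1]` in the second block column from the right,
or `J = [k + 1, n - 1]` in the last block column. -/
def thirdTier (n k l t : ℕ) : Finset ℕ :=
  {1} ∪ gammaMap
    (if t + 1 = n - k - l then Finset.Icc (k + 1) (n - 1)
     else if t + 2 = n - k - l then Finset.Icc (l + 1) (n - 1)
     else Finset.Icc 2 (n - 1))

/-- The matrix `Φ_{kl}(X)`, with `n - k - l` block columns of width `n + 1`. The block column `t`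
(numbered from `0`) consists of `t n` zero rows, the second tier `[X_{I ∪ n} 0]`, the third tier
`[0 X_{1 ∪ γ(J)}]`, and zero rows. -/
def bigPhi {n : ℕ} (k l : ℕ) (X : Matrix (Fin n) (Fin n) K) :
    Matrix (Fin ((n - k - l) * (n + 1))) (Fin ((n - k - l) * (n + 1))) K :=
  Matrix.of fun r c =>
    let t := (c : ℕ) / (n + 1)
    let c' := (c : ℕ) % (n + 1)
    if (r : ℕ) < t * n then 0
    else if (r : ℕ) < t * n + (secondTier n k l t).card then
      rowsEntry X (secondTier n k l t) 0 (r - t * n) c'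
    else
      rowsEntry X (thirdTier n k l t) 1 (r - (t * n + (secondTier n k l t).card)) c'

/-- `φ_{kl}(X) = det Φ_{kl}(X)`. -/
def phiX {n : ℕ} (k l : ℕ) (X : Matrix (Fin n) (Fin n) K) : K := (bigPhi k l X).det

/-- The pairs (row index of `X`, number of initial zero columns) for the successive rows of the
matrix `G(I_1, …, I_k)` in which `X_{I_1}, …, X_{I_k}` are stacked one below the other, each block
being shifted by one column to the right with respect to the block above it. -/
def stackedRows (L : List (Finset ℕ)) : List (ℕ × ℕ) :=
  (L.mapIdx fun d I => I.sort.map fun a => (a, d)).flatten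

/-- The index sets `{1, n}` (`j - 2` times), `{1} ∪ [n + j - i, n]`, `{1} ∪ [i + 1, n]`. -/
def gSets (n i j : ℕ) : List (Finset ℕ) :=
  List.replicate (j - 2) ({1, n} : Finset ℕ) ++
    [{1} ∪ Finset.Icc (n + j - i) n, {1} ∪ Finset.Icc (i + 1) n]

/-- The matrix `G_{ij}(X) = G({1, n}^{j - 2}, {1} ∪ [n + j - i, n], {1} ∪ [i + 1, n])`, which is a
square matrix of size `n + j - 1` for `2 ≤ j ≤ i ≤ n - 1`. -/
def bigG {n : ℕ} (i j : ℕ) (X : Matrix (Fin n) (Fin n) K) :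
    Matrix (Fin (n + j - 1)) (Fin (n + j - 1)) K :=
  Matrix.of fun r c =>
    let p := (stackedRows (gSets n i j)).getD r (0, 0)
    ent X p.1 (c + 1 - p.2)

/-- `g_{ij}(X) = det G_{ij}(X)`. -/
def gX {n : ℕ} (i j : ℕ) (X : Matrix (Fin n) (Fin n) K) : K := (bigG i j X).det

/-- The matrix `A(X)` of size `n + 1`: the first `n` rows of its last `n - 1` columns are the first
`n - 1` columns of `X`; all other entries are zero. -/
def matA {n : ℕ} (X : Matrix (Fin n) (Fin n) K) : Matrix (Fin (n + 1)) (Fin (n + 1)) K :=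
  Matrix.of fun r c => if (r : ℕ) < n ∧ 2 ≤ (c : ℕ) then ent X (r + 1) (c - 1) else 0

/-- The matrix `B(X)` of size `n + 1`: the first `n` entries of its first column form the last column
of `X`, and its lower right `n × n` block is `X`; all other entries are zero. -/
def matB {n : ℕ} (X : Matrix (Fin n) (Fin n) K) : Matrix (Fin (n + 1)) (Fin (n + 1)) K :=
  Matrix.of fun r c => if (c : ℕ) = 0 then ent X (r + 1) n else ent X r c

/-- `c_r(X)` is `(-1) ^ (r n)` times the coefficient at `λ ^ r` of `det (λ A(X) + B(X))`. -/
noncomputable def cX {n : ℕ} (r : ℕ) (M : Matrix (Fin n) (Fin n) K) : K :=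
  (-1) ^ (r * n) * (((X : K[X]) • (matA M).map C + (matB M).map C).det).coeff r

/-- The matrix `F(X)` of size `2 n - 1`: the row `2 i + 1` is the last row of `X` preceded by
`i` zeros, and the row `2 i` is the first row of `X` preceded by `i` zeros. -/
def matF {n : ℕ} (X : Matrix (Fin n) (Fin n) K) : Matrix (Fin (2 * n - 1)) (Fin (2 * n - 1)) K :=
  Matrix.of fun r c =>
    if Even (r : ℕ) then ent X n (c + 1 - r / 2) else ent X 1 (c + 1 - (r + 1) / 2)

/-- `f_m(X)` is the trailing minor of size `m` of `F(X)`. -/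
def fX {n : ℕ} (m : ℕ) (X : Matrix (Fin n) (Fin n) K) : K :=
  minor (matF X) (Finset.Icc (2 * n - m) (2 * n - 1)) (Finset.Icc (2 * n - m) (2 * n - 1))

end Matrices

/-! ### The map from `GL_n` to `GL_{n-1}` -/

/-- The Schur complement
`X_L = X_{[2,n]}^{[1,n-1]} - X_{[2,n]}^{[n,n]} x_{1n}⁻¹ X_{[1,1]}^{[1,n-1]}` of `x_{1n}`. -/
noncomputable def matXL {n : ℕ} (X : Matrix (Fin n) (Fin n) ℂ) :
    Matrix (Fin (n - 1)) (Fin (n - 1)) ℂ :=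
  Matrix.of fun r c =>
    ent X (r + 2) (c + 1) - ent X (r + 2) n * (ent X 1 n)⁻¹ * ent X 1 (c + 1)

/-- The Schur complement
`X_R = X_{[1,n-1]}^{[2,n]} - X_{[1,n-1]}^{[1,1]} x_{n1}⁻¹ X_{[n,n]}^{[2,n]}` of `x_{n1}`. -/
noncomputable def matXR {n : ℕ} (X : Matrix (Fin n) (Fin n) ℂ) :
    Matrix (Fin (n - 1)) (Fin (n - 1)) ℂ :=
  Matrix.of fun r c =>
    ent X (r + 1) (c + 2) - ent X (r + 1) 1 * (ent X n 1)⁻¹ * ent X n (c + 2)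

/-- The map `X ↦ U = X_L X_R⁻¹`, defined on the set of `X ∈ GL_n` with `x_{1n} x_{n1} ≠ 0`. -/
noncomputable def psiOne {n : ℕ} (X : Matrix (Fin n) (Fin n) ℂ) :
    Matrix (Fin (n - 1)) (Fin (n - 1)) ℂ :=
  matXL X * (matXR X)⁻¹

/-! ### Rational functions of one variable -/

/-- The space `R̄_d` of rational functions `q̄ / p` with `p` monic of degree `d` and `q̄` of degree at
most `d` and coprime with `p`. -/
def RBar (d : ℕ) : Set (RatFunc ℂ) :=
  {M | ∃ p q : ℂ[X], p.Monic ∧ p.natDegree = d ∧ q.natDegree ≤ d ∧ IsCoprime q p ∧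
    M = algebraMap ℂ[X] (RatFunc ℂ) q / algebraMap ℂ[X] (RatFunc ℂ) p}

/-- The Laurent expansion at infinity of a rational function of `λ`, as a Laurent series in
`z = λ⁻¹`. -/
noncomputable def expansionAtInfinity (M : RatFunc ℂ) : LaurentSeries ℂ :=
  M.eval (HahnSeries.C : ℂ →+* LaurentSeries ℂ) (HahnSeries.single (-1) 1)

/-- The coefficient `h̄_i` of `λ ^ (-i)` in the Laurent expansion of `M` at infinity. -/
noncomputable def moment (M : RatFunc ℂ) (i : ℕ) : ℂ :=
  (expansionAtInfinity M).coeff (i : ℤ)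

/-- `t̄_m^-`, the determinant of the Hankel matrix `(h̄_{α + β - 2})`, `1 ≤ α, β ≤ m`. -/
noncomputable def tBarMinus (m : ℕ) (M : RatFunc ℂ) : ℂ :=
  (Matrix.of fun a b : Fin m => moment M (a + b)).det

/-- `t̄_m^+`, equal to `(-1) ^ m` times the determinant of the Hankel matrix `(h̄_{α + β - 1})`,
`1 ≤ α, β ≤ m`. -/
noncomputable def tBarPlus (m : ℕ) (M : RatFunc ℂ) : ℂ :=
  (-1) ^ m * (Matrix.of fun a b : Fin m => moment M (a + b + 1)).det

/-- The polynomial `∑_{i = 0}^{n-1} (x_{a,i+1} / x_{1n}) λ ^ i`. -/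
noncomputable def rowPoly {n : ℕ} (a : ℕ) (M : Matrix (Fin n) (Fin n) ℂ) : ℂ[X] :=
  ∑ i ∈ Finset.range n, C (ent M a (i + 1) / ent M 1 n) * X ^ i

/-- The map sending `X` with `x_{1n} ≠ 0` to the rational function `q̄ / p` with
`q̄_i = x_{n,i+1} / x_{1n}` and `p_i = x_{1,i+1} / x_{1n}`, `0 ≤ i ≤ n - 1`. -/
noncomputable def psiTwo {n : ℕ} (X : Matrix (Fin n) (Fin n) ℂ) : RatFunc ℂ :=
  algebraMap ℂ[X] (RatFunc ℂ) (rowPoly n X) / algebraMap ℂ[X] (RatFunc ℂ) (rowPoly 1 X)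

/-! ### The signs in the formulas -/

/-- The sign `s_{kl}` for given `n`. -/
def signPhi (n k l : ℕ) : ℤ :=
  if Even n then (-1) ^ ((n - 2) / 2 + k * (k - 1) / 2 + l * (l - 1) / 2)
  else (-1) ^ ((n - 1) / 2 + k * (k - 1) / 2 + l * (l - 1) / 2)

/-- The sign `ŝ_{ij}` for given `n`. -/
def signG (n i j : ℕ) : ℤ := (-1) ^ ((n + j + 1) * (i + j))

end CGPullback

open CGPullback

/-! Write `n = N + 1`, `U = X_L X_R⁻¹`, let `X_a` be the `a`-th row of `X` viewed as a polynomial in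
`λ` (column `c` being the coefficient of `λ ^ (c - 1)`), so that a shift by one column is
multiplication by `λ`.

The formulas for `Ψ'` all come from one identity, `exists_ent_shift_eq`: for `1 ≤ s ≤ N`,
`λ X_{s+1} = ∑_j U_{sj} X_j + b_s X_n + a_s λ X_1` with scalars `a_s`, `b_s`. It is the equation
`U X_R = X_L` with the Schur complements written out. The tool that is used throughout is a Laplace
expansion with a vanishing complementary block, `det_eq_of_complementary_block_zero`.

* For `c_r`, two row operations on `λ A + B` leave `x_{1n} x_{n1} det (X_R + λ X_L)` up to sign, and
  `X_R + λ X_L = (1 + λ U) X_R` (`det_matA_add_matB`).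
* For `φ_{kl}`, the rows of each block column of `Φ_{kl}(X)` are combinations of `X_1, …, X_n, λ X_1`,
  a basis of determinant `x_{1n} det X`. The matrix of coefficients consists of unit vectors and of
  vectors `U_s`; multiplying it by the unitriangular `kernelMatrix` made of the vectors
  `(-U) ^ p e_1` clears all but the last few rows of `n - k - 1` columns, and the remaining minor
  has the columns `U (-U) ^ p e_1` and `U e_s`, which up to order and sign are the columns of the dual
  matrix `Φ_{kl}(U)` other than unit vectors (`det_reducedPhi`, `det_phiCore`).
* For `g_{ij}`, iterated Cauchy–Binet summation turns the sum of products of minors into a single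
  determinant of size `N` whose rows are rows of powers of `W`, the matrix `U` with its columns shifted
  by one (`gFun_eq_det`). By the iterated identity `exists_ent_shift_pow_eq`,
  `λ ^ d X_{r+1} = ∑_s (W ^ d)_{rs} X_{s+1}` modulo shifts of `X_1` and `X_n`. In `G_{ij}(X)` the shifts
  of `X_n` are removed by row operations, the rows of `X` and the shifts of `X_1` give the factor
  `x_{1n} ^ (j - 1) det X`, and expansion along the shifts of `X_1` leaves the same rows of powers
  of `W` in a different order (`det_stacked_eq`, `det_gMatrix_eq`).

For `Ψ''`, let `p`, `q` be the power series in `z = 1 / λ` obtained by reversing the two polynomials;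
`p` has constant term `1` and the moments are the coefficients of `h = q / p`. Reversed, the rows of
`F(X)` are `q, p, z q, z p, …`; dividing by `p` is a unitriangular column operation and leaves
`h, 1, z h, z, …`, and expansion along the powers of `z` gives Hankel determinants (`fX_eq_hankel`).
The quotient is obtained by expanding `f_{2n-1}` along its first column (`fX_last`), and `f_{2n-2}` is
up to a power of `x_{1n}` and a sign the resultant of the two polynomials, which does not vanish when
the fraction is in lowest terms (`fX_ne_zero`). -/

namespace CGPullback

open Finset Matrix Equiv.Perm

/-! ### Signs of permutations, Laplace expansion and the Cauchy–Binet formula -/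

section Determinants

variable {K : Type*} [CommRing K]

/-- The sign of a permutation is the parity of its number of inversions, counted by their
right ends. -/
theorem sign_eq_pow_inversions {s : ℕ} (σ : Equiv.Perm (Fin s)) :
    (sign σ : ℤ) = (-1) ^ ∑ j, #{i ∈ Iio j | σ j < σ i} := by
  rw [sign_eq_prod_prod_Iio, ← prod_pow_eq_pow_sum]
  push_cast
  refine prod_congr rfl fun j _ => ?_
  rw [← prod_const, prod_filter]
  refine prod_congr rfl fun i hi => ?_
  have : σ i ≠ σ j := fun h => (mem_Iio.1 hi).ne (σ.injective h)
  rcases lt_or_gt_of_ne this with h | h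
  · simp [h, h.not_gt]
  · simp [h, h.not_gt]

theorem det_submatrix_eq_pow_inversions {s : ℕ} (σ : Equiv.Perm (Fin s))
    (M : Matrix (Fin s) (Fin s) K) (c : Fin s → ℕ)
    (hc : ∀ j, #{i ∈ Iio j | σ j < σ i} = c j) :
    (M.submatrix σ id).det = (-1) ^ (∑ j, c j) * M.det := by
  rw [det_permute, sign_eq_pow_inversions]
  simp [hc]

/-- The sign of the unshuffle that lists first a set of positions (the range of `g`) and then its
complement (the range of `f`), each in increasing order. -/
theorem sign_append {p q : ℕ} (g : Fin p → Fin (p + q)) (f : Fin q → Fin (p + q))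
    (hg : StrictMono g) (hf : StrictMono f) (σ : Equiv.Perm (Fin (p + q)))
    (hσ : ∀ i, σ i = Fin.append g f i) :
    (sign σ : ℤ) = (-1) ^ ∑ b : Fin q, (p + (b : ℕ) + (f b : ℕ)) := by
  have hc : ∀ b : Fin q, #{i ∈ Iio (Fin.natAdd p b) | σ (Fin.natAdd p b) < σ i} + (f b : ℕ)
      = p + b := by
    intro b
    have h1 : #{i | σ (Fin.natAdd p b) < σ i} = p + q - 1 - f b := by
      have : ({i | σ (Fin.natAdd p b) < σ i} : Finset _)
          = (Ioi (f b)).map σ.symm.toEmbedding := by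
        ext i
        simp only [mem_filter, mem_univ, true_and, mem_map, mem_Ioi, Equiv.coe_toEmbedding]
        rw [hσ (Fin.natAdd p b), Fin.append_right]
        exact ⟨fun h => ⟨σ i, h, by simp⟩, by rintro ⟨x, hx, rfl⟩; simpa using hx⟩
      rw [this, card_map, Fin.card_Ioi]
    have h2 : ({i | σ (Fin.natAdd p b) < σ i} : Finset _)
        = {i ∈ Iio (Fin.natAdd p b) | σ (Fin.natAdd p b) < σ i} ∪ Ioi (Fin.natAdd p b) := by
      ext i
      simp only [mem_filter, mem_univ, true_and, mem_union, mem_Ioi, mem_Iio]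
      constructor
      · intro h
        rcases lt_trichotomy i (Fin.natAdd p b) with h' | h' | h'
        · exact Or.inl ⟨h', h⟩
        · subst h'; exact absurd h (lt_irrefl _)
        · exact Or.inr h'
      · rintro (⟨_, h⟩ | h)
        · exact h
        · induction i using Fin.addCases with
          | left i =>
            rw [Fin.lt_def] at h
            simp only [Fin.val_natAdd, Fin.val_castAdd] at h
            omega
          | right i =>
            rw [hσ, hσ, Fin.append_right, Fin.append_right]
            apply hf
            rw [Fin.lt_def] at h ⊢
            simpa using h
    have h3 : Disjoint {i ∈ Iio (Fin.natAdd p b) | σ (Fin.natAdd p b) < σ i}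
        (Ioi (Fin.natAdd p b)) := by
      rw [Finset.disjoint_left]
      intro i hi hi'
      exact (mem_Ioi.1 hi').not_gt (mem_Iio.1 (mem_filter.1 hi).1)
    have h4 := card_union_of_disjoint h3
    rw [← h2, h1, Fin.card_Ioi, Fin.val_natAdd] at h4
    have := (f b).2
    have := b.2
    omega
  rw [sign_eq_pow_inversions, Fin.sum_univ_add]
  have h0 : ∀ i : Fin p, #{x ∈ Iio (Fin.castAdd q i) | σ (Fin.castAdd q i) < σ x} = 0 := by
    intro i
    rw [card_eq_zero, filter_eq_empty_iff]
    intro x hx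
    have hx := mem_Iio.1 hx
    have : ∃ y : Fin p, x = Fin.castAdd q y ∧ y < i := by
      rw [Fin.lt_def] at hx
      exact ⟨⟨x, by have := i.2; simp at hx; omega⟩, by ext; simp, by simpa [Fin.lt_def] using hx⟩
    obtain ⟨y, rfl, hy⟩ := this
    rw [hσ, hσ, Fin.append_left, Fin.append_left]
    exact (hg hy).not_gt
  simp only [h0, sum_const_zero, zero_add]
  rw [← prod_pow_eq_pow_sum, ← prod_pow_eq_pow_sum]
  refine prod_congr rfl fun b _ => ?_
  rw [← hc b, add_assoc, ← two_mul, pow_add, pow_mul]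
  simp

/-- Laplace expansion when one complementary block vanishes: rows and columns are split into
pivots (`gr`, `gc`) and the remaining ones (`fr`, `fc`). -/
theorem det_eq_of_complementary_block_zero {s p q : ℕ} (hs : p + q = s)
    (M : Matrix (Fin s) (Fin s) K)
    (gr gc : Fin p → Fin s) (fr fc : Fin q → Fin s)
    (hgr : StrictMono gr) (hgc : StrictMono gc) (hfr : StrictMono fr) (hfc : StrictMono fc)
    (hr : ∀ i j, gr i ≠ fr j) (hc : ∀ i j, gc i ≠ fc j)
    (h0 : ∀ i j, M (gr i) (fc j) = 0) :
    M.det = (-1) ^ (∑ b : Fin q, ((fr b : ℕ) + (fc b : ℕ))) * (M.submatrix gr gc).det *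
      (M.submatrix fr fc).det := by
  subst hs
  have key : ∀ (g : Fin p → Fin (p + q)) (f : Fin q → Fin (p + q)), StrictMono g → StrictMono f →
      (∀ i j, g i ≠ f j) → Function.Bijective (Fin.append g f) := by
    intro g f hg hf hd
    rw [Fintype.bijective_iff_injective_and_card]
    refine ⟨?_, rfl⟩
    intro a b
    induction a using Fin.addCases <;> induction b using Fin.addCases <;>
      simp only [Fin.append_left, Fin.append_right]
    · intro h; rw [hg.injective h]
    · intro h; exact absurd h (hd _ _)
    · intro h; exact absurd h.symm (hd _ _)
    · intro h; rw [hf.injective h]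
  set σ := Equiv.ofBijective _ (key gr fr hgr hfr hr) with hσ
  set τ := Equiv.ofBijective _ (key gc fc hgc hfc hc) with hτ
  have h1 := sign_append gr fr hgr hfr σ (fun i => rfl)
  have h2 := sign_append gc fc hgc hfc τ (fun i => rfl)
  have h3 : (M.submatrix σ τ).det = (sign σ : ℤ) * (sign τ : ℤ) * M.det := by
    have : M.submatrix σ τ = (M.submatrix σ id).submatrix id τ := rfl
    rw [this, det_permute', det_permute]
    ring
  have h4 : (M.submatrix σ τ).det = (M.submatrix gr gc).det * (M.submatrix fr fc).det := by
    rw [← det_submatrix_equiv_self finSumFinEquiv, ← det_fromBlocks_zero₁₂ _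
      (M.submatrix fr gc)]
    congr 1
    ext (i | i) (j | j) <;> simp [hσ, hτ, h0]
  have h5 : ((sign σ : ℤ) * (sign τ : ℤ) : ℤ) = (-1) ^ (∑ b : Fin q, ((fr b : ℕ) + (fc b : ℕ))) := by
    rw [h1, h2, ← pow_add, ← sum_add_distrib, ← prod_pow_eq_pow_sum, ← prod_pow_eq_pow_sum]
    refine prod_congr rfl fun b _ => ?_
    rw [show p + (b : ℕ) + (fr b : ℕ) + (p + (b : ℕ) + (fc b : ℕ))
      = 2 * (p + b) + ((fr b : ℕ) + (fc b : ℕ)) by ring, pow_add, pow_mul]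
    simp
  have h6 : ((sign σ : ℤ) : K) * ((sign τ : ℤ) : K) = (-1) ^ (∑ b : Fin q, ((fr b : ℕ) + (fc b : ℕ))) := by
    rw [← Int.cast_mul, h5]; simp
  rw [h6, h4] at h3
  rw [mul_assoc, h3, ← mul_assoc, ← pow_add, ← two_mul, pow_mul]
  simp

/-- The element of `I` at position `a` (numbered from `0`) in increasing order; `0` if there is
none. -/
def nthElt (I : Finset ℕ) (a : ℕ) : ℕ :=
  if h : a < I.card then I.orderEmbOfFin rfl ⟨a, h⟩ else 0

theorem orderEmbOfFin_eq_nthElt {q : ℕ} (I : Finset ℕ) (h : I.card = q) (a : Fin q) :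
    I.orderEmbOfFin h a = nthElt I a := by
  subst h
  simp [nthElt]

theorem nthElt_mem {I : Finset ℕ} {a : ℕ} (h : a < I.card) : nthElt I a ∈ I := by
  simp [nthElt, h, orderEmbOfFin_mem]

theorem nthElt_eq_of_strictMono {q : ℕ} (I : Finset ℕ) (h : I.card = q) (f : ℕ → ℕ)
    (hf : ∀ a < q, f a ∈ I) (hm : ∀ a b, a < b → b < q → f a < f b) {a : ℕ} (ha : a < q) :
    nthElt I a = f a := by
  have := Finset.orderEmbOfFin_unique h (f := fun a : Fin q => f a) (fun x => hf x x.2)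
    (fun x y hxy => hm x y hxy y.2)
  rw [← orderEmbOfFin_eq_nthElt I h ⟨a, ha⟩, ← this]

/-- The Cauchy–Binet formula for an alternating map, evaluated on linear combinations of a family
indexed by a finite set of natural numbers. -/
theorem alternatingMap_sum_smul {q : ℕ} {M : Type*} [AddCommGroup M] [Module K M]
    (D : M [⋀^Fin q]→ₗ[K] K) (S : Finset ℕ) (A : Fin q → ℕ → K) (v : ℕ → M) :
    D (fun i => ∑ s ∈ S, A i s • v s) =
      ∑ I ∈ powersetCard q S, (Matrix.of fun i j : Fin q => A i (nthElt I j)).det *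
        D (fun i => v (nthElt I i)) := by
  classical
  have e1 : D (fun i => ∑ s ∈ S, A i s • v s)
      = ∑ f ∈ Fintype.piFinset (fun _ : Fin q => S), (∏ i, A i (f i)) * D (fun i => v (f i)) := by
    refine (D.toMultilinearMap.map_sum_finset (fun i s => A i s • v s) (fun _ => S)).trans
      (sum_congr rfl fun f _ => ?_)
    exact D.toMultilinearMap.map_smul_univ (fun i => A i (f i)) (fun i => v (f i))
  rw [e1]
  have e2 : ∑ f ∈ Fintype.piFinset (fun _ : Fin q => S),
        (∏ i, A i (f i)) * D (fun i => v (f i))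
      = ∑ f ∈ (Fintype.piFinset (fun _ : Fin q => S)).filter Function.Injective,
        (∏ i, A i (f i)) * D (fun i => v (f i)) := by
    rw [sum_filter_of_ne]
    intro f _ hne
    by_contra hf
    rw [Function.Injective] at hf
    push Not at hf
    obtain ⟨a, b, hab, hne'⟩ := hf
    exact hne (by rw [D.map_eq_zero_of_eq _ (by simp [hab]) hne', mul_zero])
  rw [e2, ← sum_fiberwise_of_maps_to (t := powersetCard q S) (g := fun f => univ.image f)]
  · refine sum_congr rfl fun I hI => ?_
    obtain ⟨hIS, hIc⟩ := mem_powersetCard.1 hI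
    have hn : ∀ a : Fin q, nthElt I a ∈ I := fun a => nthElt_mem (by rw [hIc]; exact a.2)
    have hinj : Function.Injective (fun a : Fin q => nthElt I a) := by
      intro a b hab
      simp only [← orderEmbOfFin_eq_nthElt I hIc] at hab
      exact (I.orderEmbOfFin hIc).injective hab
    have himg : univ.image (fun a : Fin q => nthElt I a) = I := by
      apply eq_of_subset_of_card_le
      · intro x hx
        obtain ⟨a, _, rfl⟩ := mem_image.1 hx
        exact hn a
      · rw [card_image_of_injective _ hinj]; simp [hIc]
    have e3 : ∑ f ∈ ((Fintype.piFinset (fun _ : Fin q => S)).filter Function.Injective).filter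
          (fun f => univ.image f = I),
        (∏ i, A i (f i)) * D (fun i => v (f i))
        = ∑ σ : Equiv.Perm (Fin q), (∏ i, A i (nthElt I (σ i))) *
          D (fun i => v (nthElt I (σ i))) := by
      symm
      refine sum_bij (fun σ _ i => nthElt I (σ i)) ?_ ?_ ?_ ?_
      · intro σ _
        simp only [mem_filter, Fintype.mem_piFinset]
        refine ⟨⟨fun i => hIS (hn _), fun a b hab => σ.injective (hinj hab)⟩, ?_⟩
        rw [← himg]
        ext x
        simp only [mem_image, mem_univ, true_and]
        exact ⟨fun ⟨a, h⟩ => ⟨σ a, by simpa [himg] using h⟩,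
          fun ⟨a, h⟩ => ⟨σ.symm a, by simpa [himg] using h⟩⟩
      · intro σ _ τ _ h
        ext i
        exact congrArg Fin.val (hinj (congrFun h i))
      · intro f hf
        simp only [mem_filter, Fintype.mem_piFinset] at hf
        obtain ⟨⟨_, hfi⟩, hfI⟩ := hf
        have : ∀ i, ∃ a : Fin q, nthElt I a = f i := by
          intro i
          have : f i ∈ univ.image (fun a : Fin q => nthElt I a) := by
            rw [himg, ← hfI]; exact mem_image_of_mem _ (mem_univ _)
          obtain ⟨a, _, h⟩ := mem_image.1 this
          exact ⟨a, h⟩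
        choose σ hσ using this
        have hσi : Function.Injective σ := fun a b h => hfi (by rw [← hσ a, ← hσ b, h])
        refine ⟨Equiv.ofBijective σ (Finite.injective_iff_bijective.1 hσi), mem_univ _, ?_⟩
        ext i
        simp [hσ]
      · intro σ _; rfl
    rw [e3]
    have e4 : ∀ σ : Equiv.Perm (Fin q), D (fun i => v (nthElt I (σ i)))
        = (sign σ : ℤ) * D (fun i => v (nthElt I i)) := fun σ => by
      rw [← zsmul_eq_mul]
      exact D.map_perm (fun i => v (nthElt I i)) σ
    simp only [e4]
    rw [← det_transpose (Matrix.of fun i j : Fin q => A i (nthElt I j)),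
      det_apply' (Matrix.of fun i j : Fin q => A i (nthElt I j))ᵀ, sum_mul]
    refine sum_congr rfl fun σ _ => ?_
    simp only [transpose_apply, of_apply]
    ring
  · intro f hf
    simp only [mem_filter, Fintype.mem_piFinset] at hf
    rw [mem_powersetCard]
    refine ⟨fun x hx => ?_, by rw [card_image_of_injective _ hf.2]; simp⟩
    obtain ⟨a, _, rfl⟩ := mem_image.1 hx
    exact hf.1 a

end Determinants

/-! ### The pencil identity for `X_L X_R⁻¹` and the coefficients of the characteristic polynomial -/

section Entries

variable {K : Type*} [CommRing K]

theorem ent_succ_succ {m n : ℕ} (X : Matrix (Fin m) (Fin n) K) (i : Fin m) (j : Fin n) :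
    ent X (i + 1) (j + 1) = X i j := by
  simp [ent, i.2, j.2]

theorem ent_eq_apply {m n : ℕ} (X : Matrix (Fin m) (Fin n) K) {i j : ℕ} (i' : Fin m) (j' : Fin n)
    (hi : i = i' + 1) (hj : j = j' + 1) : ent X i j = X i' j' := by
  subst hi hj; exact ent_succ_succ X i' j'

theorem ent_col_zero {m n : ℕ} (X : Matrix (Fin m) (Fin n) K) (i : ℕ) : ent X i 0 = 0 := by
  simp [ent]

theorem ent_row_zero {m n : ℕ} (X : Matrix (Fin m) (Fin n) K) (j : ℕ) : ent X 0 j = 0 := by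
  simp [ent]

theorem ent_of_col_gt {m n : ℕ} (X : Matrix (Fin m) (Fin n) K) (i : ℕ) {j : ℕ} (h : n < j) :
    ent X i j = 0 := by
  simp [ent]; omega

theorem ent_of_row_gt {m n : ℕ} (X : Matrix (Fin m) (Fin n) K) {i : ℕ} (j : ℕ) (h : m < i) :
    ent X i j = 0 := by
  simp [ent]; omega

theorem det_eq_of_column_zero_eq_single {N : ℕ} (A : Matrix (Fin (N + 1)) (Fin (N + 1)) K)
    (i₀ : Fin (N + 1)) (h : ∀ i, i ≠ i₀ → A i 0 = 0) :
    A.det = (-1) ^ (i₀ : ℕ) * A i₀ 0 * (A.submatrix i₀.succAbove Fin.succ).det := by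
  rw [det_succ_column_zero]
  exact sum_eq_single i₀ (fun i _ hi => by simp [h i hi]) (by simp)

end Entries

section Pencil

variable {N : ℕ} {X : Matrix (Fin (N + 1)) (Fin (N + 1)) ℂ}

theorem matXR_apply (r c : Fin N) : matXR X r c = ent X (r + 1) (c + 2) -
    ent X (r + 1) 1 * (ent X (N + 1) 1)⁻¹ * ent X (N + 1) (c + 2) := rfl

theorem matXL_apply (r c : Fin N) : matXL X r c = ent X (r + 2) (c + 1) -
    ent X (r + 2) (N + 1) * (ent X 1 (N + 1))⁻¹ * ent X 1 (c + 1) := rfl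

/-- The Schur complement formula for the lower left entry `x_{n1}`. -/
theorem det_eq_mul_det_matXR (hn1 : ent X (N + 1) 1 ≠ 0) :
    X.det = (-1) ^ N * ent X (N + 1) 1 * (matXR X).det := by
  have hl : ent X (N + 1) 1 = X (Fin.last N) 0 := ent_eq_apply X _ _ (by simp) (by simp)
  set c : Fin (N + 1) → ℂ := fun i => if i = Fin.last N then 0 else X i 0 * (ent X (N + 1) 1)⁻¹
  have h1 : X.det = (Matrix.of fun i j => X i j - c i * X (Fin.last N) j).det := by
    refine det_eq_of_forall_row_eq_smul_add_const c (Fin.last N) (by simp [c]) fun i j => ?_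
    simp [c]
  rw [h1, det_eq_of_column_zero_eq_single _ (Fin.last N)]
  · congr 1
    · simp [c, hl]
    · congr 1
      ext i j
      rw [submatrix_apply, of_apply, Fin.succAbove_last, matXR_apply]
      simp only [c]
      rw [if_neg (Fin.castSucc_lt_last i).ne,
        ent_eq_apply X (i := i + 1) (j := j + 2) i.castSucc j.succ (by simp) (by simp),
        ent_eq_apply X (i := i + 1) (j := 1) i.castSucc 0 (by simp) (by simp),
        ent_eq_apply X (i := N + 1) (j := j + 2) (Fin.last N) j.succ (by simp) (by simp)]
  · intro i hi
    simp only [of_apply, c, if_neg hi, hl] at hn1 ⊢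
    field_simp
    ring

/-- The Schur complement formula for the upper right entry `x_{1n}`. -/
theorem det_eq_mul_det_matXL (h1n : ent X 1 (N + 1) ≠ 0) :
    X.det = (-1) ^ N * ent X 1 (N + 1) * (matXL X).det := by
  have hl : ent X 1 (N + 1) = X 0 (Fin.last N) := ent_eq_apply X _ _ (by simp) (by simp)
  set c : Fin (N + 1) → ℂ := fun i => if i = 0 then 0 else X i (Fin.last N) * (ent X 1 (N + 1))⁻¹
  have h1 : X.det = (Matrix.of fun i j => X i j - c i * X 0 j).det := by
    refine det_eq_of_forall_row_eq_smul_add_const c 0 (by simp [c]) fun i j => ?_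
    simp [c]
  rw [h1, det_succ_column _ (Fin.last N), sum_eq_single 0]
  · congr 1
    · simp [c, hl]
    · congr 1
      ext i j
      rw [submatrix_apply, of_apply, Fin.succAbove_last, Fin.succAbove_zero, matXL_apply]
      simp only [c]
      rw [if_neg (Fin.succ_ne_zero i),
        ent_eq_apply X (i := i + 2) (j := j + 1) i.succ j.castSucc (by simp) (by simp),
        ent_eq_apply X (i := i + 2) (j := N + 1) i.succ (Fin.last N) (by simp) (by simp),
        ent_eq_apply X (i := 1) (j := j + 1) 0 j.castSucc (by simp) (by simp)]
  · intro i _ hi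
    have : X i (Fin.last N) - c i * X 0 (Fin.last N) = 0 := by
      simp only [c, if_neg hi, hl] at h1n ⊢
      field_simp
      ring
    simp [this]
  · simp

theorem psiOne_mul_matXR (hX : X.det ≠ 0) (hn1 : ent X (N + 1) 1 ≠ 0) :
    psiOne X * matXR X = matXL X := by
  rw [det_eq_mul_det_matXR hn1] at hX
  have : IsUnit (matXR X).det := (right_ne_zero_of_mul hX).isUnit
  rw [psiOne, Matrix.mul_assoc, nonsing_inv_mul _ this, Matrix.mul_one]

/-- Modulo the first and the last row of `X`, the rows `X_{s+1}` shifted by one column are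
the combinations of the rows `X_j` given by the matrix `U = X_L X_R⁻¹`. All three determinantal
formulas for `U` follow from this identity. -/
theorem exists_ent_shift_eq (hX : X.det ≠ 0) (h1n : ent X 1 (N + 1) ≠ 0)
    (hn1 : ent X (N + 1) 1 ≠ 0) :
    ∃ a b : Fin N → ℂ, ∀ (s : Fin N) (c : ℕ), ent X (s + 2) (c - 1) =
      ∑ j : Fin N, psiOne X s j * ent X (j + 1) c + b s * ent X (N + 1) c +
        a s * ent X 1 (c - 1) := by
  refine ⟨fun s => ent X (s + 2) (N + 1) * (ent X 1 (N + 1))⁻¹,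
    fun s => -(∑ j : Fin N, psiOne X s j * ent X (j + 1) 1) * (ent X (N + 1) 1)⁻¹, fun s c => ?_⟩
  have hU := psiOne_mul_matXR hX hn1
  rcases Nat.eq_zero_or_pos c with rfl | hc
  · simp [ent_col_zero]
  rcases Nat.eq_or_lt_of_le hc with rfl | hc
  · simp only [Nat.sub_self, ent_col_zero, mul_zero, add_zero]
    rw [mul_assoc, inv_mul_cancel₀ hn1]; ring
  rcases Nat.lt_trichotomy c (N + 2) with h | rfl | h
  · have := congrFun (congrFun hU s) ⟨c - 2, by omega⟩
    rw [Matrix.mul_apply, matXL_apply] at this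
    simp only [matXR_apply] at this
    rw [show c - 2 + 1 = c - 1 by omega, show c - 2 + 2 = c by omega] at this
    rw [← sub_eq_iff_eq_add, ← this]
    simp only [neg_mul, sum_mul, mul_sub, sum_sub_distrib]
    rw [sub_eq_add_neg]
    congr 2
    exact sum_congr rfl fun j _ => by ring
  · simp [ent_of_col_gt X _ (show N + 1 < N + 2 by omega), h1n]
  · simp [ent_of_col_gt X _ (show N + 1 < c by omega),
      ent_of_col_gt X _ (show N + 1 < c - 1 by omega)]

theorem det_psiOne (hX : X.det ≠ 0) (h1n : ent X 1 (N + 1) ≠ 0) (hn1 : ent X (N + 1) 1 ≠ 0) :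
    (psiOne X).det = ent X (N + 1) 1 / ent X 1 (N + 1) := by
  have h := congrArg det (psiOne_mul_matXR hX hn1)
  rw [det_mul] at h
  have h1 := det_eq_mul_det_matXR hn1
  have h2 := det_eq_mul_det_matXL h1n
  rw [h2] at h1
  have h3 : (matXR X).det ≠ 0 := by
    rw [det_eq_mul_det_matXR hn1] at hX; exact right_ne_zero_of_mul hX
  rw [← h, mul_assoc, mul_assoc] at h1
  have h4 := mul_left_cancel₀ (pow_ne_zero N (by norm_num : (-1 : ℂ) ≠ 0)) h1
  rw [eq_div_iff h1n]
  apply mul_right_cancel₀ h3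
  linear_combination h4

open Polynomial in
/-- The determinant of the pencil `λ A + B` is the characteristic polynomial of
`U = X_L X_R⁻¹`, in the form `det (1 + λ U)`, up to a scalar. -/
theorem det_matA_add_matB (hX : X.det ≠ 0) (h1n : ent X 1 (N + 1) ≠ 0)
    (hn1 : ent X (N + 1) 1 ≠ 0) :
    ((Polynomial.X : ℂ[X]) • (matA X).map C + (matB X).map C).det =
      C (ent X 1 (N + 1) * X.det) *
        (1 + (Polynomial.X : ℂ[X]) • (psiOne X).map C).det := by
  set M := (Polynomial.X : ℂ[X]) • (matA X).map C + (matB X).map C with hM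
  have hM0 : ∀ i, M i 0 = C (ent X (i + 1) (N + 1)) := by
    intro i; simp [hM, matA, matB]
  have hMs : ∀ i (j : Fin (N + 1)), M i j.succ =
      Polynomial.X * C (ent X (i + 1) j) + C (ent X i (j + 1)) := by
    intro i j
    have hA : matA X i j.succ = ent X (i + 1) j := by
      have : matA X i j.succ = if (i : ℕ) < N + 1 ∧ 2 ≤ (j.succ : ℕ) then
        ent X (i + 1) (j.succ - 1) else 0 := rfl
      rw [this, Fin.val_succ, Nat.add_sub_cancel]
      split_ifs with h
      · rfl
      · rcases Nat.eq_zero_or_pos (j : ℕ) with h' | h'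
        · rw [h', ent_col_zero]
        · rw [ent_of_row_gt]; omega
    have hB : matB X i j.succ = ent X i (j + 1) := by
      have : matB X i j.succ = if (j.succ : ℕ) = 0 then ent X (i + 1) (N + 1)
        else ent X i j.succ := rfl
      rw [this, Fin.val_succ, if_neg (by omega)]
    rw [hM, Matrix.add_apply, Matrix.smul_apply, map_apply, map_apply, hA, hB, smul_eq_mul]
  -- Subtracting `a i` times the row `0` clears the first column below its first entry; subtracting
  -- `b i` times the last row then clears the constant terms of the second column above `x_{n1}`.
  set a : Fin (N + 2) → ℂ := fun i => if i = 0 then 0 else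
    ent X (i + 1) (N + 1) * (ent X 1 (N + 1))⁻¹ with ha
  set b : Fin (N + 2) → ℂ := fun i => if i = Fin.last (N + 1) then 0 else
    ent X i 1 * (ent X (N + 1) 1)⁻¹ with hb
  have ha_last : a (Fin.last (N + 1)) = 0 := by
    simp [ha, ent_of_row_gt X (N + 1) (show N + 1 < N + 1 + 1 by omega)]
  have hb_zero : b 0 = 0 := by simp [hb, ent_row_zero]
  set M1 : Matrix (Fin (N + 2)) (Fin (N + 2)) ℂ[X] := Matrix.of fun i j => M i j - C (a i) * M 0 j
    with hM1
  set M2 : Matrix (Fin (N + 2)) (Fin (N + 2)) ℂ[X] :=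
    Matrix.of fun i j => M1 i j - C (b i) * M1 (Fin.last (N + 1)) j with hM2
  have e1 : M.det = M1.det :=
    det_eq_of_forall_row_eq_smul_add_const (fun i => C (a i)) 0 (by simp [ha]) fun i j => by
      simp [hM1, ha]
  have e2 : M1.det = M2.det :=
    det_eq_of_forall_row_eq_smul_add_const (fun i => C (b i)) (Fin.last (N + 1)) (by simp [hb])
      fun i j => by simp [hM2, hb]
  have hlast : ∀ j, M1 (Fin.last (N + 1)) j = M (Fin.last (N + 1)) j := by
    intro j; simp [hM1, ha_last]
  have e3 : M2.det = C (ent X 1 (N + 1)) * (M2.submatrix Fin.succ Fin.succ).det := by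
    rw [det_eq_of_column_zero_eq_single M2 0]
    · simp [hM2, hM1, hb_zero, ha, hM0]
    · intro i hi
      have h0 : M1 (Fin.last (N + 1)) 0 = 0 := by
        rw [hlast, hM0, Fin.val_last, ent_of_row_gt _ _ (by omega), C_0]
      have h0' : M1 i 0 = 0 := by
        simp only [hM1, of_apply, hM0, ← C_mul, ← C_sub, ha, if_neg hi]
        simp [h1n]
      simp [hM2, h0, h0']
  have hM2s : ∀ i (j : Fin (N + 1)), M2 i j.succ =
      Polynomial.X * (C (ent X (i + 1) j - a i * ent X 1 j)) +
        C (ent X i (j + 1) - b i * ent X (N + 1) (j + 1)) := by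
    intro i j
    simp only [hM2, of_apply, hlast]
    simp only [hM1, of_apply, hMs, Fin.val_last, Fin.val_zero, ent_row_zero,
      ent_of_row_gt X _ (show N + 1 < N + 1 + 1 by omega), C_0, C_sub, C_mul]
    ring_nf
  have e4 : (M2.submatrix Fin.succ Fin.succ).det = (-1) ^ N * C (ent X (N + 1) 1) *
      ((matXR X).map C + (Polynomial.X : ℂ[X]) • (matXL X).map C).det := by
    rw [det_eq_of_column_zero_eq_single _ (Fin.last N)]
    · congr 2
      · rw [submatrix_apply, hM2s]
        simp [ent_col_zero, hb]
      · refine Matrix.ext fun i j => ?_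
        have hi : i.castSucc.succ ≠ Fin.last (N + 1) := by
          rw [Fin.succ_castSucc]; exact (Fin.castSucc_lt_last _).ne
        rw [Matrix.add_apply, Matrix.smul_apply, map_apply, map_apply, matXR_apply, matXL_apply,
          submatrix_apply, submatrix_apply, Fin.succAbove_last, hM2s, smul_eq_mul, add_comm]
        simp only [ha, hb, if_neg hi, if_neg (Fin.succ_ne_zero _), Fin.val_succ, Fin.val_castSucc]
    · intro i hi
      have hi' : i.succ ≠ Fin.last (N + 1) := by
        rw [← Fin.succ_last]; exact fun h => hi (Fin.succ_injective _ h)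
      rw [submatrix_apply, hM2s]
      simp only [hb, if_neg hi', Fin.val_zero, ent_col_zero, zero_add]
      rw [mul_assoc, inv_mul_cancel₀ hn1]
      simp
  have e5 : (matXR X).map C + (Polynomial.X : ℂ[X]) • (matXL X).map C =
      (1 + (Polynomial.X : ℂ[X]) • (psiOne X).map C) * (matXR X).map C := by
    rw [← psiOne_mul_matXR hX hn1, Matrix.map_mul, add_mul, Matrix.one_mul, Matrix.smul_mul]
  have e6 : ((matXR X).map C).det = C (matXR X).det := (RingHom.map_det C (matXR X)).symm
  rw [e1, e2, e3, e4, e5, det_mul, e6, det_eq_mul_det_matXR hn1]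
  simp only [C_mul, C_pow, C_neg, C_1]
  ring

theorem cFun_psiOne (hN : 1 ≤ N) (hX : X.det ≠ 0) (h1n : ent X 1 (N + 1) ≠ 0)
    (hn1 : ent X (N + 1) 1 ≠ 0) (r : ℕ) :
    cFun r (psiOne X) = cX r X / (ent X 1 (N + 1) * X.det) := by
  rw [cX, cFun, det_matA_add_matB hX h1n hn1, Polynomial.coeff_C_mul, eq_div_iff (mul_ne_zero h1n hX)]
  have : ((-1 : ℂ)) ^ (r * (N + 1)) = (-1) ^ (r * (N - 1)) := by
    rw [show r * (N + 1) = r * (N - 1) + 2 * r by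
      obtain ⟨M, rfl⟩ : ∃ M, N = M + 1 := ⟨N - 1, by omega⟩
      simp; ring, pow_add, pow_mul]
    simp
  rw [this]
  simp only [Nat.add_sub_cancel]
  ring

open Polynomial in
theorem cFun_self (U : Matrix (Fin N) (Fin N) ℂ) : cFun N U = U.det := by
  have h : (1 + (Polynomial.X : ℂ[X]) • U.map C).det.coeff N = U.det := by
    have := coeff_det_X_add_C_card U (1 : Matrix (Fin N) (Fin N) ℂ)
    rwa [Fintype.card_fin, Matrix.map_one _ C_0 C_1, add_comm] at this
  rw [cFun, h]
  have : Even (N * (N - 1)) := Nat.even_mul_pred_self N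
  rw [this.neg_one_pow, one_mul]

end Pencil

/-! ### The functions `φ_{kl}` -/

section SortedSets

theorem sort_getD_eq_nthElt (I : Finset ℕ) (a : ℕ) : I.sort.getD a 0 = nthElt I a := by
  unfold nthElt
  split_ifs with h
  · rw [orderEmbOfFin_apply, List.getD_eq_getElem _ _ (by simpa using h)]
    rfl
  · rw [List.getD_eq_default _ _ (by simpa using h)]

theorem nthElt_of_card_le {I : Finset ℕ} {a : ℕ} (h : I.card ≤ a) : nthElt I a = 0 := by
  simp [nthElt, h.not_gt]

theorem nthElt_Icc {u v a : ℕ} (h : a < v + 1 - u) : nthElt (Icc u v) a = u + a :=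
  nthElt_eq_of_strictMono (Icc u v) (Nat.card_Icc u v) (fun a => u + a)
    (fun a ha => by simp; omega) (fun a b hab _ => by simpa using hab) h

theorem card_one_union_Icc {u v : ℕ} (h1 : 1 < u) : (({1} : Finset ℕ) ∪ Icc u v).card = v + 2 - u ∨
    v + 1 < u := by
  by_cases h2 : v + 1 < u
  · exact Or.inr h2
  left
  rw [card_union_of_disjoint (by simp; omega)]
  simp; omega

theorem nthElt_one_union_Icc {u v a : ℕ} (h1 : 1 < u) (h2 : u ≤ v + 1) (ha : a < v + 2 - u) :
    nthElt ({1} ∪ Icc u v) a = if a = 0 then 1 else u + a - 1 := by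
  refine nthElt_eq_of_strictMono _ ((card_one_union_Icc h1).resolve_right (by omega))
    (fun a => if a = 0 then 1 else u + a - 1) ?_ ?_ ha
  · intro a ha
    simp only [mem_union, mem_singleton, mem_Icc]
    split_ifs <;> omega
  · intro a b hab hb
    split_ifs <;> omega

theorem gammaMap_Icc (u v : ℕ) : gammaMap (Icc u v) = Icc (u + 1) (v + 1) := by
  ext x
  simp only [gammaMap, mem_image, mem_Icc]
  exact ⟨by rintro ⟨a, h, rfl⟩; omega, fun h => ⟨x - 1, by omega, by omega⟩⟩

end SortedSets

section PhiRows

variable {K : Type*} [CommRing K]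

/-- The number of basis vectors that are left free in the block column `t` (numbered from `0`) of
`Φ_{kl}`, when there are `m` block columns; the value at `t = m` describes the last tier. -/
def blockShift (m k l t : ℕ) : ℕ := if t + 1 < m then 1 else if t + 1 = m then l else k

theorem secondTier_eq {n k l t : ℕ} (hl : 1 ≤ l) (hk : 1 ≤ k) (hkl : k + l < n)
    (ht : t < n - k - l) :
    secondTier n k l t = Icc (blockShift (n - k - l) k l t + 1) n := by
  unfold secondTier blockShift
  split_ifs <;> try omega
  all_goals ext x; simp only [mem_union, mem_Icc, mem_singleton]; omega

theorem thirdTier_eq {n k l t : ℕ} (hn : 1 ≤ n) (ht : t < n - k - l) :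
    thirdTier n k l t = {1} ∪ Icc (blockShift (n - k - l) k l (t + 1) + 2) n := by
  unfold thirdTier blockShift
  split_ifs <;> first | omega | rw [gammaMap_Icc, Nat.sub_add_cancel hn]

/-- The entries of a block column of `Φ_{kl}(X)`, by tiers: rows of `X` in the second tier, then
the shifted row `X_1`, then shifted rows of `X`. The zero rows below are included in the last case,
where the row index exceeds `n`. -/
theorem bigPhi_apply {n k l : ℕ} (X : Matrix (Fin n) (Fin n) K) (hl : 1 ≤ l) (hk : 1 ≤ k)
    (hkl : k + l < n) (r : Fin ((n - k - l) * (n + 1))) (t : Fin (n - k - l)) (c : Fin (n + 1)) :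
    bigPhi k l X r (finProdFinEquiv (t, c)) =
      if (r : ℕ) < (t : ℕ) * n then 0
      else if r - (t : ℕ) * n < n - blockShift (n - k - l) k l t then
        ent X (r - (t : ℕ) * n + blockShift (n - k - l) k l t + 1) (c + 1)
      else if r - (t : ℕ) * n = n - blockShift (n - k - l) k l t then ent X 1 c
      else ent X (r - (t : ℕ) * n - (n - blockShift (n - k - l) k l t) +
        blockShift (n - k - l) k l (t + 1) + 1) c := by
  have h1 : ((finProdFinEquiv (t, c) : Fin _) : ℕ) / (n + 1) = t := by
    rw [finProdFinEquiv_apply_val, Nat.add_mul_div_left _ _ (by omega), Nat.div_eq_of_lt c.2,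
      zero_add]
  have h2 : ((finProdFinEquiv (t, c) : Fin _) : ℕ) % (n + 1) = c := by
    rw [finProdFinEquiv_apply_val, Nat.add_mul_mod_self_left, Nat.mod_eq_of_lt c.2]
  have hc : (secondTier n k l t).card = n - blockShift (n - k - l) k l t := by
    rw [secondTier_eq hl hk hkl t.2, Nat.card_Icc]; omega
  have hS : ∀ t, blockShift (n - k - l) k l t < n := by
    intro t; unfold blockShift; split_ifs <;> omega
  have hb := hS t
  have hb' := hS (t + 1)
  have hu : bigPhi k l X r (finProdFinEquiv (t, c)) =
    (if (r : ℕ) < (t : ℕ) * n then 0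
    else if (r : ℕ) < (t : ℕ) * n + (secondTier n k l t).card then
      rowsEntry X (secondTier n k l t) 0 (r - (t : ℕ) * n) c
    else
      rowsEntry X (thirdTier n k l t) 1 (r - ((t : ℕ) * n + (secondTier n k l t).card)) c) := by
    simp only [bigPhi, of_apply, h1, h2]
  rw [hu]
  simp only [hc, rowsEntry, sort_getD_eq_nthElt, Nat.sub_zero, Nat.add_sub_cancel]
  by_cases h3 : (r : ℕ) < (t : ℕ) * n
  · rw [if_pos h3, if_pos h3]
  rw [if_neg h3, if_neg h3]
  by_cases h4 : (r : ℕ) - (t : ℕ) * n < n - blockShift (n - k - l) k l t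
  · rw [if_pos h4, if_pos (by omega), secondTier_eq hl hk hkl t.2, nthElt_Icc (by omega)]
    congr 1
    omega
  rw [if_neg h4, if_neg (by omega), thirdTier_eq (by omega) t.2]
  by_cases h6 : (r : ℕ) - (t : ℕ) * n = n - blockShift (n - k - l) k l t
  · rw [if_pos h6, nthElt_one_union_Icc (by omega) (by omega) (by omega), if_pos (by omega)]
  rw [if_neg h6]
  by_cases h7 : (r : ℕ) - ((t : ℕ) * n + (n - blockShift (n - k - l) k l t)) <
    n - blockShift (n - k - l) k l (t + 1)
  · rw [nthElt_one_union_Icc (by omega) (by omega) (by omega), if_neg (by omega)]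
    congr 1
    omega
  · rw [nthElt_of_card_le, ent_row_zero, ent_of_row_gt _ _ (by omega)]
    rw [(card_one_union_Icc (by omega)).resolve_right (by omega)]
    omega

/-- The rows `X_1, …, X_n` followed by a zero, and the row `X_1` preceded by a zero: the basis in
which the block columns of `Φ_{kl}(X)` are expanded. -/
def basisMatrix {n : ℕ} (X : Matrix (Fin n) (Fin n) K) : Matrix (Fin (n + 1)) (Fin (n + 1)) K :=
  Matrix.of fun i j => if (i : ℕ) < n then ent X (i + 1) (j + 1) else ent X 1 j

theorem det_basisMatrix {n : ℕ} (X : Matrix (Fin n) (Fin n) K) :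
    (basisMatrix X).det = X.det * ent X 1 n := by
  rw [det_succ_column _ (Fin.last n), sum_eq_single (Fin.last n)]
  · have h1 : basisMatrix X (Fin.last n) (Fin.last n) = ent X 1 n := by simp [basisMatrix]
    have h2 : (basisMatrix X).submatrix (Fin.last n).succAbove (Fin.last n).succAbove = X := by
      ext i j
      simp [basisMatrix, ent_succ_succ]
    rw [h1, h2, Even.neg_one_pow ⟨_, rfl⟩]
    ring
  · intro i _ hi
    have : (i : ℕ) < n := Fin.val_lt_last hi
    have h1 : basisMatrix X i (Fin.last n) = 0 := by
      simp [basisMatrix, this, ent_of_col_gt]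
    rw [h1]
    ring
  · simp

end PhiRows

section Pencil

variable {N : ℕ} {X : Matrix (Fin (N + 1)) (Fin (N + 1)) ℂ}

/-- The pencil identity `exists_ent_shift_eq` with rows numbered from `1`. -/
theorem exists_ent_shift_eq' (hX : X.det ≠ 0) (h1n : ent X 1 (N + 1) ≠ 0)
    (hn1 : ent X (N + 1) 1 ≠ 0) :
    ∃ a b : ℕ → ℂ, (∀ s, N < s → a s = 0) ∧ (∀ s, N < s → b s = 0) ∧
      ∀ s c : ℕ, 1 ≤ s → ent X (s + 1) (c - 1) =
        ∑ j : Fin N, ent (psiOne X) s (j + 1) * ent X (j + 1) c + b s * ent X (N + 1) c +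
        a s * ent X 1 (c - 1) := by
  obtain ⟨a, b, h⟩ := exists_ent_shift_eq hX h1n hn1
  refine ⟨fun s => if hs : s - 1 < N then a ⟨s - 1, hs⟩ else 0,
    fun s => if hs : s - 1 < N then b ⟨s - 1, hs⟩ else 0, ?_, ?_, ?_⟩
  · intro s hs; exact dif_neg (by omega)
  · intro s hs; exact dif_neg (by omega)
  · intro s c hs
    by_cases hs' : s - 1 < N
    · have := h ⟨s - 1, hs'⟩ c
      simp only [show s - 1 + 2 = s + 1 by omega] at this
      rw [this]
      simp only [dif_pos hs']
      congr 2
      refine sum_congr rfl fun j _ => ?_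
      congr 1
      exact (ent_eq_apply (psiOne X) (⟨s - 1, hs'⟩ : Fin N) j (by simp; omega) rfl).symm
    · simp only [dif_neg hs', zero_mul, add_zero]
      rw [ent_of_row_gt X _ (by omega)]
      symm
      refine sum_eq_zero fun j _ => ?_
      rw [ent_of_row_gt (psiOne X) _ (by omega : N + 1 - 1 < s), zero_mul]

end Pencil

section PhiFactorization

variable {K : Type*} [CommRing K] {N : ℕ}

theorem ent_mul {m n p : ℕ} (U : Matrix (Fin m) (Fin n) K) (V : Matrix (Fin n) (Fin p) K)
    (s c : ℕ) : ent (U * V) s c = ∑ j : Fin n, ent U s (j + 1) * ent V (j + 1) c := by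
  by_cases hs : 1 ≤ s ∧ s ≤ m
  · by_cases hc : 1 ≤ c ∧ c ≤ p
    · rw [ent_eq_apply (U * V) (⟨s - 1, by omega⟩ : Fin m) (⟨c - 1, by omega⟩ : Fin p)
        (by simp; omega) (by simp; omega), Matrix.mul_apply]
      refine sum_congr rfl fun j _ => ?_
      rw [ent_eq_apply U (⟨s - 1, by omega⟩ : Fin m) j (by simp; omega) rfl,
        ent_eq_apply V j (⟨c - 1, by omega⟩ : Fin p) rfl (by simp; omega)]
    · simp [ent, hc]
  · simp [ent, hs]

theorem ent_one_of_ne {s c : ℕ} (h : s ≠ c) : ent (1 : Matrix (Fin N) (Fin N) K) s c = 0 := by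
  unfold ent
  split_ifs with h'
  · rw [one_apply_ne]
    intro h''
    have := congrArg Fin.val h''
    simp only at this
    omega
  · rfl

theorem ent_neg {m n : ℕ} (U : Matrix (Fin m) (Fin n) K) (s c : ℕ) :
    ent (-U) s c = -ent U s c := by
  unfold ent; split_ifs <;> simp

/-- The coefficients, in the basis `X_1, …, X_{N+1}, λ X_1`, of the shifted row `λ X_{s+1}`. -/
def shiftCoeff (U : Matrix (Fin N) (Fin N) K) (a b : ℕ → K) (s c : ℕ) : K :=
  if c < N then ent U s (c + 1) else if c = N then b s else a s

theorem sum_shiftCoeff_mul (U : Matrix (Fin N) (Fin N) K) (a b : ℕ → K) (s : ℕ) (f : ℕ → K) :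
    ∑ c : Fin (N + 2), shiftCoeff U a b s c * f c =
      ∑ j : Fin N, ent U s (j + 1) * f j + b s * f N + a s * f (N + 1) := by
  rw [Fin.sum_univ_castSucc, Fin.sum_univ_castSucc]
  simp [shiftCoeff]

theorem shiftCoeff_eq_zero (U : Matrix (Fin N) (Fin N) K) {a b : ℕ → K}
    (ha : ∀ s, N < s → a s = 0) (hb : ∀ s, N < s → b s = 0) {s : ℕ} (hs : N < s) (c : ℕ) :
    shiftCoeff U a b s c = 0 := by
  unfold shiftCoeff
  rw [ha s hs, hb s hs, ent_of_row_gt U _ hs]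
  simp

theorem sum_shiftCoeff_mul_ent (U V : Matrix (Fin N) (Fin N) K) (a b : ℕ → K) (s : ℕ) :
    ∑ c : Fin (N + 2), shiftCoeff U a b s c * ent V (c + 1) 1 = ent (U * V) s 1 := by
  rw [sum_shiftCoeff_mul U a b s (fun c => ent V (c + 1) 1), ent_mul,
    ent_of_row_gt V _ (show N < N + 1 by omega), ent_of_row_gt V _ (show N < N + 1 + 1 by omega)]
  ring

/-- The coefficients of the part of row `r` of `Φ_{kl}` in the block column `t`, in the basis
`X_1, …, X_{N+1}, λ X_1`. -/
def phiCoeff (U : Matrix (Fin N) (Fin N) K) (a b : ℕ → K) (m k l r t c : ℕ) : K :=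
  if r < t * (N + 1) then 0
  else if r - t * (N + 1) ≤ N + 1 - blockShift m k l t then
    (if c = r - t * (N + 1) + blockShift m k l t then 1 else 0)
  else shiftCoeff U a b (r - t * (N + 1) - (N + 1 - blockShift m k l t) +
    blockShift m k l (t + 1)) c

/-- The matrix `Φ_{kl}(X)` is the matrix of coefficients `phiCoeff` times copies of
`basisMatrix`. -/
theorem bigPhi_eq_sum_phiCoeff {X : Matrix (Fin (N + 1)) (Fin (N + 1)) K}
    (U : Matrix (Fin N) (Fin N) K) (a b : ℕ → K)
    (h : ∀ s c : ℕ, 1 ≤ s → ent X (s + 1) (c - 1) =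
        ∑ j : Fin N, ent U s (j + 1) * ent X (j + 1) c + b s * ent X (N + 1) c +
        a s * ent X 1 (c - 1)) {k l : ℕ} (hk : 1 ≤ k) (hl : 1 ≤ l) (hkl : k + l ≤ N)
    (r : Fin ((N + 1 - k - l) * (N + 1 + 1))) (t : Fin (N + 1 - k - l)) (c : Fin (N + 1 + 1)) :
    bigPhi k l X r (finProdFinEquiv (t, c)) =
      ∑ c' : Fin (N + 1 + 1), phiCoeff U a b (N + 1 - k - l) k l r t c' * basisMatrix X c' c := by
  have hS : ∀ t, 1 ≤ blockShift (N + 1 - k - l) k l t ∧ blockShift (N + 1 - k - l) k l t < N + 1 := by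
    intro t; unfold blockShift; split_ifs <;> omega
  have hb := hS t
  have hb' := hS (t + 1)
  rw [bigPhi_apply X hl hk (by omega)]
  unfold phiCoeff
  by_cases h1 : (r : ℕ) < t * (N + 1)
  · simp [h1]
  simp only [if_neg h1]
  by_cases h2 : (r : ℕ) - t * (N + 1) ≤ N + 1 - blockShift (N + 1 - k - l) k l t
  · simp only [if_pos h2, ite_mul, one_mul, zero_mul]
    rw [sum_eq_single (⟨r - t * (N + 1) + blockShift (N + 1 - k - l) k l t, by omega⟩ :
      Fin (N + 1 + 1))]
    · simp only [if_true, basisMatrix, of_apply]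
      by_cases h3 : (r : ℕ) - t * (N + 1) = N + 1 - blockShift (N + 1 - k - l) k l t
      · rw [if_neg (by omega), if_pos h3, if_neg (by omega)]
      · rw [if_pos (by omega), if_pos (by omega)]
    · intro x _ hx
      rw [if_neg]
      intro hx'
      exact hx (Fin.ext hx')
    · simp
  · simp only [if_neg h2]
    rw [if_neg (by omega), if_neg (by omega)]
    have e : ∀ c' : Fin (N + 1 + 1), basisMatrix X c' c =
        (fun i : ℕ => if i < N + 1 then ent X (i + 1) (c + 1) else ent X 1 c) c' := fun _ => rfl
    simp only [e]
    rw [sum_shiftCoeff_mul U a b _ (fun i : ℕ => if i < N + 1 then ent X (i + 1) (c + 1)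
      else ent X 1 c)]
    have := h ((r : ℕ) - t * (N + 1) - (N + 1 - blockShift (N + 1 - k - l) k l t) +
      blockShift (N + 1 - k - l) k l (t + 1)) (c + 1) (by omega)
    rw [Nat.add_sub_cancel] at this
    rw [this, if_pos (by omega), if_neg (by omega)]
    congr 2
    refine sum_congr rfl fun j _ => ?_
    rw [if_pos (by omega)]

/-- A unitriangular matrix: the first column of each block column `t₀` but the last one is the
sequence of vectors `(-U) ^ (t - t₀) e_1`, which solves the equations given by the upper rows
of `Φ_{kl}`. -/
def kernelMatrix (U : Matrix (Fin N) (Fin N) K) (m : ℕ) :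
    Matrix (Fin m × Fin (N + 2)) (Fin m × Fin (N + 2)) K :=
  Matrix.of fun x y =>
    if (y.2 : ℕ) = 0 ∧ (y.1 : ℕ) + 1 < m then
      (if (y.1 : ℕ) ≤ x.1 then ent ((-U) ^ ((x.1 : ℕ) - y.1)) (x.2 + 1) 1 else 0)
    else if x = y then 1 else 0

theorem det_kernelMatrix (hN : 1 ≤ N) (U : Matrix (Fin N) (Fin N) K) (m : ℕ) :
    (kernelMatrix U m).det = 1 := by
  have hb : BlockTriangular (kernelMatrix U m) (fun x => OrderDual.toDual x.1) := by
    intro x y hxy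
    have hxy : x.1 < y.1 := hxy
    have hne : x ≠ y := fun h => hxy.ne (congrArg Prod.fst h)
    simp only [kernelMatrix, of_apply]
    rw [if_neg hne, if_neg (not_le.2 (Fin.lt_def.1 hxy))]
    simp
  rw [hb.det_fintype]
  refine prod_eq_one fun k _ => ?_
  have : (kernelMatrix U m).toSquareBlock (fun x => OrderDual.toDual x.1) k = 1 := by
    ext ⟨x, hx⟩ ⟨y, hy⟩
    have hxy : x.1 = y.1 := OrderDual.toDual.injective (hx.trans hy.symm)
    rw [toSquareBlock_def, of_apply]
    simp only [kernelMatrix, of_apply]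
    have h1 : (1 : Matrix {x : Fin m × Fin (N + 2) // OrderDual.toDual x.1 = k}
        {x : Fin m × Fin (N + 2) // OrderDual.toDual x.1 = k} K) ⟨x, hx⟩ ⟨y, hy⟩
        = if x = y then 1 else 0 := by
      simp [Matrix.one_apply]
    rw [h1, hxy, Nat.sub_self, pow_zero, if_pos le_rfl]
    split_ifs with h2 h3 h3
    · subst h3
      rw [h2.1, ent_eq_apply 1 (⟨0, hN⟩ : Fin N) ⟨0, hN⟩ rfl rfl, one_apply_eq]
    · refine ent_one_of_ne ?_
      intro h4
      exact h3 (Prod.ext hxy (Fin.ext (by omega)))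
    · rfl
    · rfl
  rw [this, det_one]

/-- The matrix of the coefficients `phiCoeff`, multiplied by `kernelMatrix`. -/
def reducedPhi (U : Matrix (Fin N) (Fin N) K) (a b : ℕ → K) (m k l : ℕ) :
    Matrix (Fin (m * (N + 2))) (Fin m × Fin (N + 2)) K :=
  (Matrix.of fun (r : Fin (m * (N + 2))) (x : Fin m × Fin (N + 2)) =>
    phiCoeff U a b m k l r x.1 x.2) * kernelMatrix U m

open Kronecker in
/-- The basis contributes `x_{1n} det X` for each block column; `kernelMatrix` has
determinant `1`. -/
theorem det_bigPhi_eq {X : Matrix (Fin (N + 1)) (Fin (N + 1)) K}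
    (U : Matrix (Fin N) (Fin N) K) (a b : ℕ → K)
    (h : ∀ s c : ℕ, 1 ≤ s → ent X (s + 1) (c - 1) =
        ∑ j : Fin N, ent U s (j + 1) * ent X (j + 1) c + b s * ent X (N + 1) c +
        a s * ent X 1 (c - 1)) {k l : ℕ} (hk : 1 ≤ k) (hl : 1 ≤ l) (hkl : k + l ≤ N) :
    (bigPhi k l X).det = (X.det * ent X 1 (N + 1)) ^ (N + 1 - k - l) *
      ((reducedPhi U a b (N + 1 - k - l) k l).submatrix id finProdFinEquiv.symm).det := by
  set m := N + 1 - k - l with hm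
  set P : Matrix (Fin (m * (N + 2))) (Fin m × Fin (N + 2)) K :=
    Matrix.of fun r x => phiCoeff U a b m k l r x.1 x.2 with hP
  have h1 : (bigPhi k l X).submatrix finProdFinEquiv finProdFinEquiv =
      P.submatrix finProdFinEquiv id * ((1 : Matrix (Fin m) (Fin m) K) ⊗ₖ basisMatrix X) := by
    ext x ⟨t, c⟩
    rw [submatrix_apply, bigPhi_eq_sum_phiCoeff U a b h hk hl hkl, Matrix.mul_apply,
      Fintype.sum_prod_type, sum_eq_single t]
    · refine sum_congr rfl fun c' _ => ?_
      simp [hP, hm]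
    · intro t' _ ht'
      refine sum_eq_zero fun c' _ => ?_
      simp [ht']
    · simp
  have h2 : ((reducedPhi U a b m k l).submatrix id finProdFinEquiv.symm).submatrix
      finProdFinEquiv finProdFinEquiv = P.submatrix finProdFinEquiv id * kernelMatrix U m := by
    ext x y
    simp [reducedPhi, hP, Matrix.mul_apply]
  rw [← det_submatrix_equiv_self finProdFinEquiv (bigPhi k l X), h1,
    ← det_submatrix_equiv_self finProdFinEquiv
      ((reducedPhi U a b m k l).submatrix id finProdFinEquiv.symm), h2, det_mul, det_mul,
    det_kernelMatrix (by omega), det_kronecker, det_basisMatrix]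
  simp
  ring

end PhiFactorization

section PhiReduction

variable {K : Type*} [CommRing K] {N : ℕ}

/-- Row `t₁ (N + 1) + y` of the coefficient matrix, in the second tier (or the first row of the third
tier) of block column `t₁`: a unit vector in that block column, and a row of `U` in the preceding
one. -/
theorem phiCoeff_of_pivot (U : Matrix (Fin N) (Fin N) K) {a b : ℕ → K}
    (ha : ∀ s, N < s → a s = 0) (hb : ∀ s, N < s → b s = 0) {μ k l : ℕ} (hk : 1 ≤ k) (hl : 1 ≤ l)
    (hN : N = μ + k + l) {t₁ y : ℕ} (ht : t₁ ≤ μ)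
    (hy : y + blockShift (μ + 1) k l t₁ ≤ N + 1) (hy' : y < N + 1) (t c : ℕ) :
    phiCoeff U a b (μ + 1) k l (t₁ * (N + 1) + y) t c =
      if t = t₁ then (if c = y + blockShift (μ + 1) k l t₁ then 1 else 0)
      else if t + 1 = t₁ then shiftCoeff U a b (y + 1 + blockShift (μ + 1) k l t₁) c
      else 0 := by
  have hS : ∀ t, 1 ≤ blockShift (μ + 1) k l t ∧ blockShift (μ + 1) k l t ≤ N := by
    intro t; unfold blockShift; split_ifs <;> omega
  unfold phiCoeff
  rcases lt_trichotomy t t₁ with h | h | h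
  · have hlt : blockShift (μ + 1) k l t = 1 := by unfold blockShift; rw [if_pos (by omega)]
    rw [if_neg h.ne]
    by_cases h' : t + 1 = t₁
    · subst h'
      have e : (t + 1) * (N + 1) = t * (N + 1) + (N + 1) := by ring
      rw [if_pos rfl, if_neg (by omega), hlt, if_neg (by omega)]
      congr 1
      omega
    · have e : (t + 2) * (N + 1) ≤ t₁ * (N + 1) := Nat.mul_le_mul_right _ (by omega)
      have e' : (t + 2) * (N + 1) = t * (N + 1) + 2 * (N + 1) := by ring
      rw [if_neg h', if_neg (by omega), hlt, if_neg (by omega),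
        shiftCoeff_eq_zero U ha hb (by have := hS (t + 1); omega)]
  · subst h
    rw [if_neg (by omega), if_pos rfl, if_pos (by omega), Nat.add_sub_cancel_left]
  · have e : (t₁ + 1) * (N + 1) ≤ t * (N + 1) := Nat.mul_le_mul_right _ h
    have e' : (t₁ + 1) * (N + 1) = t₁ * (N + 1) + (N + 1) := by ring
    rw [if_pos (by omega), if_neg (by omega), if_neg (by omega)]

/-- The rows after the last pivot row lie in the third tier of the last block column. -/
theorem phiCoeff_of_last (U : Matrix (Fin N) (Fin N) K) {a b : ℕ → K}
    (ha : ∀ s, N < s → a s = 0) (hb : ∀ s, N < s → b s = 0) {μ k l : ℕ} (hk : 1 ≤ k) (hl : 1 ≤ l)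
    (hN : N = μ + k + l) (i t c : ℕ) (ht : t ≤ μ) :
    phiCoeff U a b (μ + 1) k l (μ * (N + 1) + (N + 2 - l) + i) t c =
      if t = μ then shiftCoeff U a b (k + 1 + i) c else 0 := by
  have hS : ∀ t, 1 ≤ blockShift (μ + 1) k l t ∧ blockShift (μ + 1) k l t ≤ N := by
    intro t; unfold blockShift; split_ifs <;> omega
  unfold phiCoeff
  rcases Nat.eq_or_lt_of_le ht with h | h
  · subst h
    have h1 : blockShift (t + 1) k l t = l := by
      unfold blockShift; rw [if_neg (by omega), if_pos rfl]
    have h2 : blockShift (t + 1) k l (t + 1) = k := by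
      unfold blockShift; rw [if_neg (by omega), if_neg (by omega)]
    rw [if_pos rfl, if_neg (by omega), h1, h2, if_neg (by omega)]
    congr 1
    omega
  · have hlt : blockShift (μ + 1) k l t = 1 := by unfold blockShift; rw [if_pos (by omega)]
    rw [if_neg h.ne, hlt]
    by_cases h' : t + 1 = μ
    · subst h'
      have h2 : blockShift (t + 1 + 1) k l (t + 1) = l := by
        unfold blockShift; rw [if_neg (by omega), if_pos rfl]
      have e : (t + 1) * (N + 1) = t * (N + 1) + (N + 1) := by ring
      rw [if_neg (by omega), if_neg (by omega), h2, shiftCoeff_eq_zero U ha hb (by omega)]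
    · have e : (t + 2) * (N + 1) ≤ μ * (N + 1) := Nat.mul_le_mul_right _ (by omega)
      have e' : (t + 2) * (N + 1) = t * (N + 1) + 2 * (N + 1) := by ring
      rw [if_neg (by omega), if_neg (by omega),
        shiftCoeff_eq_zero U ha hb (by have := hS (t + 1); omega)]

theorem reducedPhi_of_not_free (U : Matrix (Fin N) (Fin N) K) (a b : ℕ → K) {m k l : ℕ}
    (r : Fin (m * (N + 2))) (y : Fin m × Fin (N + 2))
    (hy : ¬((y.2 : ℕ) = 0 ∧ (y.1 : ℕ) + 1 < m)) :
    reducedPhi U a b m k l r y = phiCoeff U a b m k l r y.1 y.2 := by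
  rw [reducedPhi, Matrix.mul_apply, sum_eq_single y]
  · simp only [kernelMatrix, of_apply]
    rw [if_neg hy]
    simp
  · intro x _ hx
    simp only [kernelMatrix, of_apply]
    rw [if_neg hy, if_neg hx, mul_zero]
  · simp

theorem reducedPhi_of_free (U : Matrix (Fin N) (Fin N) K) (a b : ℕ → K) {m k l : ℕ}
    (r : Fin (m * (N + 2))) (y : Fin m × Fin (N + 2))
    (hy : (y.2 : ℕ) = 0 ∧ (y.1 : ℕ) + 1 < m) :
    reducedPhi U a b m k l r y = ∑ t : Fin m, if (y.1 : ℕ) ≤ t then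
      ∑ c : Fin (N + 2), phiCoeff U a b m k l r t c * ent ((-U) ^ ((t : ℕ) - y.1)) (c + 1) 1
      else 0 := by
  rw [reducedPhi, Matrix.mul_apply, Fintype.sum_prod_type]
  refine sum_congr rfl fun t _ => ?_
  simp only [kernelMatrix, of_apply, if_pos hy]
  split_ifs
  · rfl
  · simp

/-- The vectors `(-U) ^ p e_1` are annihilated by the pivot rows. -/
theorem reducedPhi_pivot_free (U : Matrix (Fin N) (Fin N) K) {a b : ℕ → K}
    (ha : ∀ s, N < s → a s = 0) (hb : ∀ s, N < s → b s = 0) {μ k l : ℕ} (hk : 1 ≤ k) (hl : 1 ≤ l)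
    (hN : N = μ + k + l) {t₁ y : ℕ} (ht : t₁ ≤ μ)
    (hy : y + blockShift (μ + 1) k l t₁ ≤ N + 1) (hy' : y < N + 1)
    (r : Fin ((μ + 1) * (N + 2))) (hr : (r : ℕ) = t₁ * (N + 1) + y)
    (z : Fin (μ + 1) × Fin (N + 2)) (hz : (z.2 : ℕ) = 0 ∧ (z.1 : ℕ) + 1 < μ + 1) :
    reducedPhi U a b (μ + 1) k l r z = 0 := by
  have hS : 1 ≤ blockShift (μ + 1) k l t₁ := by unfold blockShift; split_ifs <;> omega
  rw [reducedPhi_of_free U a b r z hz, hr]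
  simp only [phiCoeff_of_pivot U ha hb hk hl hN ht hy hy']
  have key : ∀ V : Matrix (Fin N) (Fin N) K, ∑ c : Fin (N + 2),
      (if (c : ℕ) = y + blockShift (μ + 1) k l t₁ then (1 : K) else 0) * ent V (c + 1) 1
      = ent V (y + blockShift (μ + 1) k l t₁ + 1) 1 := by
    intro V
    rw [sum_eq_single (⟨y + blockShift (μ + 1) k l t₁, by omega⟩ : Fin (N + 2))]
    · simp
    · intro c _ hc
      rw [if_neg (fun h => hc (Fin.ext h)), zero_mul]
    · simp
  by_cases h1 : (z.1 : ℕ) < t₁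
  · obtain ⟨t', rfl⟩ : ∃ t', t₁ = t' + 1 := ⟨t₁ - 1, by omega⟩
    rw [sum_eq_add (⟨t', by omega⟩ : Fin (μ + 1)) ⟨t' + 1, by omega⟩]
    · simp only
      rw [if_pos (by omega), if_pos (by omega)]
      simp only [if_neg (show t' ≠ t' + 1 by omega), if_true]
      rw [sum_shiftCoeff_mul_ent, key, show t' + 1 - (z.1 : ℕ) = (t' - z.1) + 1 by omega,
        pow_succ', neg_mul, ent_neg, add_right_comm y]
      ring
    · simp
    · rintro t _ ⟨h2, h3⟩
      split_ifs with h4 h5 h6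
      · exact absurd (Fin.ext h5) h3
      · exact absurd (Fin.ext (by simpa using h6)) h2
      · simp
      · rfl
    · simp
    · simp
  · refine sum_eq_zero fun t _ => ?_
    split_ifs with h4 h5 h6
    · rw [key, show (t : ℕ) - z.1 = 0 by omega, pow_zero, ent_one_of_ne (by omega)]
    · omega
    · simp
    · rfl

/-- The lower right part of `reducedPhi`, whose columns are `U (-U) ^ p e_1` and `U e_s`, without the
first `k` entries. -/
def phiCore (U : Matrix (Fin N) (Fin N) K) (μ k l : ℕ) : Matrix (Fin (μ + l)) (Fin (μ + l)) K :=
  Matrix.of fun i j =>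
    if (j : ℕ) < μ then ent (U * (-U) ^ (μ - j)) (k + 1 + i) 1 else ent U (k + 1 + i) (j - μ + 1)

theorem div_mod_pivot {μ l n i : ℕ} (hl : 1 ≤ l) (hln : l ≤ n) (hi : i < μ * n + (n + 1 - l)) :
    i / n ≤ μ ∧ i % n < n ∧ i = (i / n) * n + i % n ∧ (i / n = μ → i % n < n + 1 - l) := by
  have hn : 0 < n := by omega
  have h1 : i / n ≤ μ := by
    rw [← Nat.lt_succ_iff, Nat.div_lt_iff_lt_mul hn, Nat.succ_mul]
    omega
  refine ⟨h1, Nat.mod_lt _ hn, (Nat.div_add_mod' i n).symm, fun h => ?_⟩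
  have := Nat.div_add_mod' i n
  rw [h] at this
  omega

/-- The exponent in the Laplace expansion of `reducedPhi` has the parity of the exponent stated in
`det_reducedPhi`. -/
theorem even_phi_exponent (μ k l x y : ℕ) :
    Even (μ * (μ * (μ + k + l + 1) + (μ + k + 2)) + (μ + k + l + 3) * x +
      (l * (μ * (μ + k + l + 1) + (μ + k + 2)) + l * μ + l * ((μ + k + l + 2) * μ) + 2 * y) +
      ((μ + k + l + 1) * x + μ + μ * l + (μ + k + l + 1) * l)) := by
  simp only [parity_simps]
  by_cases Even μ <;> by_cases Even k <;> by_cases Even l <;> by_cases Even x <;> simp [*]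

set_option maxHeartbeats 1000000 in
/-- Expansion of `reducedPhi` along its pivot rows. The first `μ (N + 1) + N + 2 - l` rows are pivot
rows, with unit vectors at the columns `gx`; the other columns are the first column of each block
but the last and the first `l` columns of the last block, where the pivot rows vanish. -/
theorem det_reducedPhi (U : Matrix (Fin N) (Fin N) K) {a b : ℕ → K}
    (ha : ∀ s, N < s → a s = 0) (hb : ∀ s, N < s → b s = 0) {μ k l : ℕ} (hk : 1 ≤ k) (hl : 1 ≤ l)
    (hN : N = μ + k + l) :
    ((reducedPhi U a b (μ + 1) k l).submatrix id finProdFinEquiv.symm).det =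
      (-1) ^ ((N + 1) * (∑ i ∈ range μ, i) + μ + μ * l + (N + 1) * l) * (phiCore U μ k l).det := by
  set p := μ * (N + 1) + (N + 2 - l) with hp
  have hs : p + (μ + l) = (μ + 1) * (N + 2) := by
    have : (μ + 1) * (N + 2) = μ * (N + 1) + μ + (N + 2) := by ring
    omega
  have hpiv : ∀ i : Fin p, ∃ t y : ℕ, t = i / (N + 1) ∧ y = i % (N + 1) ∧ t ≤ μ ∧ y < N + 1 ∧
      (i : ℕ) = t * (N + 1) + y ∧ y + blockShift (μ + 1) k l t ≤ N + 1 ∧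
      1 ≤ blockShift (μ + 1) k l t ∧ (t = μ → l ≤ blockShift (μ + 1) k l t) := by
    intro i
    obtain ⟨h1, h2, h3, h4⟩ := div_mod_pivot hl (show l ≤ N + 1 by omega)
      (show (i : ℕ) < μ * (N + 1) + (N + 1 + 1 - l) by have := i.2; omega)
    refine ⟨_, _, rfl, rfl, h1, h2, h3, ?_⟩
    unfold blockShift
    split_ifs with h5 h6 <;> omega
  choose tt yy _ _ htle hyle hi hsh hsh1 hshl using hpiv
  set gr : Fin p → Fin ((μ + 1) * (N + 2)) := fun i => ⟨i, by omega⟩ with hgr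
  set gx : Fin p → Fin (μ + 1) × Fin (N + 2) := fun i =>
    (⟨tt i, by have := htle i; omega⟩,
      ⟨yy i + blockShift (μ + 1) k l (tt i), by have := hsh i; omega⟩) with hgx
  set fr : Fin (μ + l) → Fin ((μ + 1) * (N + 2)) := fun j => ⟨p + j, by omega⟩ with hfr
  set fx : Fin (μ + l) → Fin (μ + 1) × Fin (N + 2) := fun j =>
    if h : (j : ℕ) < μ then (⟨j, by omega⟩, ⟨0, by omega⟩)
    else (⟨μ, by omega⟩, ⟨j - μ, by omega⟩) with hfx
  have hfx1 : ∀ j : Fin (μ + l), (j : ℕ) < μ → ((fx j).1 : ℕ) = j ∧ ((fx j).2 : ℕ) = 0 := by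
    intro j hj; simp [hfx, hj]
  have hfx2 : ∀ j : Fin (μ + l), ¬ (j : ℕ) < μ → ((fx j).1 : ℕ) = μ ∧ ((fx j).2 : ℕ) = j - μ := by
    intro j hj; simp [hfx, hj]
  have hlex : ∀ x y : Fin (μ + 1) × Fin (N + 2), (x.1 : ℕ) < y.1 →
      finProdFinEquiv x < finProdFinEquiv y := by
    intro x y hxy
    rw [Fin.lt_def, finProdFinEquiv_apply_val, finProdFinEquiv_apply_val]
    have e : (N + 2) * ((x.1 : ℕ) + 1) ≤ (N + 2) * y.1 := Nat.mul_le_mul_left _ hxy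
    have e' : (N + 2) * ((x.1 : ℕ) + 1) = (N + 2) * x.1 + (N + 2) := by ring
    have := x.2.2
    omega
  have hlex' : ∀ x y : Fin (μ + 1) × Fin (N + 2), (x.1 : ℕ) = y.1 → (x.2 : ℕ) < y.2 →
      finProdFinEquiv x < finProdFinEquiv y := by
    intro x y h1 h2
    rw [Fin.lt_def, finProdFinEquiv_apply_val, finProdFinEquiv_apply_val, h1]
    omega
  have hmono : ∀ i j : Fin p, i < j → tt i < tt j ∨ (tt i = tt j ∧ yy i < yy j) := by
    intro i j hij
    have hij : (i : ℕ) < j := hij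
    rw [hi i, hi j] at hij
    rcases lt_trichotomy (tt i) (tt j) with h | h | h
    · exact Or.inl h
    · rw [h] at hij; exact Or.inr ⟨h, by omega⟩
    · have e : (tt j + 1) * (N + 1) ≤ tt i * (N + 1) := Nat.mul_le_mul_right _ h
      have e' : (tt j + 1) * (N + 1) = tt j * (N + 1) + (N + 1) := by ring
      have := hyle j
      omega
  have hpivot_last : ∀ i : Fin p, ∀ z : Fin (μ + 1) × Fin (N + 2),
      ¬((z.2 : ℕ) = 0 ∧ (z.1 : ℕ) + 1 < μ + 1) →
      reducedPhi U a b (μ + 1) k l (gr i) z =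
      if (z.1 : ℕ) = tt i then
        (if (z.2 : ℕ) = yy i + blockShift (μ + 1) k l (tt i) then 1 else 0)
      else if (z.1 : ℕ) + 1 = tt i then
        shiftCoeff U a b (yy i + 1 + blockShift (μ + 1) k l (tt i)) z.2
      else 0 := by
    intro i z hz
    rw [reducedPhi_of_not_free U a b _ _ hz, ← phiCoeff_of_pivot U ha hb hk hl hN (htle i) (hsh i)
      (hyle i), ← hi i]
  rw [det_eq_of_complementary_block_zero hs _ gr (fun i => finProdFinEquiv (gx i)) fr
    (fun j => finProdFinEquiv (fx j))]
  rotate_left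
  · intro i j hij; exact hij
  · intro i j hij
    rcases hmono i j hij with h | ⟨h, h'⟩
    · exact hlex _ _ h
    · refine hlex' _ _ h ?_
      simp only [hgx, h]
      omega
  · intro i j hij
    rw [Fin.lt_def] at hij ⊢
    simpa [hfr] using hij
  · intro i j hij
    have hij : (i : ℕ) < j := hij
    by_cases h1 : (i : ℕ) < μ
    · by_cases h2 : (j : ℕ) < μ
      · exact hlex _ _ (by rw [(hfx1 i h1).1, (hfx1 j h2).1]; exact hij)
      · exact hlex _ _ (by rw [(hfx1 i h1).1, (hfx2 j h2).1]; exact h1)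
    · have h2 : ¬ (j : ℕ) < μ := by omega
      refine hlex' _ _ (by rw [(hfx2 i h1).1, (hfx2 j h2).1]) ?_
      rw [(hfx2 i h1).2, (hfx2 j h2).2]
      omega
  · intro i j h
    have := congrArg Fin.val h
    simp only [hgr, hfr] at this
    omega
  · intro i j h
    have h := finProdFinEquiv.injective h
    have h1 := congrArg (fun x => (x.1 : ℕ)) h
    have h2 := congrArg (fun x => (x.2 : ℕ)) h
    simp only [hgx] at h1 h2
    have := hsh1 i
    have := hshl i
    by_cases hj : (j : ℕ) < μ
    · rw [(hfx1 j hj).2] at h2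
      omega
    · rw [(hfx2 j hj).2] at h2
      rw [(hfx2 j hj).1] at h1
      omega
  · intro i j
    rw [submatrix_apply, id, Equiv.symm_apply_apply]
    by_cases hj : (j : ℕ) < μ
    · obtain ⟨h1, h2⟩ := hfx1 j hj
      exact reducedPhi_pivot_free U ha hb hk hl hN (htle i) (hsh i) (hyle i) _ (hi i) _ (by omega)
    · obtain ⟨h1, h2⟩ := hfx2 j hj
      have := hsh1 i
      have := hshl i
      rw [hpivot_last i _ (by omega), h1, h2]
      have := htle i
      split_ifs <;> first | omega | rfl
  have hA : (((reducedPhi U a b (μ + 1) k l).submatrix id finProdFinEquiv.symm).submatrix gr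
      (fun i => finProdFinEquiv (gx i))).det = 1 := by
    have hval : ∀ i j : Fin p, ((reducedPhi U a b (μ + 1) k l).submatrix id
        finProdFinEquiv.symm).submatrix gr (fun i => finProdFinEquiv (gx i)) i j =
        if tt j = tt i then
        (if yy j + blockShift (μ + 1) k l (tt j) = yy i + blockShift (μ + 1) k l (tt i)
          then 1 else 0)
      else if tt j + 1 = tt i then
        shiftCoeff U a b (yy i + 1 + blockShift (μ + 1) k l (tt i))
          (yy j + blockShift (μ + 1) k l (tt j))
      else 0 := by
      intro i j
      rw [submatrix_apply, submatrix_apply, id, Equiv.symm_apply_apply, hpivot_last]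
      have := hsh1 j
      simp only [hgx]
      omega
    rw [det_of_isLowerTriangular]
    · refine prod_eq_one fun i _ => ?_
      rw [hval, if_pos rfl, if_pos rfl]
    · intro i j hij
      have hij : i < j := hij
      rw [hval]
      rcases hmono i j hij with h | ⟨h, h'⟩
      · rw [if_neg (by omega), if_neg (by omega)]
      · rw [if_pos h.symm, if_neg (by rw [h]; omega)]
  have hD : ((reducedPhi U a b (μ + 1) k l).submatrix id finProdFinEquiv.symm).submatrix fr
      (fun j => finProdFinEquiv (fx j)) = phiCore U μ k l := by
    ext i j
    rw [submatrix_apply, submatrix_apply, id, Equiv.symm_apply_apply]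
    simp only [phiCore, of_apply]
    by_cases hj : (j : ℕ) < μ
    · obtain ⟨h1, h2⟩ := hfx1 j hj
      rw [if_pos hj, reducedPhi_of_free U a b _ _ (by omega), sum_eq_single (Fin.last μ)]
      · simp only [hfr, Fin.val_last, hp]
        rw [if_pos (by omega)]
        simp only [phiCoeff_of_last U ha hb hk hl hN _ _ _ le_rfl, if_true]
        rw [sum_shiftCoeff_mul_ent, h1]
      · intro t _ ht
        have ht' : (t : ℕ) < μ := Fin.val_lt_last ht
        simp only [hfr, hp, phiCoeff_of_last U ha hb hk hl hN _ _ _ ht'.le, if_neg ht'.ne]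
        simp
      · simp
    · obtain ⟨h1, h2⟩ := hfx2 j hj
      rw [if_neg hj, reducedPhi_of_not_free U a b _ _ (by omega), h1, h2]
      simp only [hfr, hp, phiCoeff_of_last U ha hb hk hl hN _ _ _ le_rfl, if_true]
      rw [shiftCoeff, if_pos (by omega)]
  rw [hA, hD, mul_one]
  congr 1
  have hsum : ∑ j : Fin (μ + l), (((fr j : Fin _) : ℕ) + (finProdFinEquiv (fx j) : Fin _)) =
      μ * p + (N + 3) * (∑ i ∈ range μ, i) + (l * p + l * μ + l * ((N + 2) * μ) +
        2 * ∑ i ∈ range l, i) := by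
    rw [Fin.sum_univ_add]
    congr 1
    · have : ∀ j : Fin μ, (((fr (Fin.castAdd l j) : Fin _) : ℕ) +
          (finProdFinEquiv (fx (Fin.castAdd l j)) : Fin _)) = p + (N + 3) * j := by
        intro j
        obtain ⟨h1, h2⟩ := hfx1 (Fin.castAdd l j) (by simp)
        rw [finProdFinEquiv_apply_val, h1, h2]
        simp only [hfr, Fin.val_castAdd]
        ring
      simp only [this, sum_add_distrib, sum_const, card_univ, Fintype.card_fin, ← mul_sum]
      rw [Fin.sum_univ_eq_sum_range (fun i => i)]
      rfl
    · have : ∀ j : Fin l, (((fr (Fin.natAdd μ j) : Fin _) : ℕ) +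
          (finProdFinEquiv (fx (Fin.natAdd μ j)) : Fin _)) = p + μ + (N + 2) * μ + 2 * j := by
        intro j
        obtain ⟨h1, h2⟩ := hfx2 (Fin.natAdd μ j) (by simp)
        rw [finProdFinEquiv_apply_val, h1, h2]
        simp only [hfr, Fin.val_natAdd, Nat.add_sub_cancel_left]
        ring
      simp only [this, sum_add_distrib, sum_const, card_univ, Fintype.card_fin, ← mul_sum]
      rw [Fin.sum_univ_eq_sum_range (fun i => i)]
      simp only [smul_eq_mul]
  rw [hsum]
  rw [neg_one_pow_eq_pow_mod_two, neg_one_pow_eq_pow_mod_two (n := (N + 1) * _ + _ + _ + _)]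
  congr 1
  have hp' : p = μ * (N + 1) + (μ + k + 2) := by omega
  rw [hp', hN]
  generalize ∑ i ∈ range μ, i = x
  generalize ∑ i ∈ range l, i = y
  have := even_phi_exponent μ k l x y
  rw [Nat.even_iff] at this
  omega

end PhiReduction

section PhiFormula

variable {K : Type*} [CommRing K] {N : ℕ}

/-- The columns of `dualPhiMatrix` that are not unit vectors, without their first `k` entries. -/
def dualPhiCore (U : Matrix (Fin N) (Fin N) K) (μ k l : ℕ) :
    Matrix (Fin (μ + l)) (Fin (μ + l)) K :=
  Matrix.of fun i j =>
    if (j : ℕ) < l then ent U (k + 1 + i) (j + 1) else ent (U ^ ((j : ℕ) - l + 2)) (k + 1 + i) 1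

/-- The first `k` columns of `Φ_{kl}(U)` are unit vectors. -/
theorem det_dualPhiMatrix (U : Matrix (Fin N) (Fin N) K) {μ k l : ℕ} (hN : N = μ + k + l) :
    (dualPhiMatrix k l U).det = (dualPhiCore U μ k l).det := by
  rw [det_eq_of_complementary_block_zero (show (μ + l) + k = N by omega) _
    (fun i => ⟨k + i, by omega⟩) (fun i => ⟨k + i, by omega⟩)
    (fun i => ⟨i, by omega⟩) (fun i => ⟨i, by omega⟩)]
  rotate_left
  · intro i j h; exact Nat.add_lt_add_left (Fin.lt_def.1 h) k
  · intro i j h; exact Nat.add_lt_add_left (Fin.lt_def.1 h) k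
  · intro i j h; exact h
  · intro i j h; exact h
  · intro i j h; have := congrArg Fin.val h; simp only at this; omega
  · intro i j h; have := congrArg Fin.val h; simp only at this; omega
  · intro i j
    simp only [dualPhiMatrix, of_apply, j.2, if_true, pow_zero]
    exact ent_one_of_ne (by omega)
  · have h1 : ((dualPhiMatrix k l U).submatrix (fun i : Fin k => (⟨i, by omega⟩ : Fin N))
        (fun i : Fin k => (⟨i, by omega⟩ : Fin N))) = 1 := by
      refine Matrix.ext fun i j => ?_
      rw [submatrix_apply]
      simp only [dualPhiMatrix, of_apply, j.2, if_true, pow_zero]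
      by_cases h : i = j
      · subst h
        rw [ent_eq_apply 1 (⟨i, by omega⟩ : Fin N) ⟨i, by omega⟩ rfl rfl, one_apply_eq,
          one_apply_eq]
      · rw [one_apply_ne h]
        exact ent_one_of_ne fun h' => h (Fin.ext (by omega))
    have h2 : ((dualPhiMatrix k l U).submatrix (fun i : Fin (μ + l) => (⟨k + i, by omega⟩ : Fin N))
        (fun i : Fin (μ + l) => (⟨k + i, by omega⟩ : Fin N))) = dualPhiCore U μ k l := by
      refine Matrix.ext fun i j => ?_
      rw [submatrix_apply]
      simp only [dualPhiMatrix, dualPhiCore, of_apply]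
      rw [if_neg (by omega)]
      by_cases h : (j : ℕ) < l
      · rw [if_pos (by omega), if_pos h]
        congr 1 <;> omega
      · rw [if_neg (by omega), if_neg h, show k + (j : ℕ) - (k + l) = j - l by omega]
        congr 1
        omega
    rw [h1, h2, det_one, mul_one]
    have : ∀ b : Fin k, (-1 : K) ^ ((b : ℕ) + (b : ℕ)) = 1 := fun b => Even.neg_one_pow ⟨_, rfl⟩
    rw [← prod_pow_eq_pow_sum]
    simp [this]

/-- The two core matrices have the same columns up to order and sign. -/
theorem det_phiCore (U : Matrix (Fin N) (Fin N) K) (μ k l : ℕ) :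
    (phiCore U μ k l).det = (-1) ^ (μ * (l + 1)) * (dualPhiCore U μ k l).det := by
  -- `τ'` moves the columns `U e_s` to the front and reverses the order of the others.
  set τ' : Fin (μ + l) → Fin (μ + l) := fun j =>
    if h : (j : ℕ) < l then ⟨μ + j, by omega⟩ else ⟨μ - 1 - (j - l), by omega⟩ with hτ'
  have hv1 : ∀ j : Fin (μ + l), (j : ℕ) < l → (τ' j : ℕ) = μ + j := by
    intro j hj; simp [hτ', hj]
  have hv2 : ∀ j : Fin (μ + l), ¬(j : ℕ) < l → (τ' j : ℕ) = μ - 1 - (j - l) := by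
    intro j hj; simp [hτ', hj]
  have hinj : Function.Injective τ' := by
    intro i j h
    have h := congrArg Fin.val h
    apply Fin.ext
    have := i.2
    have := j.2
    by_cases hi : (i : ℕ) < l <;> by_cases hj : (j : ℕ) < l <;>
      simp only [hv1, hv2, hi, hj, not_false_eq_true] at h <;> omega
  set τ := Equiv.ofBijective τ' (Finite.injective_iff_bijective.1 hinj) with hτ
  have hτv : ∀ j, τ j = τ' j := fun _ => rfl
  have h1 := det_submatrix_eq_pow_inversions τ (phiCore U μ k l)ᵀ
    (fun j => if (j : ℕ) < l then 0 else (j : ℕ)) (by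
      intro j
      split_ifs with hj
      · rw [card_eq_zero, filter_eq_empty_iff]
        intro i hi
        have hi : i < j := mem_Iio.1 hi
        rw [Fin.lt_def] at hi
        rw [hτv, hτv, Fin.lt_def, hv1 j hj, hv1 i (by omega)]
        omega
      · rw [filter_true_of_mem, Fin.card_Iio]
        intro i hi
        have hi : i < j := mem_Iio.1 hi
        rw [Fin.lt_def] at hi
        have := j.2
        rw [hτv, hτv, Fin.lt_def, hv2 j hj]
        by_cases hi' : (i : ℕ) < l
        · rw [hv1 i hi']; omega
        · rw [hv2 i hi']; omega)
  have h2 : (phiCore U μ k l)ᵀ.submatrix τ id = Matrix.of fun (i j : Fin (μ + l)) =>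
      (if (i : ℕ) < l then 1 else (-1 : K) ^ ((i : ℕ) - l + 1)) * (dualPhiCore U μ k l)ᵀ i j := by
    refine Matrix.ext fun i j => ?_
    rw [submatrix_apply, hτv, transpose_apply, of_apply, transpose_apply]
    simp only [phiCore, dualPhiCore, of_apply, id]
    by_cases hi : (i : ℕ) < l
    · rw [hv1 i hi, if_neg (by omega), if_pos hi, if_pos hi, Nat.add_sub_cancel_left, one_mul]
    · have := i.2
      rw [hv2 i hi, if_pos (by omega), if_neg hi, if_neg hi,
        show μ - (μ - 1 - ((i : ℕ) - l)) = (i : ℕ) - l + 1 by omega]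
      have hpow : ∀ (e s : ℕ), ent (U * (-U) ^ e) s 1 = (-1) ^ e * ent (U ^ (e + 1)) s 1 := by
        intro e s
        rcases Nat.even_or_odd e with he | he
        · rw [he.neg_pow, he.neg_one_pow, one_mul, pow_succ']
        · rw [he.neg_pow, he.neg_one_pow, mul_neg, ent_neg, pow_succ', neg_one_mul]
      rw [hpow]
  rw [h2, det_mul_column, det_transpose, det_transpose] at h1
  have hs : ∑ j : Fin (μ + l), (if (j : ℕ) < l then 0 else (j : ℕ)) =
      ∑ i : Fin μ, (l + (i : ℕ)) := by
    rw [← Fin.sum_congr' _ (add_comm l μ), Fin.sum_univ_add]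
    simp [add_comm]
  have hp : ∏ j : Fin (μ + l), (if (j : ℕ) < l then 1 else (-1 : K) ^ ((j : ℕ) - l + 1)) =
      ∏ i : Fin μ, (-1) ^ ((i : ℕ) + 1) := by
    rw [← Fin.prod_congr' _ (add_comm l μ), Fin.prod_univ_add]
    simp
  rw [hs, hp] at h1
  have h3 : (phiCore U μ k l).det = (-1) ^ (∑ i : Fin μ, (l + (i : ℕ))) *
      ((-1) ^ (∑ i : Fin μ, (l + (i : ℕ))) * (phiCore U μ k l).det) := by
    rw [← mul_assoc, ← pow_add, Even.neg_one_pow ⟨_, rfl⟩, one_mul]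
  rw [h3, ← h1, ← mul_assoc]
  congr 1
  rw [← prod_pow_eq_pow_sum, ← prod_mul_distrib]
  have : ∀ i : Fin μ, (-1 : K) ^ (l + (i : ℕ)) * (-1) ^ ((i : ℕ) + 1) = (-1) ^ (l + 1) := by
    intro i
    rw [← pow_add, show l + (i : ℕ) + (i + 1) = (l + 1) + ((i : ℕ) + i) by ring, pow_add,
      Even.neg_one_pow ⟨(i : ℕ), rfl⟩, mul_one]
  simp only [this]
  simp [← pow_mul, mul_comm]

/-- Additivity of triangular numbers up to a product, which splits the signs of
`φ_{kl}`. -/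
theorem triangle_add (a b : ℕ) :
    (a + b) * (a + b - 1) / 2 = a * (a - 1) / 2 + b * (b - 1) / 2 + a * b := by
  rw [← Finset.sum_range_id (a + b), ← Finset.sum_range_id a, ← Finset.sum_range_id b,
    Finset.sum_range_add, sum_add_distrib, sum_const, card_range, smul_eq_mul]
  ring

theorem triangle_two_mul (h : ℕ) : Even ((2 * h) * (2 * h - 1) / 2 + h) := by
  rcases Nat.eq_zero_or_pos h with rfl | hh
  · simp
  rw [mul_assoc, Nat.mul_div_cancel_left _ (by omega)]
  refine ⟨h * h, ?_⟩
  obtain ⟨j, rfl⟩ : ∃ j, h = j + 1 := ⟨h - 1, by omega⟩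
  simp only [show 2 * (j + 1) - 1 = 2 * j + 1 by omega]
  ring

theorem even_sign_exponent {μ k l x y z h : ℕ} (h1 : Even (μ + k + l))
    (h2 : Even (x + (y + z + k * l) + μ * (k + l) + h)) :
    Even (k * (l + 1) + (x + l) + (h + y + z)) := by
  simp only [parity_simps] at *
  generalize Even μ = a₁ at *
  generalize Even k = a₂ at *
  generalize Even l = a₃ at *
  generalize Even x = a₄ at *
  generalize Even y = a₅ at *
  generalize Even z = a₆ at *
  generalize Even h = a₇ at *
  by_cases a₁ <;> by_cases a₂ <;> by_cases a₃ <;> by_cases a₄ <;> by_cases a₅ <;> by_cases a₆ <;>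
    simp_all

/-- Comparison of the signs in the definitions of `φ_{kl}` on matrices of size `N` and
in the formula for the pullback. -/
theorem dualSign_mul_eq {μ k l : ℕ} (hN : N = μ + k + l) :
    dualSign N k l * (-1) ^ ((N + 1) * (μ * (μ - 1) / 2 + l)) = signPhi (N + 1) k l := by
  unfold dualSign signPhi
  rcases Nat.even_or_odd N with he | ho
  · rw [if_pos he, if_neg (by rw [Nat.even_add_one]; simpa using he)]
    obtain ⟨h, hh⟩ := he
    have h1 : (N + 1 - 1) / 2 = h := by omega
    rw [h1]
    have t1 := triangle_add μ (k + l)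
    have t2 := triangle_add k l
    have t3 := triangle_two_mul h
    rw [show 2 * h = μ + (k + l) by omega, t1, t2] at t3
    have hpar : Even (μ + k + l) := ⟨h, by omega⟩
    have hN1 : (-1 : ℤ) ^ (N + 1) = -1 := (Even.add_one ⟨h, hh⟩).neg_one_pow
    rw [pow_mul (-1 : ℤ) (N + 1), hN1, ← pow_add]
    have := even_sign_exponent hpar t3
    rw [neg_one_pow_eq_pow_mod_two, neg_one_pow_eq_pow_mod_two (n := h + _ + _)]
    congr 1
    rw [Nat.even_iff] at this
    omega
  · rw [if_neg (Nat.not_even_iff_odd.2 ho), if_pos ho.add_one, pow_mul (-1 : ℤ) (N + 1), ho.add_one.neg_one_pow,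
      one_pow, mul_one]
    rfl

/-- The formula for the functions `φ_{kl}`. -/
theorem varphi_eq_of_shift {X : Matrix (Fin (N + 1)) (Fin (N + 1)) ℂ} (hX : X.det ≠ 0)
    (h1n : ent X 1 (N + 1) ≠ 0) (hn1 : ent X (N + 1) 1 ≠ 0) {k l : ℕ} (hk : 1 ≤ k) (hl : 1 ≤ l)
    (hkl : k + l ≤ N) :
    varphi k l (psiOne X) = (signPhi (N + 1) k l : ℂ) *
      (phiX k l X / (ent X 1 (N + 1) * X.det) ^ (N + 1 - k - l)) := by
  obtain ⟨a, b, ha, hb, h⟩ := exists_ent_shift_eq' hX h1n hn1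
  obtain ⟨μ, hN⟩ : ∃ μ, N = μ + k + l := ⟨N - k - l, by omega⟩
  have hm : N + 1 - k - l = μ + 1 := by omega
  set U : Matrix (Fin N) (Fin N) ℂ := psiOne X
  have h1 : phiX k l X = (X.det * ent X 1 (N + 1)) ^ (N + 1 - k - l) *
      ((-1) ^ ((N + 1) * (∑ i ∈ range μ, i) + μ + μ * l + (N + 1) * l) *
      ((-1) ^ (μ * (l + 1)) * (dualPhiCore U μ k l).det)) := by
    rw [phiX, det_bigPhi_eq U a b h hk hl hkl, hm, det_reducedPhi U ha hb hk hl hN, det_phiCore]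
  have h2 : varphi k l (psiOne X) = (dualSign N k l : ℂ) * (dualPhiCore U μ k l).det := by
    rw [← det_dualPhiMatrix U hN]; rfl
  rw [h1, h2, mul_comm (ent X 1 (N + 1)) X.det,
    mul_div_cancel_left₀ _ (pow_ne_zero _ (mul_ne_zero hX h1n)), ← dualSign_mul_eq hN]
  have h3 : ∀ e : ℕ, ((-1 : ℂ)) ^ e * (-1) ^ e = 1 := fun e => by
    rw [← pow_add, Even.neg_one_pow ⟨_, rfl⟩]
  rw [Finset.sum_range_id]
  generalize μ * (μ - 1) / 2 = x
  have h4 : (-1 : ℂ) ^ ((N + 1) * x + μ + μ * l + (N + 1) * l) * (-1) ^ (μ * (l + 1)) =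
      (-1) ^ ((N + 1) * (x + l)) := by
    rw [← pow_add, show (N + 1) * x + μ + μ * l + (N + 1) * l + μ * (l + 1) =
      (N + 1) * (x + l) + (μ * (l + 1) + μ * (l + 1)) by ring, pow_add,
      Even.neg_one_pow ⟨μ * (l + 1), rfl⟩, mul_one]
  push_cast
  rw [← mul_assoc ((-1 : ℂ) ^ _) _ (dualPhiCore U μ k l).det, h4]
  linear_combination (-(dualSign N k l : ℂ) * (dualPhiCore U μ k l).det) *
    h3 ((N + 1) * (x + l))

end PhiFormula

/-! ### The functions `g_{ij}` as determinants -/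

section CauchyBinetChain

variable {K : Type*} [CommRing K] {N : ℕ}

theorem of_append_update {K : Type*} {q e : ℕ} [DecidableEq (Fin q)] (v : Fin q → Fin (q + e) → K)
    (R : Fin e → Fin (q + e) → K) (i : Fin q) (x : Fin (q + e) → K) :
    (Matrix.of fun j c : Fin (q + e) => Fin.append (Function.update v i x) R j c) =
      (Matrix.of fun j c : Fin (q + e) => Fin.append v R j c).updateRow (Fin.castAdd e i) x := by
  refine Matrix.ext fun j c => ?_
  rw [updateRow_apply, of_apply, of_apply]
  induction j using Fin.addCases with
  | left j =>
    by_cases hj : j = i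
    · subst hj; simp
    · rw [if_neg (by simpa using hj)]; simp [hj]
  | right j =>
    rw [if_neg (by intro h; have := congrArg Fin.val h; simp at this; omega)]
    simp

/-- The determinant as an alternating map of its upper rows, the lower rows being fixed. -/
def detFixedRows {q e : ℕ} (R : Fin e → Fin (q + e) → K) : (Fin (q + e) → K) [⋀^Fin q]→ₗ[K] K where
  toFun v := Matrix.det (Matrix.of fun i j : Fin (q + e) => Fin.append v R i j)
  map_update_add' := by
    intro inst v i x y
    rw [of_append_update, of_append_update, of_append_update, det_updateRow_add]
  map_update_smul' := by
    intro inst v i c x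
    rw [of_append_update, of_append_update, det_updateRow_smul, smul_eq_mul]
  map_eq_zero_of_eq' := by
    intro v i j h hij
    refine det_zero_of_row_eq (i := Fin.castAdd e i) (j := Fin.castAdd e j) (by simpa using hij) ?_
    funext c
    rw [of_apply, of_apply, Fin.append_left, Fin.append_left, h]

theorem minor_eq_det {m n q : ℕ} (U : Matrix (Fin m) (Fin n) K) {I J : Finset ℕ} (hI : I.card = q)
    (hJ : J.card = q) :
    minor U I J = (Matrix.of fun a b : Fin q => ent U (nthElt I a) (nthElt J b)).det := by
  subst hI
  rw [minor, dif_pos hJ]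
  congr 1
  ext a b
  simp only [of_apply, orderEmbOfFin_eq_nthElt]

/-- One step of the chain of minors in `g_{ij}`: the rows of `Y` are shifted by one column and
multiplied by `U`, and `e` rows of `U` are appended. -/
theorem sum_det_mul_minor (U : Matrix (Fin N) (Fin N) K) (q e : ℕ) (he : e ≤ N) (Y : ℕ → ℕ → K)
    (J : Finset ℕ) (hJ : J.card = q + e) :
    ∑ I ∈ powersetCard q (Icc 2 N), (Matrix.of fun a b : Fin q => Y a (nthElt I b)).det *
        minor U (gammaStar I ∪ Icc (N + 1 - e) N) J =
      (Matrix.of fun a b : Fin (q + e) =>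
        if (a : ℕ) < q then ∑ s ∈ Icc 2 N, Y a s * ent U (s - 1) (nthElt J b)
        else ent U (N + 1 - e + (a - q)) (nthElt J b)).det := by
  set R : Fin e → Fin (q + e) → K := fun a b => ent U (N + 1 - e + a) (nthElt J b) with hR
  set v : ℕ → Fin (q + e) → K := fun s b => ent U (s - 1) (nthElt J b) with hv
  have h1 := alternatingMap_sum_smul (detFixedRows R) (Icc 2 N) (fun (a : Fin q) s => Y a s) v
  have h2 : detFixedRows R (fun i => ∑ s ∈ Icc 2 N, Y i s • v s) =
      (Matrix.of fun a b : Fin (q + e) =>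
        if (a : ℕ) < q then ∑ s ∈ Icc 2 N, Y a s * ent U (s - 1) (nthElt J b)
        else ent U (N + 1 - e + (a - q)) (nthElt J b)).det := by
    change Matrix.det _ = _
    congr 1
    ext a b
    induction a using Fin.addCases with
    | left a => simp [of_apply, hv]
    | right a => simp [of_apply, hR]
  rw [← h2, h1]
  refine sum_congr rfl fun I hI => ?_
  obtain ⟨hIS, hIc⟩ := mem_powersetCard.1 hI
  have hmem : ∀ a : ℕ, a < q → 2 ≤ nthElt I a ∧ nthElt I a ≤ N ∧ nthElt I a ∈ I := by
    intro a ha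
    have h := nthElt_mem (I := I) (a := a) (by omega)
    exact ⟨(mem_Icc.1 (hIS h)).1, (mem_Icc.1 (hIS h)).2, h⟩
  have hlt : ∀ a b : ℕ, a < b → b < q → nthElt I a < nthElt I b := by
    intro a b hab hb
    have := (I.orderEmbOfFin hIc).strictMono (show (⟨a, by omega⟩ : Fin q) < ⟨b, hb⟩ from hab)
    rwa [orderEmbOfFin_eq_nthElt, orderEmbOfFin_eq_nthElt] at this
  have hg : (gammaStar I).card = q := by
    rw [gammaStar, card_image_of_injOn, hIc]
    intro a ha b hb hab
    have h1 := mem_Icc.1 (hIS ha)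
    have h2 := mem_Icc.1 (hIS hb)
    simp only at hab
    omega
  -- If `γ^*(I)` meets the appended interval, the minor is zero by convention, since its index sets
  -- have different sizes, and the determinant has two equal rows.
  congr 1
  symm
  change Matrix.det _ = _
  by_cases hd : Disjoint (gammaStar I) (Icc (N + 1 - e) N)
  · have hc : (gammaStar I ∪ Icc (N + 1 - e) N).card = q + e := by
      rw [card_union_of_disjoint hd, hg, Nat.card_Icc]; omega
    have hlow : ∀ a, a < q → nthElt I a - 1 < N + 1 - e := by
      intro a ha
      have h1 := hmem a ha
      by_contra h
      exact (Finset.disjoint_left.1 hd) (mem_image_of_mem (fun a => a - 1) h1.2.2)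
        (mem_Icc.2 ⟨by omega, by omega⟩)
    have hn : ∀ a, a < q + e → nthElt (gammaStar I ∪ Icc (N + 1 - e) N) a =
        if a < q then nthElt I a - 1 else N + 1 - e + (a - q) := by
      intro a ha
      refine nthElt_eq_of_strictMono _ hc
        (fun a => if a < q then nthElt I a - 1 else N + 1 - e + (a - q)) ?_ ?_ ha
      · intro a ha
        simp only [mem_union, mem_Icc]
        split_ifs with h
        · exact Or.inl (mem_image_of_mem (fun a => a - 1) (hmem a h).2.2)
        · right; omega
      · intro a b hab hb
        split_ifs with h1 h2 h2
        · have := hlt a b hab h2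
          have := hmem a h1
          omega
        · have := hlow a h1
          omega
        · omega
        · omega
    rw [minor_eq_det U hc hJ]
    congr 1
    ext a b
    rw [of_apply, of_apply, hn a a.2]
    induction a using Fin.addCases with
    | left a => simp [hv]
    | right a => simp [hR]
  · have hc : ¬ J.card = (gammaStar I ∪ Icc (N + 1 - e) N).card := by
      intro h
      apply hd
      rw [← card_union_eq_card_add_card, hg, Nat.card_Icc, ← h, hJ]
      omega
    rw [minor, dif_neg hc]
    obtain ⟨x, hx1, hx2⟩ := Finset.not_disjoint_iff.1 hd
    obtain ⟨y, hy, rfl⟩ := mem_image.1 hx1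
    have : ∃ a : Fin q, nthElt I a = y := by
      have h : y ∈ Set.range (I.orderEmbOfFin hIc) := by rw [range_orderEmbOfFin]; exact hy
      obtain ⟨a, ha⟩ := h
      exact ⟨a, by rw [← ha, orderEmbOfFin_eq_nthElt]⟩
    obtain ⟨a, rfl⟩ := this
    have hx2 := mem_Icc.1 hx2
    refine det_zero_of_row_eq (i := Fin.castAdd e a)
      (j := Fin.natAdd q (⟨nthElt I a - 1 - (N + 1 - e), by omega⟩ : Fin e)) ?_ ?_
    · intro h
      have := congrArg Fin.val h
      simp at this
      omega
    · funext b
      simp only [of_apply, Fin.append_left, Fin.append_right, hv, hR]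
      congr 1
      omega

/-- A tuple of sets, continued by the set `J`. -/
def tupleExt {d : ℕ} (I : Fin d → Finset ℕ) (J : Finset ℕ) (p : ℕ) : Finset ℕ :=
  if h : p < d then I ⟨p, h⟩ else J

/-- Summation of a chain of products over tuples of index sets, one set at a time. -/
theorem sum_piFinset_chain (S : ℕ → Finset (Finset ℕ)) (F : ℕ → Finset ℕ → K)
    (T : ℕ → Finset ℕ → Finset ℕ → K) (d : ℕ)
    (hstep : ∀ m < d, ∀ J ∈ S (m + 1), ∑ I ∈ S m, F m I * T m I J = F (m + 1) J)
    (J : Finset ℕ) (hJ : ∑ I ∈ S d, F d I * T d I J = F (d + 1) J) :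
    ∑ I ∈ Fintype.piFinset (fun m : Fin (d + 1) => S m),
      F 0 (tupleExt I J 0) * ∏ p ∈ range (d + 1), T p (tupleExt I J p) (tupleExt I J (p + 1)) =
    F (d + 1) J := by
  induction d generalizing J with
  | zero =>
    rw [← hJ]
    refine sum_nbij' (fun I => I 0) (fun x _ => x) ?_ ?_ ?_ ?_ ?_
    · intro I hI; exact Fintype.mem_piFinset.1 hI 0
    · intro x hx
      rw [Fintype.mem_piFinset]
      intro a
      rwa [show a = 0 from Fin.ext (by omega)]
    · intro I _
      funext a
      rw [show a = 0 from Fin.ext (by omega)]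
    · intro x _; rfl
    · intro I _
      simp [tupleExt]
  | succ d ih =>
    rw [← hJ]
    have h1 : ∀ x ∈ S (d + 1), F (d + 1) x * T (d + 1) x J =
        ∑ I ∈ Fintype.piFinset (fun m : Fin (d + 1) => S m),
      (F 0 (tupleExt I x 0) * ∏ p ∈ range (d + 1), T p (tupleExt I x p) (tupleExt I x (p + 1))) *
        T (d + 1) x J := by
      intro x hx
      rw [← sum_mul, ih (fun m hm => hstep m (by omega)) x (hstep d (by omega) x hx)]
    rw [sum_congr rfl h1, sum_sigma']
    refine sum_nbij' (fun I => ⟨I (Fin.last (d + 1)), Fin.init I⟩)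
      (fun x => Fin.snoc (α := fun _ => Finset ℕ) x.2 x.1) ?_ ?_ ?_ ?_ ?_
    · intro I hI
      rw [Fintype.mem_piFinset] at hI
      rw [mem_sigma, Fintype.mem_piFinset]
      refine ⟨by simpa using hI (Fin.last (d + 1)), fun a => ?_⟩
      exact hI a.castSucc
    · rintro ⟨x, I⟩ hI
      rw [mem_sigma, Fintype.mem_piFinset] at hI
      rw [Fintype.mem_piFinset]
      intro a
      induction a using Fin.lastCases with
      | last => simpa using hI.1
      | cast a => simpa using hI.2 a
    · intro I _; exact Fin.snoc_init_self I
    · rintro ⟨x, I⟩ _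
      simp
    · intro I _
      have hext : ∀ p ≤ d + 1, tupleExt (Fin.init I : Fin (d + 1) → Finset ℕ)
          (I (Fin.last (d + 1))) p = tupleExt I J p := by
        intro p hp
        unfold tupleExt
        rw [dif_pos (show p < d + 1 + 1 by omega)]
        split_ifs with h
        · rfl
        · congr 1
          ext
          simp
          omega
      rw [prod_range_succ, ← mul_assoc]
      have e1 : tupleExt I J (d + 1) = I (Fin.last (d + 1)) := by
        simp [tupleExt, Fin.last]
      have e2 : tupleExt I J (d + 1 + 1) = J := by
        simp [tupleExt]
      rw [e1, e2, hext 0 (by omega)]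
      congr 2
      refine prod_congr rfl fun p hp => ?_
      have := mem_range.1 hp
      rw [hext p (by omega), hext (p + 1) (by omega)]

end CauchyBinetChain

section GFun

variable {K : Type*} [CommRing K] {N : ℕ}

/-- The matrix `U` with its columns shifted by one to the left; the last column is zero. -/
def shiftCols (U : Matrix (Fin N) (Fin N) K) : Matrix (Fin N) (Fin N) K :=
  Matrix.of fun r c => ent U (r + 1) (c + 2)

theorem ent_shiftCols (U : Matrix (Fin N) (Fin N) K) (r : ℕ) {c : ℕ} (hc : 1 ≤ c) :
    ent (shiftCols U) r c = ent U r (c + 1) := by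
  by_cases hr : 1 ≤ r ∧ r ≤ N
  · by_cases hc' : c ≤ N
    · rw [ent_eq_apply (shiftCols U) (⟨r - 1, by omega⟩ : Fin N) (⟨c - 1, by omega⟩ : Fin N)
        (by simp; omega) (by simp; omega)]
      simp only [shiftCols, of_apply]
      congr 1 <;> omega
    · rw [ent_of_col_gt _ _ (by omega), ent_of_col_gt _ _ (by omega)]
  · simp [ent, hr]

theorem ent_pow_shiftCols (U : Matrix (Fin N) (Fin N) K) (x r : ℕ) {c : ℕ} (hc : 1 ≤ c) :
    ent (shiftCols U ^ (x + 1)) r c = ent (shiftCols U ^ x * U) r (c + 1) := by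
  rw [pow_succ, ent_mul, ent_mul]
  refine sum_congr rfl fun j _ => ?_
  rw [ent_shiftCols U _ hc]

theorem sum_Icc_ent_mul (U : Matrix (Fin N) (Fin N) K) (x r c : ℕ) :
    ∑ s ∈ Icc 2 N, ent (shiftCols U ^ x * U) r s * ent U (s - 1) c =
      ent (shiftCols U ^ (x + 1) * U) r c := by
  rw [ent_mul, Fin.sum_univ_eq_sum_range
    (fun j => ent (shiftCols U ^ (x + 1)) r (j + 1) * ent U (j + 1) c)]
  rcases Nat.eq_zero_or_pos N with rfl | hN
  · simp
  obtain ⟨M, rfl⟩ : ∃ M, N = M + 1 := ⟨N - 1, by omega⟩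
  rw [sum_range_succ, ent_pow_shiftCols U x r (by omega), ent_of_col_gt _ _ (by omega), zero_mul,
    add_zero, ← Finset.Ico_add_one_right_eq_Icc, Finset.sum_Ico_eq_sum_range]
  refine sum_congr (by congr 1) fun j _ => ?_
  rw [ent_pow_shiftCols U x r (by omega)]
  congr 2 <;> omega

/-- The row index of the matrix power in row `a` of `gMatrix`. -/
def gRow (N i j a : ℕ) : ℕ :=
  if a < N - i + 1 then i + a else if a < N - j + 2 then a + j - 1 else N

/-- The exponent of the matrix power in row `a` of `gMatrix`. -/
def gExp (N i j a : ℕ) : ℕ :=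
  if a < N - i + 1 then j - 1 else if a < N - j + 2 then j - 2 else N - 1 - a

/-- The matrix of size `N` whose rows are the rows `i, …, N` of `W ^ (j - 1)`, the rows
`N - i + j, …, N` of `W ^ (j - 2)` and the last rows of `W ^ (j - 3), …, W ^ 0`. -/
def gMatrix (i j : ℕ) (W : Matrix (Fin N) (Fin N) K) : Matrix (Fin N) (Fin N) K :=
  Matrix.of fun a b => ent (W ^ gExp N i j a) (gRow N i j a) (b + 1)

/-- For `j = 2` the lower rows of `gMatrix` are unit vectors. -/
theorem gFun_eq_det_of_two {i : ℕ} (hi : 2 ≤ i) (hiN : i ≤ N) (U : Matrix (Fin N) (Fin N) K) :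
    gFun i 2 U = (gMatrix i 2 (shiftCols U)).det := by
  rw [gFun, if_pos rfl, minor_eq_det U (q := N - i + 1) (by simp; omega) (by simp)]
  rw [det_eq_of_complementary_block_zero (show (i - 1) + (N - i + 1) = N by omega)
    (gMatrix i 2 (shiftCols U))
    (fun a => ⟨N - i + 1 + a, by omega⟩) (fun a => ⟨N - i + 1 + a, by omega⟩)
    (fun a => ⟨a, by omega⟩) (fun a => ⟨a, by omega⟩)]
  rotate_left
  · intro a b h; exact Nat.add_lt_add_left (Fin.lt_def.1 h) _
  · intro a b h; exact Nat.add_lt_add_left (Fin.lt_def.1 h) _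
  · intro a b h; exact h
  · intro a b h; exact h
  · intro a b h; have := congrArg Fin.val h; simp only at this; omega
  · intro a b h; have := congrArg Fin.val h; simp only at this; omega
  · intro a b
    simp only [gMatrix, of_apply, gExp, gRow]
    rw [if_neg (by omega), if_pos (by omega), if_neg (by omega), if_pos (by omega), Nat.sub_self,
      pow_zero, ent_one_of_ne (by omega)]
  · have h1 : ((gMatrix i 2 (shiftCols U)).submatrix
        (fun a : Fin (i - 1) => (⟨N - i + 1 + a, by omega⟩ : Fin N))
        (fun a : Fin (i - 1) => (⟨N - i + 1 + a, by omega⟩ : Fin N))) = 1 := by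
      refine Matrix.ext fun a b => ?_
      rw [submatrix_apply]
      simp only [gMatrix, of_apply, gExp, gRow]
      rw [if_neg (by omega), if_pos (by omega), if_neg (by omega), if_pos (by omega), Nat.sub_self,
        pow_zero]
      by_cases h : a = b
      · subst h
        rw [ent_eq_apply 1 (⟨N - i + 1 + a, by omega⟩ : Fin N) ⟨N - i + 1 + a, by omega⟩
          (by simp) rfl, one_apply_eq, one_apply_eq]
      · rw [one_apply_ne h]
        exact ent_one_of_ne fun h' => h (Fin.ext (by omega))
    have h2 : ((gMatrix i 2 (shiftCols U)).submatrix
        (fun a : Fin (N - i + 1) => (⟨a, by omega⟩ : Fin N))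
        (fun a : Fin (N - i + 1) => (⟨a, by omega⟩ : Fin N))) =
        Matrix.of fun a b : Fin (N - i + 1) =>
          ent U (nthElt (Icc i N) a) (nthElt (Icc 2 (N - i + 2)) b) := by
      refine Matrix.ext fun a b => ?_
      rw [submatrix_apply, of_apply, nthElt_Icc (by omega), nthElt_Icc (by omega)]
      simp only [gMatrix, of_apply, gExp, gRow]
      rw [if_pos a.2, if_pos a.2, show 2 - 1 = 1 from rfl, pow_one, ent_shiftCols U _ (by omega)]
      congr 1
      omega
    have h3 : ∀ b : Fin (N - i + 1), (-1 : K) ^ ((b : ℕ) + (b : ℕ)) = 1 :=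
      fun b => Even.neg_one_pow ⟨_, rfl⟩
    rw [h1, h2, det_one, mul_one, ← prod_pow_eq_pow_sum]
    simp [h3]

/-- The sum of products of minors `g_{ij}` is a single determinant, by Cauchy–Binet summation over
`I_1`, then over `I_2`, and so on. -/
theorem gFun_eq_det {i j : ℕ} (hj : 2 ≤ j) (hji : j ≤ i) (hiN : i ≤ N)
    (U : Matrix (Fin N) (Fin N) K) :
    gFun i j U = (gMatrix i j (shiftCols U)).det := by
  rcases Nat.eq_or_lt_of_le hj with rfl | hj3
  · exact gFun_eq_det_of_two hji hiN U
  obtain ⟨d, rfl⟩ : ∃ d, j = d + 3 := ⟨j - 3, by omega⟩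
  -- the sizes of the successive index sets, the appended intervals, and the rows
  -- that are reached after `m` steps
  set q : ℕ → ℕ := fun m => if m = 0 then N - i + 1 else N - (d + 3) + (m + 1) with hq
  set e : ℕ → ℕ := fun m => if m = 0 then i - (d + 3) + 1 else 1 with he
  set Y : ℕ → ℕ → ℕ → K := fun m a c =>
    ent (shiftCols U ^ (gExp N i (d + 3) a + m + 1 - (d + 3)) * U) (gRow N i (d + 3) a) c with hY
  set S : ℕ → Finset (Finset ℕ) := fun m => powersetCard (q m) (Icc 2 N) with hS
  set F : ℕ → Finset ℕ → K := fun m I =>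
    (Matrix.of fun a b : Fin (q m) => Y m a (nthElt I b)).det with hF
  set T : ℕ → Finset ℕ → Finset ℕ → K := fun m I J =>
    minor U (gammaStar I ∪ Icc (N + 1 - e m) N) J with hT
  have hqe : ∀ m, q m + e m = q (m + 1) := by
    rintro (_ | m)
    · simp only [hq, he, if_true]
      rw [if_neg (by omega)]
      omega
    · simp only [hq, he]
      rw [if_neg (by omega), if_neg (by omega), if_neg (by omega)]
      omega
  have hstep : ∀ m ≤ d, ∀ J : Finset ℕ, J.card = q (m + 1) →
      ∑ I ∈ S m, F m I * T m I J = F (m + 1) J := by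
    intro m hm J hJ
    simp only [hS, hF, hT]
    rw [sum_det_mul_minor U (q m) (e m) (by simp only [he]; split_ifs <;> omega) (Y m) J
      (by rw [hJ, hqe])]
    have hcast := hqe m
    rw [← hcast]
    congr 1
    refine Matrix.ext fun a b => ?_
    rw [of_apply, of_apply]
    have ha := a.2
    simp only [hY]
    split_ifs with h
    · rw [sum_Icc_ent_mul]
      congr 3
      have : d + 3 ≤ gExp N i (d + 3) a + m + 1 := by
        simp only [hq] at h
        unfold gExp
        split_ifs at h ⊢ <;> omega
      omega
    · have h1 : gExp N i (d + 3) a + (m + 1) + 1 - (d + 3) = 0 := by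
        simp only [hq, he] at h ha
        unfold gExp
        split_ifs at h ha ⊢ <;> omega
      rw [h1, pow_zero, Matrix.one_mul]
      congr 1
      simp only [hq, he] at h ha ⊢
      unfold gRow
      split_ifs at h ha ⊢ <;> omega
  have hcardS : ∀ m, ∀ J ∈ S m, J.card = q m := fun m J hJ => (mem_powersetCard.1 hJ).2
  have hlast : (Icc 2 N).card = q (d + 1) := by
    simp only [hq, Nat.card_Icc]
    rw [if_neg (by omega)]
    omega
  have hchain := sum_piFinset_chain S F T d
    (fun m hm J hJ => hstep m hm.le J (hcardS _ J hJ)) (Icc 2 N) (hstep d le_rfl _ hlast)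
  have hg : gFun i (d + 3) U = F (d + 1) (Icc 2 N) := by
    rw [← hchain, gFun, if_neg (by omega)]
    have hset : ∀ (I : Fin (d + 1) → Finset ℕ) (p : ℕ),
        tupleSet N (d + 3) I (p + 1) = tupleExt I (Icc 2 N) p := fun _ _ => rfl
    have hidx : indexTuples N i (d + 3) = Fintype.piFinset (fun m : Fin (d + 1) => S m) := rfl
    rw [hidx]
    refine sum_congr rfl fun (I : Fin (d + 1) → Finset ℕ) hI => ?_
    have hI0 : (I 0).card = q 0 := hcardS 0 _ (Fintype.mem_piFinset.1 hI 0)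
    rw [prod_range_succ', mul_comm (∏ _ ∈ _, _), ← mul_assoc]
    congr 1
    · congr 1
      · have e1 : tupleExt I (Icc 2 N) 0 = I 0 := dif_pos (Nat.succ_pos d)
        have e0 : tupleSet N (d + 3) I 1 = I 0 := e1
        rw [e0, e1, minor_eq_det U (q := q 0) (by simp [hq]; omega) hI0]
        simp only [hF]
        congr 1
        refine Matrix.ext fun a b => ?_
        have ha : (a : ℕ) < N - i + 1 := by have := a.2; simpa [hq] using this
        rw [of_apply, of_apply, nthElt_Icc (by omega)]
        simp only [hY, gExp, gRow, if_pos ha]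
        rw [show d + 3 - 1 + 0 + 1 - (d + 3) = 0 by omega, pow_zero, Matrix.one_mul]
      · rw [hset, hset]
        simp only [hT, he, if_true]
        congr 3
        omega
    · rw [show d + 3 - 2 = d + 1 from rfl, ← Finset.Ico_add_one_right_eq_Icc,
        Finset.prod_Ico_eq_prod_range]
      refine prod_congr (by congr 1) fun p _ => ?_
      rw [show 2 + p = p + 1 + 1 by omega, hset, hset]
      simp only [hT, he]
      rw [if_neg (by omega), Nat.add_sub_cancel, Icc_self]
  -- The last row of `gMatrix` is the unit vector `e_N`; the first `N - 1` columns of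
  -- `W ^ (x + 1)` are the columns `[2, N]` of `W ^ x U`.
  rw [hg]
  obtain ⟨M, rfl⟩ : ∃ M, N = M + 1 := ⟨N - 1, by omega⟩
  have hqd : q (d + 1) = M := by
    simp only [hq]
    rw [if_neg (by omega)]
    omega
  rw [det_succ_row _ (Fin.last M), sum_eq_single (Fin.last M)]
  · have h1 : gMatrix i (d + 3) (shiftCols U) (Fin.last M) (Fin.last M) = 1 := by
      simp only [gMatrix, of_apply, gExp, gRow, Fin.val_last]
      rw [if_neg (by omega), if_neg (by omega), if_neg (by omega), if_neg (by omega),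
        show M + 1 - 1 - M = 0 by omega, pow_zero,
        ent_eq_apply 1 (Fin.last M) (Fin.last M) (by simp) (by simp), one_apply_eq]
    rw [h1, Even.neg_one_pow ⟨_, rfl⟩, one_mul, one_mul]
    simp only [hF]
    rw [hqd]
    congr 1
    refine Matrix.ext fun a b => ?_
    rw [submatrix_apply, of_apply, Fin.succAbove_last, nthElt_Icc (by omega)]
    have hexp : 1 ≤ gExp (M + 1) i (d + 3) a := by
      unfold gExp
      split_ifs <;> omega
    simp only [hY, gMatrix, of_apply, Fin.val_castSucc]
    rw [show gExp (M + 1) i (d + 3) a = (gExp (M + 1) i (d + 3) a - 1) + 1 by omega,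
      ent_pow_shiftCols U _ _ (by omega)]
    congr 1
    · congr 2
      omega
    · omega
  · intro b _ hb
    have hb' : (b : ℕ) < M := Fin.val_lt_last hb
    have h1 : gMatrix i (d + 3) (shiftCols U) (Fin.last M) b = 0 := by
      simp only [gMatrix, of_apply, gExp, gRow, Fin.val_last]
      rw [if_neg (by omega), if_neg (by omega), if_neg (by omega), if_neg (by omega),
        show M + 1 - 1 - M = 0 by omega, pow_zero, ent_one_of_ne (by omega)]
    rw [h1, mul_zero, zero_mul]
  · simp

end GFun

/-! ### The matrix `G_{ij}(X)` -/

section StackedRows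

theorem sort_map_getD {I : Finset ℕ} {x : ℕ} (d : ℕ) (hx : x < I.card) :
    (I.sort.map fun a => (a, d)).getD x (0, 0) = (nthElt I x, d) := by
  rw [List.getD_eq_getElem _ _ (by simpa using hx), List.getElem_map, ← sort_getD_eq_nthElt,
    List.getD_eq_getElem _ _ (by simpa using hx)]

theorem card_pair_one {n : ℕ} (hn : 2 ≤ n) : ({1, n} : Finset ℕ).card = 2 := by
  rw [card_pair (by omega)]

theorem stackedRows_concat (L : List (Finset ℕ)) (I : Finset ℕ) :
    stackedRows (L ++ [I]) = stackedRows L ++ I.sort.map fun a => (a, L.length) := by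
  simp [stackedRows, List.mapIdx_append]

theorem length_stackedRows_replicate {n : ℕ} (hn : 2 ≤ n) (w : ℕ) :
    (stackedRows (List.replicate w ({1, n} : Finset ℕ))).length = 2 * w := by
  induction w with
  | zero => rfl
  | succ w ih =>
    rw [List.replicate_succ', stackedRows_concat, List.length_append, ih]
    simp only [List.length_map, length_sort, card_pair_one hn]
    ring

theorem stackedRows_replicate_getD {n : ℕ} (hn : 2 ≤ n) (w : ℕ) {x : ℕ} (hx : x < 2 * w) :
    (stackedRows (List.replicate w ({1, n} : Finset ℕ))).getD x (0, 0) =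
      (if x % 2 = 0 then 1 else n, x / 2) := by
  induction w with
  | zero => omega
  | succ w ih =>
    rw [List.replicate_succ', stackedRows_concat]
    have hl := length_stackedRows_replicate hn w
    by_cases h : x < 2 * w
    · rw [List.getD_append _ _ _ _ (by omega), ih h]
    · rw [List.getD_append_right _ _ _ _ (by omega), hl, List.length_replicate,
        sort_map_getD _ (by rw [card_pair_one hn]; omega),
        nthElt_eq_of_strictMono _ (card_pair_one hn) (fun a => if a = 0 then 1 else n)
          (by intro a ha; simp only [mem_insert, mem_singleton]; split_ifs <;> simp)
          (by intro a b hab hb; split_ifs <;> omega) (by omega : x - 2 * w < 2)]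
      rw [show x / 2 = w by omega]
      congr 1
      split_ifs <;> omega

/-- The row index of `X` and the shift in row `x` of `G_{ij}(X)`, for `j = w + 2`, `i = j + v` and
`n = i + u + 1`. -/
def gIndex (w v u x : ℕ) : ℕ × ℕ :=
  if x < 2 * w then (if x % 2 = 0 then 1 else w + v + u + 3, x / 2)
  else if x < 2 * w + v + 2 then (if x = 2 * w then 1 else w + u + 2 + (x - 2 * w), w)
  else (if x = 2 * w + v + 2 then 1 else w + v + 2 + (x - (2 * w + v + 2)), w + 1)

theorem stackedRows_gSets_getD (w v u : ℕ) {x : ℕ} (hx : x < 2 * w + v + u + 4) :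
    (stackedRows (gSets (w + v + u + 3) (w + v + 2) (w + 2))).getD x (0, 0) = gIndex w v u x := by
  have hn : 2 ≤ w + v + u + 3 := by omega
  have hl := length_stackedRows_replicate hn w
  have e : gSets (w + v + u + 3) (w + v + 2) (w + 2) =
      (List.replicate w ({1, w + v + u + 3} : Finset ℕ) ++ [{1} ∪ Icc (w + u + 3) (w + v + u + 3)])
        ++ [{1} ∪ Icc (w + v + 3) (w + v + u + 3)] := by
    rw [List.append_assoc, gSets, show w + v + u + 3 + (w + 2) - (w + v + 2) = w + u + 3 by omega]
    rfl
  have hc1 : (({1} : Finset ℕ) ∪ Icc (w + u + 3) (w + v + u + 3)).card = v + 2 := by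
    rw [(card_one_union_Icc (by omega)).resolve_right (by omega)]; omega
  have hc2 : (({1} : Finset ℕ) ∪ Icc (w + v + 3) (w + v + u + 3)).card = u + 2 := by
    rw [(card_one_union_Icc (by omega)).resolve_right (by omega)]; omega
  rw [e, stackedRows_concat, stackedRows_concat]
  unfold gIndex
  by_cases h1 : x < 2 * w
  · rw [if_pos h1, List.getD_append _ _ _ _ (by rw [List.length_append]; omega),
      List.getD_append _ _ _ _ (by omega), stackedRows_replicate_getD hn w h1]
  rw [if_neg h1]
  by_cases h2 : x < 2 * w + v + 2
  · rw [if_pos h2, List.getD_append, List.getD_append_right _ _ _ _ (by omega), hl,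
      sort_map_getD _ (by omega), nthElt_one_union_Icc (by omega) (by omega) (by omega),
      List.length_replicate]
    · congr 1
      split_ifs <;> omega
    · rw [List.length_append, List.length_map, length_sort, hc1]; omega
  · have hl2 : (stackedRows (List.replicate w ({1, w + v + u + 3} : Finset ℕ)) ++
        ({1} ∪ Icc (w + u + 3) (w + v + u + 3)).sort.map fun a =>
          (a, (List.replicate w ({1, w + v + u + 3} : Finset ℕ)).length)).length =
        2 * w + (v + 2) := by
      rw [List.length_append, List.length_map, length_sort, hc1, hl]
    rw [if_neg h2, List.getD_append_right _ _ _ _ (by omega), hl2, sort_map_getD _ (by omega),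
      nthElt_one_union_Icc (by omega) (by omega) (by omega), List.length_append,
      List.length_replicate, List.length_singleton]
    congr 1
    split_ifs <;> omega

end StackedRows

section GRows

variable {K : Type*} [CommRing K] {N : ℕ}

theorem sum_ent_mul_eq_shiftCols (hN : 1 ≤ N) (U : Matrix (Fin N) (Fin N) K) (s : ℕ) (f : ℕ → K) :
    ∑ j : Fin N, ent U s (j + 1) * f (j + 1) =
      ent U s 1 * f 1 + ∑ j : Fin N, ent (shiftCols U) s (j + 1) * f (j + 2) := by
  obtain ⟨M, rfl⟩ : ∃ M, N = M + 1 := ⟨N - 1, by omega⟩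
  rw [Fin.sum_univ_succ, Fin.sum_univ_castSucc (f := fun j : Fin (M + 1) =>
    ent (shiftCols U) s (j + 1) * f (j + 2))]
  have h1 : ent (shiftCols U) s ((Fin.last M : ℕ) + 1) = 0 := by
    rw [ent_shiftCols U _ (by omega), ent_of_col_gt]
    simp
  rw [h1, zero_mul, add_zero]
  congr 1
  refine sum_congr rfl fun j _ => ?_
  rw [ent_shiftCols U _ (by omega)]
  rfl

/-- Iteration of the pencil identity: modulo the shifts of the first and the last row, the `d`-fold
shift acts on the rows `X_{r+1}` as the `d`-th power of `shiftCols U`. -/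
theorem exists_ent_shift_pow_eq (hN : 1 ≤ N) {X : Matrix (Fin (N + 1)) (Fin (N + 1)) K}
    (U : Matrix (Fin N) (Fin N) K) (a b : ℕ → K)
    (h : ∀ s c : ℕ, 1 ≤ s → ent X (s + 1) (c - 1) =
        ∑ j : Fin N, ent U s (j + 1) * ent X (j + 1) c + b s * ent X (N + 1) c +
        a s * ent X 1 (c - 1)) {r : ℕ} (hr : 1 ≤ r) (hrN : r ≤ N) (d : ℕ) :
    ∃ α β : ℕ → K, ∀ c : ℕ, ent X (r + 1) (c - d) =
      ∑ s : Fin N, ent (shiftCols U ^ d) r (s + 1) * ent X (s + 2) c +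
        ∑ e ∈ range (d + 1), α e * ent X 1 (c - e) +
        ∑ e ∈ range d, β e * ent X (N + 1) (c - e) := by
  induction d with
  | zero =>
    refine ⟨0, 0, fun c => ?_⟩
    rw [sum_eq_single (⟨r - 1, by omega⟩ : Fin N)]
    · rw [pow_zero, ent_eq_apply 1 (⟨r - 1, by omega⟩ : Fin N) ⟨r - 1, by omega⟩
        (by simp; omega) rfl, one_apply_eq]
      simp only [show r - 1 + 2 = r + 1 by omega]
      simp
    · intro s _ hs
      rw [pow_zero, ent_one_of_ne, zero_mul]
      intro h'
      exact hs (Fin.ext (by simp; omega))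
    · simp
  | succ d ih =>
    obtain ⟨α, β, ih⟩ := ih
    set V := shiftCols U ^ d with hV
    set A0 := ∑ s : Fin N, ent V r (s + 1) * ent U (s + 1) 1
    set A1 := ∑ s : Fin N, ent V r (s + 1) * a (s + 1)
    set B0 := ∑ s : Fin N, ent V r (s + 1) * b (s + 1)
    refine ⟨fun e => if e = 0 then A0 else α (e - 1) + if e = 1 then A1 else 0,
      fun e => if e = 0 then B0 else β (e - 1), fun c => ?_⟩
    have h1 : ∀ s : Fin N, ent X (s + 2) (c - 1) =
        ent U (s + 1) 1 * ent X 1 c +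
          ∑ j : Fin N, ent (shiftCols U) (s + 1) (j + 1) * ent X (j + 2) c +
          b (s + 1) * ent X (N + 1) c + a (s + 1) * ent X 1 (c - 1) := by
      intro s
      rw [← sum_ent_mul_eq_shiftCols hN U (s + 1) (fun j => ent X j c)]
      exact h (s + 1) c (by omega)
    have h2 : ∑ s : Fin N, ent V r (s + 1) * ent X (s + 2) (c - 1) =
        A0 * ent X 1 c + ∑ j : Fin N, ent (shiftCols U ^ (d + 1)) r (j + 1) * ent X (j + 2) c +
          B0 * ent X (N + 1) c + A1 * ent X 1 (c - 1) := by
      simp only [h1, mul_add, sum_add_distrib, A0, A1, B0, sum_mul, mul_assoc]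
      congr 3
      simp only [pow_succ, ent_mul, sum_mul, mul_sum, ← hV, mul_assoc]
      exact sum_comm
    have h3 : ∑ e ∈ range (d + 1), (if e + 1 = 0 then A0
        else α (e + 1 - 1) + if e + 1 = 1 then A1 else 0) * ent X 1 (c - (e + 1)) =
        ∑ e ∈ range (d + 1), α e * ent X 1 (c - 1 - e) + A1 * ent X 1 (c - 1) := by
      simp only [Nat.add_one_ne_zero, if_false, Nat.add_sub_cancel, add_mul, sum_add_distrib]
      congr 1
      · exact sum_congr rfl fun e _ => by rw [show c - (e + 1) = c - 1 - e by omega]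
      · rw [sum_eq_single 0]
        · simp
        · intro e _ he
          rw [if_neg (by omega), zero_mul]
        · simp
    have h4 : ∑ e ∈ range d, (if e + 1 = 0 then B0 else β (e + 1 - 1)) *
        ent X (N + 1) (c - (e + 1)) = ∑ e ∈ range d, β e * ent X (N + 1) (c - 1 - e) := by
      refine sum_congr rfl fun e _ => ?_
      rw [if_neg (by omega), Nat.add_sub_cancel, show c - (e + 1) = c - 1 - e by omega]
    rw [sum_range_succ' _ (d + 1), sum_range_succ' (fun e => (if e = 0 then B0 else β (e - 1)) *
      ent X (N + 1) (c - e)) d, h3, h4, show c - (d + 1) = (c - 1) - d by omega, ih (c - 1), h2]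
    simp only [if_true, Nat.sub_zero]
    ring

end GRows

section GFormula

variable {K : Type*} [CommRing K] {N : ℕ}

/-- A shifted row of `X` in terms of the rows of `X` and the shifts of its first and last row, with
the number of shifts bounded independently of the row. -/
theorem exists_shifted_row_eq (hN : 1 ≤ N) {X : Matrix (Fin (N + 1)) (Fin (N + 1)) K}
    (U : Matrix (Fin N) (Fin N) K) (a b : ℕ → K)
    (h : ∀ s c : ℕ, 1 ≤ s → ent X (s + 1) (c - 1) =
        ∑ j : Fin N, ent U s (j + 1) * ent X (j + 1) c + b s * ent X (N + 1) c +
        a s * ent X 1 (c - 1)) {r d w : ℕ} (hr : 1 ≤ r) (hrN : r ≤ N + 1) (hd : d ≤ w + 1) :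
    ∃ α β : ℕ → K, (∀ e, d ≤ e → β e = 0) ∧ (r = 1 → ∀ e, α e = if e = d then 1 else 0) ∧
      ∀ c : ℕ, ent X r (c - d) =
        ∑ s ∈ range N, (if r = 1 then 0 else ent (shiftCols U ^ d) (r - 1) (s + 1)) *
          ent X (s + 2) c +
        ∑ e ∈ range (w + 2), α e * ent X 1 (c - e) +
        ∑ e ∈ range (w + 1), β e * ent X (N + 1) (c - e) := by
  by_cases h1 : r = 1
  · subst h1
    refine ⟨fun e => if e = d then 1 else 0, fun _ => 0, fun _ _ => rfl, fun _ _ => rfl,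
      fun c => ?_⟩
    have : d < w + 2 := by omega
    simp [this]
  · obtain ⟨α, β, hc⟩ := exists_ent_shift_pow_eq hN U a b h (r := r - 1) (by omega) (by omega) d
    refine ⟨fun e => if e < d + 1 then α e else 0, fun e => if e < d then β e else 0,
      fun e he => if_neg (by omega), fun h' => absurd h' h1, fun c => ?_⟩
    have key : ∀ (f : ℕ → K) (g : ℕ → K) (p q : ℕ), p ≤ q →
        ∑ e ∈ range q, (if e < p then f e else 0) * g e = ∑ e ∈ range p, f e * g e := by
      intro f g p q hpq
      rw [← sum_subset (range_subset_range.2 hpq)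
        (fun e _ he => by rw [if_neg (by simpa using he), zero_mul])]
      exact sum_congr rfl fun e he => by rw [if_pos (by simpa using he)]
    rw [key α _ _ _ (by omega), key β _ _ _ hd]
    simp only [if_neg h1]
    rw [Finset.sum_range (n := N)]
    rw [← hc c, show r - 1 + 1 = r by omega]

/-- The determinant of the matrix with rows `X_1, …, X_n` followed by the `w + 1` further shifts
of `X_1`. -/
theorem det_rows_append_shifts (X : Matrix (Fin (N + 1)) (Fin (N + 1)) K) {s w : ℕ}
    (hs : s = N + w + 2) :
    (Matrix.of fun c col : Fin s => if (c : ℕ) ≤ N then ent X (c + 1) (col + 1)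
      else ent X 1 ((col : ℕ) + 1 - (c - N))).det = X.det * ent X 1 (N + 1) ^ (w + 1) := by
  rw [det_eq_of_complementary_block_zero (show (N + 1) + (w + 1) = s by omega) _
    (fun a => ⟨a, by omega⟩) (fun a => ⟨a, by omega⟩)
    (fun a => ⟨N + 1 + a, by omega⟩) (fun a => ⟨N + 1 + a, by omega⟩)]
  · have e : (-1 : K) ^ (∑ x : Fin (w + 1), (N + 1 + (x : ℕ) + (N + 1 + x))) = 1 := by
      rw [sum_add_distrib, Even.neg_one_pow ⟨_, rfl⟩]
    rw [e, one_mul]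
    congr 1
    · congr 1
      refine Matrix.ext fun i j => ?_
      simp only [submatrix_apply, of_apply]
      rw [if_pos (by omega), ent_succ_succ]
    · rw [det_of_isLowerTriangular]
      · simp only [submatrix_apply, of_apply]
        rw [prod_congr rfl (g := fun _ => ent X 1 (N + 1))]
        · simp
        · intro x _
          rw [if_neg (by omega)]
          congr 1
          omega
      · intro i j hij
        have hij : i < j := hij
        simp only [submatrix_apply, of_apply]
        rw [if_neg (by omega), ent_of_col_gt]
        have : (i : ℕ) < j := hij
        omega
  · exact fun a b h => h
  · exact fun a b h => h
  · intro a b h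
    have h : (a : ℕ) < b := h
    simp only [Fin.mk_lt_mk]; omega
  · intro a b h
    have h : (a : ℕ) < b := h
    simp only [Fin.mk_lt_mk]; omega
  · intro i j h
    simp only [Fin.mk.injEq] at h; omega
  · intro i j h
    simp only [Fin.mk.injEq] at h; omega
  · intro i j
    simp only [of_apply]
    rw [if_pos (by omega), ent_of_col_gt]
    omega

/-- The position in `G_{ij}(X)` of the `e`-th shift of the last row of `X`, for `e ≤ w`. -/
def lastRowPos (w v e : ℕ) : ℕ := if e < w then 2 * e + 1 else 2 * w + v + 1

theorem gIndex_lastRowPos {w v u e : ℕ} (he : e ≤ w) :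
    gIndex w v u (lastRowPos w v e) = (w + v + u + 3, e) := by
  unfold lastRowPos
  split_ifs with h
  · rw [gIndex, if_pos (by omega), if_neg (by omega)]
    congr 1; omega
  · rw [gIndex, if_neg (by omega), if_pos (by omega), if_neg (by omega)]
    congr 1 <;> omega

/-- A row with shift `d` stands below all shifts `λ ^ e X_n` with `e < d`, so that the row operations
of `det_stacked_eq` are unitriangular. -/
theorem lastRowPos_lt {w v u e x : ℕ} (he : e < (gIndex w v u x).2) : lastRowPos w v e < x := by
  unfold gIndex at he
  unfold lastRowPos
  split_ifs at he ⊢ <;> simp only at he <;> omega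

/-- The positions in `G_{ij}(X)` of the rows that are not shifts of the first row of `X`. -/
def freeRow (w v a : ℕ) : ℕ :=
  if a < w then 2 * a + 1 else if a < w + v + 1 then a + w + 1 else a + w + 2

/-- The positions in `G_{ij}(X)` of the shifts of the first row of `X`. -/
def pivotRow (w v d : ℕ) : ℕ := if d ≤ w then 2 * d else 2 * w + v + 2

theorem gIndex_pivotRow {w v u d : ℕ} (hd : d ≤ w + 1) :
    gIndex w v u (pivotRow w v d) = (1, d) := by
  unfold pivotRow gIndex
  split_ifs <;> first | omega | (congr 1; omega)

theorem gIndex_fst_pos (w v u x : ℕ) : 1 ≤ (gIndex w v u x).1 := by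
  unfold gIndex
  split_ifs <;> simp only <;> omega

theorem gIndex_fst_le {w v u x : ℕ} (hx : x < 2 * w + v + u + 4) :
    (gIndex w v u x).1 ≤ w + v + u + 3 := by
  unfold gIndex
  split_ifs <;> simp only <;> omega

theorem gIndex_snd_le (w v u x : ℕ) : (gIndex w v u x).2 ≤ w + 1 := by
  unfold gIndex
  split_ifs <;> simp only <;> omega

/-- The matrix `G_{ij}(X)` is reduced to powers of `shiftCols U` by subtracting multiples of shifts
of the last row, factoring out the rows of `X` and the shifts of its first row, and expanding along
the rows that are shifts of the first row. -/
theorem det_stacked_eq {w v u s : ℕ} (hN : N = w + v + u + 2) (hs : s = N + w + 2)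
    {X : Matrix (Fin (N + 1)) (Fin (N + 1)) K}
    (U : Matrix (Fin N) (Fin N) K) (a b : ℕ → K)
    (h : ∀ s c : ℕ, 1 ≤ s → ent X (s + 1) (c - 1) =
        ∑ j : Fin N, ent U s (j + 1) * ent X (j + 1) c + b s * ent X (N + 1) c +
        a s * ent X 1 (c - 1)) :
    (Matrix.of fun r c : Fin s =>
      ent X (gIndex w v u r).1 (c + 1 - (gIndex w v u r).2)).det =
    (-1) ^ (∑ x : Fin N, (freeRow w v x + (x + 1))) *
      (Matrix.of fun x y : Fin N => ent (shiftCols U ^ (gIndex w v u (freeRow w v x)).2)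
        ((gIndex w v u (freeRow w v x)).1 - 1) (y + 1)).det *
      (X.det * ent X 1 (N + 1) ^ (w + 1)) := by
  have hex := fun ρ : Fin s => exists_shifted_row_eq (by omega) U a b h (w := w)
    (gIndex_fst_pos w v u ρ)
    ((gIndex_fst_le (w := w) (v := v) (u := u) (by omega : (ρ : ℕ) < _)).trans (by omega))
    (gIndex_snd_le w v u ρ)
  choose α β hβ hα hrow using hex
  set G : Matrix (Fin s) (Fin s) K := Matrix.of fun r c : Fin s =>
      ent X (gIndex w v u r).1 (c + 1 - (gIndex w v u r).2) with hG
  set B : Matrix (Fin s) (Fin s) K := Matrix.of fun c col : Fin s =>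
    if (c : ℕ) ≤ N then ent X (c + 1) (col + 1) else ent X 1 ((col : ℕ) + 1 - (c - N)) with hB
  set M : Matrix (Fin s) (Fin s) K := Matrix.of fun ρ c : Fin s =>
    if (c : ℕ) = 0 then α ρ 0 else if (c : ℕ) ≤ N then
      (if (gIndex w v u ρ).1 = 1 then 0 else
        ent (shiftCols U ^ (gIndex w v u ρ).2) ((gIndex w v u ρ).1 - 1) c)
    else α ρ (c - N) with hM
  -- `L` subtracts the shifts of the last row, so that `L * G = M * B`, where `B` consists of the rows
  -- of `X` and of the shifts of its first row.
  set L : Matrix (Fin s) (Fin s) K := Matrix.of fun ρ ρ' : Fin s =>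
    (if ρ = ρ' then 1 else 0) -
      ∑ e ∈ range (w + 1), β ρ e * if (ρ' : ℕ) = lastRowPos w v e then 1 else 0 with hL
  have hLdet : L.det = 1 := by
    rw [det_of_isLowerTriangular]
    · refine prod_eq_one fun ρ _ => ?_
      rw [hL, of_apply, if_pos rfl, sum_eq_zero, sub_zero]
      intro e _
      by_cases he : e < (gIndex w v u ρ).2
      · have := lastRowPos_lt he
        rw [if_neg (by omega), mul_zero]
      · rw [hβ ρ e (by omega), zero_mul]
    · intro ρ ρ' hlt
      have hlt : ρ < ρ' := hlt
      have hlt' : (ρ : ℕ) < ρ' := hlt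
      rw [hL, of_apply, if_neg (ne_of_lt hlt), sum_eq_zero, sub_zero]
      intro e _
      by_cases he : e < (gIndex w v u ρ).2
      · have := lastRowPos_lt he
        rw [if_neg (by omega), mul_zero]
      · rw [hβ ρ e (by omega), zero_mul]
  have hLG : L * G = M * B := by
    refine Matrix.ext fun ρ col => ?_
    rw [Matrix.mul_apply, Matrix.mul_apply]
    have h1 : ∑ ρ', L ρ ρ' * G ρ' col = G ρ col -
        ∑ e ∈ range (w + 1), β ρ e * ent X (N + 1) (col + 1 - e) := by
      simp only [hL, of_apply, sub_mul, sum_sub_distrib, sum_mul]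
      congr 1
      · simp
      · rw [sum_comm]
        refine sum_congr rfl fun e he => ?_
        have he : e < w + 1 := by simpa using he
        have hp : lastRowPos w v e < s := by unfold lastRowPos; split_ifs <;> omega
        rw [sum_eq_single (⟨lastRowPos w v e, hp⟩ : Fin s)]
        · simp only [hG, of_apply, if_true, mul_one, gIndex_lastRowPos (Nat.lt_succ_iff.1 he)]
          rw [show w + v + u + 3 = N + 1 by omega]
        · intro x _ hx
          rw [if_neg (fun h' => hx (Fin.ext h')), mul_zero, zero_mul]
        · simp
    have h2 : ∑ c, M ρ c * B c col = ∑ s ∈ range N, (if (gIndex w v u ρ).1 = 1 then 0 else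
          ent (shiftCols U ^ (gIndex w v u ρ).2) ((gIndex w v u ρ).1 - 1) (s + 1)) *
          ent X (s + 2) (col + 1) +
        ∑ e ∈ range (w + 2), α ρ e * ent X 1 (col + 1 - e) := by
      simp only [hM, hB, of_apply]
      rw [Fin.sum_univ_eq_sum_range (fun c => (if c = 0 then α ρ 0 else if c ≤ N then
        (if (gIndex w v u ρ).1 = 1 then 0 else
          ent (shiftCols U ^ (gIndex w v u ρ).2) ((gIndex w v u ρ).1 - 1) c)
        else α ρ (c - N)) * (if c ≤ N then ent X (c + 1) (col + 1) else
          ent X 1 (col + 1 - (c - N)))) s,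
        show range s = range ((N + 1) + (w + 1)) by rw [hs]; congr 1; omega, sum_range_add, sum_range_succ' _ N,
        sum_range_succ' _ (w + 1), add_assoc, add_comm (∑ e ∈ range (w + 1), α ρ (e + 1) * _)]
      congr 1
      · refine sum_congr rfl fun x hx => ?_
        have hx : x < N := by simpa using hx
        rw [if_neg (show ¬ x + 1 = 0 by omega), if_pos (show x + 1 ≤ N by omega),
          if_pos (show x + 1 ≤ N by omega)]
      · congr 1
        refine sum_congr rfl fun x hx => ?_
        rw [if_neg (show ¬ N + 1 + x = 0 by omega), if_neg (show ¬ N + 1 + x ≤ N by omega),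
          if_neg (show ¬ N + 1 + x ≤ N by omega), show N + 1 + x - N = x + 1 by omega]
    rw [h1, h2, hG, of_apply, hrow ρ (col + 1), add_sub_cancel_right]
  have hdet : G.det = M.det * B.det := by
    rw [← one_mul G.det, ← hLdet, ← det_mul, hLG, det_mul]
  rw [hdet, hB, det_rows_append_shifts X hs]
  congr 1
  rw [det_eq_of_complementary_block_zero (show (w + 2) + N = s by omega) M
    (fun d => ⟨pivotRow w v d, by unfold pivotRow; split_ifs <;> omega⟩)
    (fun d => ⟨if (d : ℕ) = 0 then 0 else N + d, by split_ifs <;> omega⟩)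
    (fun x => ⟨freeRow w v x, by unfold freeRow; split_ifs <;> omega⟩)
    (fun x => ⟨x + 1, by omega⟩)]
  · have hpiv : (M.submatrix
        (fun d : Fin (w + 2) => (⟨pivotRow w v d, by unfold pivotRow; split_ifs <;> omega⟩ : Fin s))
        (fun d : Fin (w + 2) => (⟨if (d : ℕ) = 0 then 0 else N + d, by split_ifs <;> omega⟩ : Fin s)))
        = 1 := by
      refine Matrix.ext fun d d' => ?_
      have hi := gIndex_pivotRow (w := w) (v := v) (u := u) (d := d) (by omega)
      have hα' := hα ⟨pivotRow w v d, by unfold pivotRow; split_ifs <;> omega⟩ (by simp only [hi])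
      simp only [hi] at hα'
      rw [submatrix_apply, hM, of_apply, Matrix.one_apply]
      simp only [hα', Fin.ext_iff]
      split_ifs <;> first | rfl | omega
    rw [hpiv, det_one, mul_one]
    congr 2
    refine Matrix.ext fun x y => ?_
    rw [submatrix_apply, hM, of_apply, of_apply]
    have hne : (gIndex w v u (freeRow w v x)).1 ≠ 1 := by
      unfold gIndex freeRow
      split_ifs <;> simp only <;> omega
    rw [if_neg (by simp), if_pos (by simp only; omega), if_neg hne]
  · intro d d' hd
    have hd : (d : ℕ) < d' := hd
    simp only [Fin.mk_lt_mk]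
    unfold pivotRow
    split_ifs <;> omega
  · intro d d' hd
    have hd : (d : ℕ) < d' := hd
    simp only [Fin.mk_lt_mk]
    split_ifs <;> omega
  · intro d d' hd
    have hd : (d : ℕ) < d' := hd
    simp only [Fin.mk_lt_mk]
    unfold freeRow
    split_ifs <;> omega
  · intro d d' hd
    have hd : (d : ℕ) < d' := hd
    simp only [Fin.mk_lt_mk]
    omega
  · intro d x hh
    simp only [Fin.mk.injEq] at hh
    unfold pivotRow freeRow at hh
    split_ifs at hh <;> omega
  · intro d x hh
    simp only [Fin.mk.injEq] at hh
    split_ifs at hh; omega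
  · intro d x
    have hi := gIndex_pivotRow (w := w) (v := v) (u := u) (d := d) (by omega)
    rw [hM, of_apply]
    simp only [hi]
    rw [if_neg (by omega), if_pos (by omega), if_pos trivial]

/-- Reordering of the rows of `gMatrix` into the order in which they occur in `G_{ij}(X)`: the three
groups of rows are listed in the opposite order, and the last group is itself reversed. -/
theorem det_gMatrix_eq {w v u : ℕ} (hN : N = w + v + u + 2) (W : Matrix (Fin N) (Fin N) K) :
    (gMatrix (w + v + 2) (w + 2) W).det =
      (-1) ^ (∑ x : Fin N, if (x : ℕ) < u + 1 then 0 else if (x : ℕ) < v + u + 2 then u + 1 else x) *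
      (Matrix.of fun x y : Fin N => ent (W ^ (gIndex w v u (freeRow w v x)).2)
        ((gIndex w v u (freeRow w v x)).1 - 1) (y + 1)).det := by
  have hlt : ∀ x : Fin N, (if (x : ℕ) < u + 1 then w + v + 1 + x else
      if (x : ℕ) < v + u + 2 then x + w - u - 1 else N - 1 - x) < N := by
    intro x; split_ifs <;> omega
  set t : Fin N → Fin N := fun x => ⟨_, hlt x⟩ with ht
  have hinj : Function.Injective t := by
    intro x y hxy
    simp only [ht, Fin.mk.injEq] at hxy
    refine Fin.ext ?_
    split_ifs at hxy <;> omega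
  set τ : Equiv.Perm (Fin N) := Equiv.ofBijective t (Finite.injective_iff_bijective.1 hinj) with hτ
  have hτt : ∀ x, (τ x : ℕ) = if (x : ℕ) < u + 1 then w + v + 1 + x else
      if (x : ℕ) < v + u + 2 then x + w - u - 1 else N - 1 - x := fun x => rfl
  rw [← det_submatrix_eq_pow_inversions τ]
  · congr 1
    refine Matrix.ext fun x y => ?_
    rw [gMatrix, of_apply, submatrix_apply, of_apply, hτt]
    unfold gExp gRow freeRow gIndex
    have h1 : N - (w + v + 2) + 1 = u + 1 := by omega
    have h2 : N - (w + 2) + 2 = v + u + 2 := by omega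
    rw [h1, h2]
    split_ifs <;> first | omega | (simp only [id]; congr 2; omega)
  · intro j
    have hcard : ∀ (m : ℕ) (hm : m ≤ N), #{i : Fin N | (i : ℕ) < m} = m := by
      intro m hm
      rw [Fin.card_filter_val_lt]
      omega
    have : ({i ∈ Iio j | τ j < τ i} : Finset (Fin N)) = ({i : Fin N | (i : ℕ) <
        if (j : ℕ) < u + 1 then 0 else if (j : ℕ) < v + u + 2 then u + 1 else j} : Finset _) := by
      ext i
      simp only [mem_filter, mem_Iio, mem_univ, true_and, Fin.lt_def, hτt]
      split_ifs <;> omega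
    rw [this, hcard]
    split_ifs <;> omega

/-- The signs of the Laplace expansion and of the reordering of rows combine to `signG`. -/
theorem gSign_parity {w v u : ℕ} (hN : N = w + v + u + 2) :
    ((-1 : K)) ^ (∑ x : Fin N, (freeRow w v x + ((x : ℕ) + 1))) =
      (-1) ^ ((N + 1 + (w + 2) + 1) * (w + v + 2 + (w + 2))) *
      (-1) ^ (∑ x : Fin N,
        if (x : ℕ) < u + 1 then 0 else if (x : ℕ) < v + u + 2 then u + 1 else x) := by
  have e1 : ∑ x : Fin N, (freeRow w v x + ((x : ℕ) + 1)) =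
      ∑ x ∈ range w, (3 * x + 2) + ∑ x ∈ range (v + 1), (2 * (w + x) + w + 2) +
        ∑ x ∈ range (u + 1), (2 * (w + v + 1 + x) + w + 3) := by
    rw [Fin.sum_univ_eq_sum_range (fun x => freeRow w v x + (x + 1)),
      show N = w + (v + 1) + (u + 1) by omega, sum_range_add, sum_range_add]
    unfold freeRow
    congr 1
    · congr 1
      · refine sum_congr rfl fun x hx => ?_
        have := mem_range.1 hx
        rw [if_pos this]; ring
      · refine sum_congr rfl fun x hx => ?_
        have := mem_range.1 hx
        rw [if_neg (by omega), if_pos (by omega)]; ring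
    · refine sum_congr rfl fun x hx => ?_
      have := mem_range.1 hx
      rw [if_neg (by omega), if_neg (by omega)]; ring
  have e2 : (∑ x : Fin N,
        if (x : ℕ) < u + 1 then 0 else if (x : ℕ) < v + u + 2 then u + 1 else (x : ℕ)) =
      (v + 1) * (u + 1) + ∑ x ∈ range w, (v + u + 2 + x) := by
    rw [Fin.sum_univ_eq_sum_range (fun x =>
      if x < u + 1 then 0 else if x < v + u + 2 then u + 1 else x),
      show N = (u + 1) + (v + 1) + w by omega, sum_range_add, sum_range_add]
    congr 1
    · rw [sum_eq_zero (fun x hx => if_pos (mem_range.1 hx)), zero_add,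
        sum_congr rfl (g := fun _ => u + 1)]
      · simp
      · intro x hx
        have := mem_range.1 hx
        rw [if_neg (by omega), if_pos (by omega)]
    · refine sum_congr rfl fun x hx => ?_
      rw [if_neg (by omega), if_neg (by omega)]; ring
  have e3 : ∑ x ∈ range w, (v + u + 2 + x) = w * (v + u + 2) + ∑ x ∈ range w, x := by
    rw [sum_add_distrib, sum_const, card_range, smul_eq_mul]
  have e4 : ∑ x ∈ range w, 3 * x = 3 * ∑ x ∈ range w, x := (mul_sum _ _ _).symm
  rw [e1, e2, ← pow_add, e3]
  simp only [sum_add_distrib, ← mul_sum, sum_const, card_range, smul_eq_mul]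
  rw [e4]
  generalize ∑ x ∈ range w, x = A
  subst hN
  refine neg_one_pow_congr ?_
  by_cases hw : Even w <;> by_cases hv : Even v <;> by_cases hu : Even u <;>
    simp [Nat.even_add, Nat.even_mul, Nat.even_add_one, hw, hv, hu, show ¬ Even 3 by decide]

/-- The formula for the functions `g_{ij}`. -/
theorem gFun_eq_of_shift {X : Matrix (Fin (N + 1)) (Fin (N + 1)) ℂ} (hX : X.det ≠ 0)
    (h1n : ent X 1 (N + 1) ≠ 0) (hn1 : ent X (N + 1) 1 ≠ 0) {i j : ℕ} (hj : 2 ≤ j) (hji : j ≤ i)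
    (hiN : i ≤ N) :
    gFun i j (psiOne X) = (signG (N + 1) i j : ℂ) *
      (gX i j X / (ent X 1 (N + 1) ^ (j - 1) * X.det)) := by
  obtain ⟨a, b, -, -, h⟩ := exists_ent_shift_eq' hX h1n hn1
  obtain ⟨w, rfl⟩ : ∃ w, j = w + 2 := ⟨j - 2, by omega⟩
  obtain ⟨v, rfl⟩ : ∃ v, i = w + v + 2 := ⟨i - (w + 2), by omega⟩
  obtain ⟨u, hN⟩ : ∃ u, N = w + v + u + 2 := ⟨N - (w + v + 2), by omega⟩
  set U : Matrix (Fin N) (Fin N) ℂ := psiOne X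
  have h1 : gX (w + v + 2) (w + 2) X = (Matrix.of fun r c : Fin (N + 1 + (w + 2) - 1) =>
      ent X (gIndex w v u r).1 (c + 1 - (gIndex w v u r).2)).det := by
    rw [gX]
    congr 1
    refine Matrix.ext fun r c => ?_
    rw [bigG, of_apply, of_apply]
    have := stackedRows_gSets_getD w v u (x := r) (by omega)
    rw [show w + v + u + 3 = N + 1 by omega] at this
    simp only [this]
  rw [h1, det_stacked_eq hN (by omega) U a b h, gFun_eq_det (by omega) (by omega) (by omega),
    det_gMatrix_eq hN, gSign_parity hN, signG, show w + 2 - 1 = w + 1 by omega]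
  have h3 : ∀ e : ℕ, ((-1 : ℂ)) ^ e * (-1) ^ e = 1 := fun e => by
    rw [← pow_add, Even.neg_one_pow ⟨_, rfl⟩]
  rw [mul_comm X.det, mul_div_cancel_right₀ _ (mul_ne_zero (pow_ne_zero _ h1n) hX)]
  push_cast
  generalize (Matrix.of fun x y : Fin N => ent (shiftCols U ^ (gIndex w v u (freeRow w v x)).2)
        ((gIndex w v u (freeRow w v x)).1 - 1) (y + 1)).det = D
  generalize (∑ x : Fin N,
        if (x : ℕ) < u + 1 then 0 else if (x : ℕ) < v + u + 2 then u + 1 else (x : ℕ)) = F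
  linear_combination (-(-1 : ℂ) ^ F * D) * h3 ((N + 1 + (w + 2) + 1) * (w + v + 2 + (w + 2)))

end GFormula

/-! ### Moments of `q̄ / p` and the matrix `F(X)` -/

section Moments

open Polynomial Finset

variable {N : ℕ}

theorem coeff_rowPoly {n : ℕ} (a : ℕ) (M : Matrix (Fin n) (Fin n) ℂ) (k : ℕ) :
    (rowPoly a M).coeff k = ent M a (k + 1) / ent M 1 n := by
  rw [rowPoly, finsetSum_coeff]
  simp only [coeff_C_mul_X_pow]
  rw [Finset.sum_ite_eq]
  split_ifs with h
  · rfl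
  · rw [ent_of_col_gt, zero_div]
    simpa using h

theorem natDegree_rowPoly_le (a : ℕ) (M : Matrix (Fin (N + 1)) (Fin (N + 1)) ℂ) :
    (rowPoly a M).natDegree ≤ N := by
  rw [natDegree_le_iff_coeff_eq_zero]
  intro k hk
  rw [coeff_rowPoly, ent_of_col_gt _ _ (by omega), zero_div]

theorem monic_rowPoly_one {M : Matrix (Fin (N + 1)) (Fin (N + 1)) ℂ} (h : ent M 1 (N + 1) ≠ 0) :
    (rowPoly 1 M).Monic :=
  monic_of_natDegree_le_of_coeff_eq_one N (natDegree_rowPoly_le 1 M)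
    (by rw [coeff_rowPoly, div_self h])

theorem natDegree_rowPoly_one {M : Matrix (Fin (N + 1)) (Fin (N + 1)) ℂ}
    (h : ent M 1 (N + 1) ≠ 0) : (rowPoly 1 M).natDegree = N :=
  natDegree_eq_of_le_of_coeff_ne_zero (natDegree_rowPoly_le 1 M)
    (by rw [coeff_rowPoly, div_self h]; exact one_ne_zero)

/-- The power series `z ^ (n - 1) r(1 / z)` in `z = 1 / λ` for the polynomial `r = rowPoly a M`. -/
noncomputable def rowSeries {n : ℕ} (a : ℕ) (M : Matrix (Fin n) (Fin n) ℂ) : PowerSeries ℂ :=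
  PowerSeries.mk fun k => ent M a (n - k) / ent M 1 n

/-- The substitution `λ = z⁻¹` moves the coefficient of `λ ^ k` to `z ^ (-k)`. -/
theorem coeff_eval₂_single (r : ℂ[X]) (k : ℕ) :
    (r.eval₂ (HahnSeries.C : ℂ →+* LaurentSeries ℂ) (HahnSeries.single (-1 : ℤ) 1)).coeff (-(k : ℤ)) =
      r.coeff k := by
  induction r using Polynomial.induction_on' with
  | add p q hp hq => rw [eval₂_add, HahnSeries.coeff_add, hp, hq, Polynomial.coeff_add]
  | monomial m a =>
    rw [eval₂_monomial, HahnSeries.single_pow, HahnSeries.C_apply, HahnSeries.single_mul_single,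
      one_pow, mul_one, zero_add, HahnSeries.coeff_single, coeff_monomial]
    simp only [smul_neg, nsmul_eq_mul, mul_one, neg_inj, Nat.cast_inj, eq_comm]

theorem eval₂_single_ne_zero {r : ℂ[X]} (hr : r ≠ 0) :
    r.eval₂ (HahnSeries.C : ℂ →+* LaurentSeries ℂ) (HahnSeries.single (-1 : ℤ) 1) ≠ 0 := by
  intro h
  refine hr (Polynomial.ext fun k => ?_)
  rw [← coeff_eval₂_single, h]
  simp

theorem single_mul_eval₂_rowPoly (a : ℕ) (M : Matrix (Fin (N + 1)) (Fin (N + 1)) ℂ) :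
    HahnSeries.single (N : ℤ) 1 *
      (rowPoly a M).eval₂ (HahnSeries.C : ℂ →+* LaurentSeries ℂ) (HahnSeries.single (-1 : ℤ) 1) =
    HahnSeries.ofPowerSeries ℤ ℂ (rowSeries a M) := by
  have h : rowSeries a M = ∑ i ∈ range (N + 1),
      PowerSeries.C (ent M a (i + 1) / ent M 1 (N + 1)) * PowerSeries.X ^ (N - i) := by
    ext k
    simp only [rowSeries, PowerSeries.coeff_mk, map_sum, PowerSeries.coeff_C_mul_X_pow]
    by_cases hk : k ≤ N
    · rw [sum_eq_single (N - k)]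
      · rw [if_pos (by omega), show N + 1 - k = N - k + 1 by omega]
      · intro i hi hne
        have := mem_range.1 hi
        rw [if_neg (by omega)]
      · intro h
        exact absurd (mem_range.2 (by omega)) h
    · rw [show N + 1 - k = 0 by omega, ent_col_zero, zero_div, sum_eq_zero]
      intro i _
      rw [if_neg (by omega)]
  rw [h, rowPoly, eval₂_finsetSum, mul_sum, map_sum]
  refine sum_congr rfl fun i hi => ?_
  have := mem_range.1 hi
  rw [eval₂_mul, eval₂_C, eval₂_pow, eval₂_X, map_mul, HahnSeries.ofPowerSeries_C,
    HahnSeries.ofPowerSeries_X_pow, HahnSeries.single_pow, one_pow, mul_left_comm,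
    HahnSeries.single_mul_single, mul_one]
  congr 2
  rw [smul_neg, nsmul_eq_mul, mul_one, Nat.cast_sub (by omega)]
  rfl

/-- The moments of `q̄ / p` are the coefficients of the quotient of the reversed polynomials. -/
theorem exists_series_moment (M : Matrix (Fin (N + 1)) (Fin (N + 1)) ℂ)
    (h : ent M 1 (N + 1) ≠ 0) :
    ∃ H : PowerSeries ℂ, H * rowSeries 1 M = rowSeries (N + 1) M ∧
      ∀ i, moment (psiTwo M) i = PowerSeries.coeff i H := by
  set φ : ℂ[X] → LaurentSeries ℂ := fun r =>
    r.eval₂ (HahnSeries.C : ℂ →+* LaurentSeries ℂ) (HahnSeries.single (-1 : ℤ) 1) with hφ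
  have hp0 : rowPoly 1 M ≠ 0 := (monic_rowPoly_one h).ne_zero
  have h1 : expansionAtInfinity (psiTwo M) * φ (rowPoly 1 M) = φ (rowPoly (N + 1) M) := by
    have e : psiTwo M * algebraMap ℂ[X] (RatFunc ℂ) (rowPoly 1 M) =
        algebraMap ℂ[X] (RatFunc ℂ) (rowPoly (N + 1) M) := by
      rw [psiTwo, div_mul_cancel₀]
      exact (map_ne_zero_iff _ (RatFunc.algebraMap_injective ℂ)).2 hp0
    have e' := congrArg (RatFunc.eval (HahnSeries.C : ℂ →+* LaurentSeries ℂ)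
      (HahnSeries.single (-1 : ℤ) 1)) e
    have e2 := RatFunc.eval_mul (HahnSeries.C : ℂ →+* LaurentSeries ℂ)
      (HahnSeries.single (-1 : ℤ) 1) (x := psiTwo M)
      (y := algebraMap ℂ[X] (RatFunc ℂ) (rowPoly 1 M))
      (eval₂_single_ne_zero (RatFunc.denom_ne_zero _))
      (eval₂_single_ne_zero (RatFunc.denom_ne_zero _))
    rw [RatFunc.eval_algebraMap] at e' e2
    exact e2.symm.trans e'
  have hc : PowerSeries.constantCoeff (rowSeries 1 M) ≠ 0 := by
    rw [← PowerSeries.coeff_zero_eq_constantCoeff_apply, rowSeries, PowerSeries.coeff_mk,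
      Nat.sub_zero, div_self h]
    exact one_ne_zero
  refine ⟨rowSeries (N + 1) M * (rowSeries 1 M)⁻¹, ?_, fun i => ?_⟩
  · rw [mul_assoc, PowerSeries.inv_mul_cancel _ hc, mul_one]
  · have h2 : expansionAtInfinity (psiTwo M) * HahnSeries.ofPowerSeries ℤ ℂ (rowSeries 1 M) =
        HahnSeries.ofPowerSeries ℤ ℂ (rowSeries (N + 1) M) := by
      rw [← single_mul_eval₂_rowPoly, ← single_mul_eval₂_rowPoly, ← mul_left_comm]
      exact congrArg _ h1
    have h3 : expansionAtInfinity (psiTwo M) =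
        HahnSeries.ofPowerSeries ℤ ℂ (rowSeries (N + 1) M * (rowSeries 1 M)⁻¹) := by
      rw [map_mul, ← h2, mul_assoc, ← map_mul, PowerSeries.mul_inv_cancel _ hc, map_one, mul_one]
    rw [moment, h3, HahnSeries.ofPowerSeries_apply_coeff]

/-- A linear dependency between the rows of the resultant matrix of two coprime polynomials
is trivial. -/
theorem eq_zero_of_mul_add_mul_eq_zero {p q A B : ℂ[X]} (hp : p.Monic) (hpq : IsCoprime q p)
    (hB : B.degree < p.degree) (h : A * p + B * q = 0) : A = 0 ∧ B = 0 := by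
  have hdvd : p ∣ B * q := ⟨-A, by linear_combination h⟩
  have hB0 : B = 0 := by
    by_contra hB0
    exact absurd (degree_le_of_dvd (hpq.symm.dvd_of_dvd_mul_right hdvd) hB0) (not_le.2 hB)
  refine ⟨?_, hB0⟩
  rw [hB0, zero_mul, add_zero] at h
  exact (mul_eq_zero.1 h).resolve_right hp.ne_zero

/-- A quotient `q̄ / p` with `p` monic of degree `d` that lies in `R̄_d` is in lowest terms. -/
theorem isCoprime_of_mem_RBar {d : ℕ} {p q : ℂ[X]} (hp : p.Monic) (hd : p.natDegree = d)
    (h : algebraMap ℂ[X] (RatFunc ℂ) q / algebraMap ℂ[X] (RatFunc ℂ) p ∈ RBar d) :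
    IsCoprime q p := by
  obtain ⟨p', q', hp', hd', -, hc, he⟩ := h
  have hinj := RatFunc.algebraMap_injective ℂ
  rw [div_eq_div_iff ((map_ne_zero_iff _ hinj).2 hp.ne_zero)
    ((map_ne_zero_iff _ hinj).2 hp'.ne_zero), ← map_mul, ← map_mul] at he
  have he := hinj he
  have hdvd : p' ∣ p := hc.symm.dvd_of_dvd_mul_left ⟨q, by rw [← he, mul_comm]⟩
  have hpp : p = p' :=
    eq_of_monic_of_dvd_of_natDegree_le hp' hp hdvd (by rw [hd, hd'])
  subst hpp
  rw [mul_right_cancel₀ hp.ne_zero he]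
  exact hc

end Moments

section HankelMinors

variable {K : Type*} [CommRing K] {N : ℕ}

theorem det_submatrix_rev_rev {m : ℕ} (M : Matrix (Fin m) (Fin m) K) :
    (M.submatrix Fin.rev Fin.rev).det = M.det :=
  det_submatrix_equiv_self Fin.revPerm M

theorem det_submatrix_rev {m : ℕ} (M : Matrix (Fin m) (Fin m) K) :
    (M.submatrix Fin.rev id).det = (-1) ^ (∑ j : Fin m, (j : ℕ)) * M.det := by
  refine det_submatrix_eq_pow_inversions Fin.revPerm M (fun j => j) fun j => ?_
  rw [filter_true_of_mem, Fin.card_Iio]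
  intro i hi
  simpa using hi

/-- The entries of the trailing minor `f_m(X)`. -/
theorem fX_eq_det (X : Matrix (Fin (N + 1)) (Fin (N + 1)) K) {m : ℕ} (hm : m ≤ 2 * N + 1) :
    fX m X = (Matrix.of fun a b : Fin m =>
      if Even (2 * N + 1 - m + (a : ℕ)) then
        ent X (N + 1) (2 * N + 1 - m + b + 1 - (2 * N + 1 - m + a) / 2)
      else ent X 1 (2 * N + 1 - m + b + 1 - (2 * N + 1 - m + a + 1) / 2)).det := by
  have hc : (Icc (2 * (N + 1) - m) (2 * (N + 1) - 1)).card = m := by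
    rw [Nat.card_Icc]; omega
  rw [fX, minor_eq_det _ hc hc]
  congr 1
  refine Matrix.ext fun a b => ?_
  rw [of_apply, of_apply, nthElt_Icc (by omega), nthElt_Icc (by omega),
    ent_eq_apply (matF X) ⟨2 * N + 1 - m + a, by omega⟩ ⟨2 * N + 1 - m + b, by omega⟩
      (by simp only; omega) (by simp only; omega)]
  rfl

/-- The minor `f_m(X)` as the determinant of the matrix with the truncated rows
`q, p, z q, z p, …`, in terms of the reversed polynomials. -/
theorem fX_eq_det_rev (X : Matrix (Fin (N + 1)) (Fin (N + 1)) K) {m : ℕ} (hm : m ≤ 2 * N + 1) :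
    fX m X = (Matrix.of fun a b : Fin m =>
      ent X (if Even (a : ℕ) then N + 1 else 1) (N + 1 + a / 2 - b)).det := by
  rw [fX_eq_det X hm, ← det_submatrix_rev_rev]
  congr 1
  refine Matrix.ext fun a b => ?_
  rw [submatrix_apply, of_apply, of_apply]
  simp only [Fin.val_rev]
  rw [show 2 * N + 1 - m + (m - ((a : ℕ) + 1)) = 2 * N - a by omega,
    show 2 * N + 1 - m + (m - ((b : ℕ) + 1)) = 2 * N - b by omega]
  by_cases ha : Even (a : ℕ)
  · rw [if_pos ha, if_pos ((Nat.even_sub (by omega)).2 (by simp [ha]))]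
    obtain ⟨c, hc⟩ := ha
    congr 1
    omega
  · rw [if_neg ha, if_neg (fun h => ha (((Nat.even_sub (by omega)).1 h).1 (by simp)))]
    obtain ⟨c, hc⟩ := Nat.not_even_iff_odd.1 ha
    congr 1
    omega

/-- Expansion of the matrix with the truncated rows `h, 1, z h, z, …` along the rows that are powers
of `z`. -/
theorem det_interleaved_eq_hankel (h : ℕ → K) {m p q : ℕ} (hm : p + q = m) (hp : p ≤ q)
    (hq : q ≤ p + 1) :
    (Matrix.of fun a b : Fin m => if Even (a : ℕ) then (if (a : ℕ) / 2 ≤ b then h (b - a / 2) else 0)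
      else if (b : ℕ) = a / 2 then 1 else 0).det =
    (-1) ^ (p * q) * (Matrix.of fun a b : Fin q => h (a + b + (p + 1 - q))).det := by
  rw [det_eq_of_complementary_block_zero hm _
    (fun a => ⟨2 * a + 1, by omega⟩) (fun a => ⟨a, by omega⟩)
    (fun b => ⟨2 * b, by omega⟩) (fun b => ⟨p + b, by omega⟩)]
  · have h1 : ((Matrix.of fun a b : Fin m =>
        if Even (a : ℕ) then (if (a : ℕ) / 2 ≤ b then h (b - a / 2) else 0)
        else if (b : ℕ) = a / 2 then 1 else 0).submatrix
        (fun a : Fin p => (⟨2 * a + 1, by omega⟩ : Fin m)) (fun a : Fin p => ⟨a, by omega⟩)) = 1 := by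
      refine Matrix.ext fun a b => ?_
      rw [submatrix_apply, of_apply, Matrix.one_apply]
      simp only [Fin.ext_iff]
      rw [if_neg (by simp)]
      split_ifs <;> first | rfl | omega
    have h2 : ((Matrix.of fun a b : Fin m =>
        if Even (a : ℕ) then (if (a : ℕ) / 2 ≤ b then h (b - a / 2) else 0)
        else if (b : ℕ) = a / 2 then 1 else 0).submatrix
        (fun b : Fin q => (⟨2 * b, by omega⟩ : Fin m)) (fun b : Fin q => ⟨p + b, by omega⟩)) =
        (Matrix.of fun a b : Fin q => h (a + b + (p + 1 - q))).submatrix Fin.rev id := by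
      refine Matrix.ext fun a b => ?_
      rw [submatrix_apply, submatrix_apply, of_apply, of_apply]
      simp only [Fin.val_rev, id]
      rw [if_pos (by simp), if_pos (by omega)]
      congr 1
      omega
    rw [h1, h2, det_submatrix_rev, det_one, mul_one, ← mul_assoc, ← pow_add, ← sum_add_distrib]
    congr 1
    have : ∑ b : Fin q, (2 * (b : ℕ) + (p + b) + b) = 2 * ∑ b : Fin q, 2 * (b : ℕ) + p * q := by
      rw [mul_sum, sum_congr rfl (g := fun b : Fin q => 2 * (2 * (b : ℕ)) + p) (fun b _ => by ring),
        sum_add_distrib]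
      simp [mul_comm]
    rw [this, pow_add, pow_mul]
    simp
  · intro a b hab
    have hab : (a : ℕ) < b := hab
    simp only [Fin.mk_lt_mk]; omega
  · exact fun a b hab => hab
  · intro a b hab
    have hab : (a : ℕ) < b := hab
    simp only [Fin.mk_lt_mk]; omega
  · intro a b hab
    have hab : (a : ℕ) < b := hab
    simp only [Fin.mk_lt_mk]; omega
  · intro a b hab
    simp only [Fin.mk.injEq] at hab; omega
  · intro a b hab
    simp only [Fin.mk.injEq] at hab; omega
  · intro a b
    rw [of_apply, if_neg (by simp), if_neg (by simp only; omega)]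

/-- Truncated multiplication by a power series with constant term `1` preserves determinants. -/
theorem det_coeff_mul_eq {m : ℕ} (R : Fin m → PowerSeries K) (P : PowerSeries K)
    (hP : PowerSeries.coeff 0 P = 1) :
    (Matrix.of fun a b : Fin m => PowerSeries.coeff b (R a * P)).det =
      (Matrix.of fun a b : Fin m => PowerSeries.coeff b (R a)).det := by
  have h : (Matrix.of fun a b : Fin m => PowerSeries.coeff b (R a * P)) =
      (Matrix.of fun a b : Fin m => PowerSeries.coeff b (R a)) *
        (Matrix.of fun c b : Fin m => if c ≤ b then PowerSeries.coeff ((b : ℕ) - c) P else 0) := by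
    refine Matrix.ext fun a b => ?_
    rw [Matrix.mul_apply, of_apply, PowerSeries.coeff_mul,
      Nat.sum_antidiagonal_eq_sum_range_succ (fun i j => PowerSeries.coeff i (R a) *
        PowerSeries.coeff j P)]
    simp only [of_apply, Fin.le_def, mul_ite, mul_zero]
    rw [Fin.sum_univ_eq_sum_range (fun c => if c ≤ (b : ℕ) then PowerSeries.coeff c (R a) *
      PowerSeries.coeff ((b : ℕ) - c) P else 0) m, ← sum_subset (range_subset_range.2
        (by omega : (b : ℕ) + 1 ≤ m))]
    · refine sum_congr rfl fun x hx => ?_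
      have := mem_range.1 hx
      rw [if_pos (by omega)]
    · intro x _ hx
      rw [if_neg]
      simpa using hx
  rw [h, det_mul, det_of_isUpperTriangular (M := Matrix.of fun c b : Fin m => if c ≤ b then PowerSeries.coeff ((b : ℕ) - c) P else 0)]
  · simp only [of_apply, le_refl, if_true, Nat.sub_self, hP, prod_const_one, mul_one]
  · intro i j hij
    have hij : j < i := hij
    rw [of_apply, if_neg (not_le.2 hij)]

/-- The minors `f_m(X)` are Hankel determinants of the moments. -/
theorem fX_eq_hankel {X : Matrix (Fin (N + 1)) (Fin (N + 1)) ℂ} (h1n : ent X 1 (N + 1) ≠ 0)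
    {m p q : ℕ} (hm : p + q = m) (hp : p ≤ q) (hq : q ≤ p + 1) (hmN : m ≤ 2 * N + 1) :
    fX m X = ent X 1 (N + 1) ^ m * ((-1) ^ (p * q) *
      (Matrix.of fun a b : Fin q => moment (psiTwo X) (a + b + (p + 1 - q))).det) := by
  obtain ⟨H, hH, hmom⟩ := exists_series_moment X h1n
  rw [fX_eq_det_rev X hmN, ← det_interleaved_eq_hankel _ hm hp hq]
  set R : Fin m → PowerSeries ℂ := fun a =>
    PowerSeries.X ^ ((a : ℕ) / 2) * (if Even (a : ℕ) then H else 1) with hR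
  have hP : PowerSeries.coeff 0 (rowSeries 1 X) = 1 := by
    rw [rowSeries, PowerSeries.coeff_mk, Nat.sub_zero, div_self h1n]
  -- For `b < a / 2` the column index exceeds `n`, and the entry is zero as it should be.
  have h1 : (Matrix.of fun a b : Fin m =>
      ent X (if Even (a : ℕ) then N + 1 else 1) (N + 1 + a / 2 - b)) =
      ent X 1 (N + 1) • Matrix.of fun a b : Fin m =>
        PowerSeries.coeff b (R a * rowSeries 1 X) := by
    refine Matrix.ext fun a b => ?_
    rw [Matrix.smul_apply, of_apply, of_apply, smul_eq_mul, hR]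
    simp only [mul_assoc, ite_mul, one_mul, hH]
    rw [PowerSeries.coeff_X_pow_mul']
    split_ifs with h1 h2 h2
    · rw [rowSeries, PowerSeries.coeff_mk, mul_div_cancel₀ _ h1n]
      congr 1; omega
    · rw [mul_zero, ent_of_col_gt _ _ (by omega)]
    · rw [rowSeries, PowerSeries.coeff_mk, mul_div_cancel₀ _ h1n]
      congr 1; omega
    · rw [mul_zero, ent_of_col_gt _ _ (by omega)]
  rw [h1, det_smul, det_coeff_mul_eq _ _ hP, Fintype.card_fin]
  congr 2
  refine Matrix.ext fun a b => ?_
  rw [of_apply, of_apply, hR, PowerSeries.coeff_X_pow_mul']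
  by_cases ha : Even (a : ℕ)
  · simp only [if_pos ha, hmom]
  · simp only [if_neg ha, PowerSeries.coeff_one]
    split_ifs <;> first | rfl | omega

theorem tBarMinus_eq {X : Matrix (Fin (N + 1)) (Fin (N + 1)) ℂ} (h1n : ent X 1 (N + 1) ≠ 0)
    {m : ℕ} (hm : 1 ≤ m) (hmN : m ≤ N + 1) :
    tBarMinus m (psiTwo X) = fX (2 * m - 1) X / ent X 1 (N + 1) ^ (2 * m - 1) := by
  rw [fX_eq_hankel h1n (p := m - 1) (q := m) (by omega) (by omega) (by omega) (by omega),
    mul_div_cancel_left₀ _ (pow_ne_zero _ h1n)]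
  have he : Even ((m - 1) * m) := by
    have := Nat.even_mul_succ_self (m - 1)
    rwa [Nat.sub_add_cancel hm] at this
  rw [he.neg_one_pow, one_mul, tBarMinus, show m - 1 + 1 - m = 0 by omega]
  rfl

theorem tBarPlus_eq {X : Matrix (Fin (N + 1)) (Fin (N + 1)) ℂ} (h1n : ent X 1 (N + 1) ≠ 0)
    {m : ℕ} (hmN : m ≤ N) :
    tBarPlus m (psiTwo X) = fX (2 * m) X / ent X 1 (N + 1) ^ (2 * m) := by
  rw [fX_eq_hankel h1n (p := m) (q := m) (by omega) (by omega) (by omega) (by omega),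
    mul_div_cancel_left₀ _ (pow_ne_zero _ h1n), tBarPlus, show m + 1 - m = 1 by omega]
  congr 1
  exact neg_one_pow_congr (by simp [Nat.even_mul])

/-- The last column of the reversed matrix has a single nonzero entry, `x_{n1}`. -/
theorem fX_last (X : Matrix (Fin (N + 1)) (Fin (N + 1)) K) :
    fX (2 * N + 1) X = ent X (N + 1) 1 * fX (2 * N) X := by
  rw [fX_eq_det_rev X le_rfl, fX_eq_det_rev X (by omega),
    det_eq_of_complementary_block_zero rfl _ (fun a : Fin (2 * N) => Fin.castSucc a) Fin.castSucc
    (fun _ : Fin 1 => Fin.last _) (fun _ : Fin 1 => Fin.last _) (fun _ _ h => h) (fun _ _ h => h)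
    (Subsingleton.strictMono _) (Subsingleton.strictMono _)
    (fun i _ => (Fin.castSucc_lt_last i).ne) (fun i _ => (Fin.castSucc_lt_last i).ne)]
  · have h1 : (-1 : K) ^ (∑ _x : Fin 1,
        (((Fin.last (2 * N) : Fin (2 * N + 1)) : ℕ) + (Fin.last (2 * N) : Fin (2 * N + 1)))) = 1 := by
      rw [sum_add_distrib, Even.neg_one_pow ⟨_, rfl⟩]
    rw [h1, one_mul, det_fin_one, mul_comm]
    congr 1
    rw [submatrix_apply, of_apply, Fin.val_last, if_pos (by simp)]
    congr 1
    omega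
  · intro i _
    rw [of_apply, Fin.val_last, Fin.val_castSucc]
    rw [show N + 1 + (i : ℕ) / 2 - 2 * N = 0 by omega, ent_col_zero]

theorem sum_range_two_mul {M : Type*} [AddCommMonoid M] (f : ℕ → M) (n : ℕ) :
    ∑ a ∈ range (2 * n), f a = ∑ i ∈ range n, f (2 * i) + ∑ i ∈ range n, f (2 * i + 1) := by
  induction n with
  | zero => simp
  | succ n ih =>
    rw [show 2 * (n + 1) = 2 * n + 1 + 1 by ring, sum_range_succ, sum_range_succ, ih,
      sum_range_succ, sum_range_succ, add_assoc, add_add_add_comm]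

/-- If `q̄ / p` is in lowest terms, then the rows of `F(X)` involved in `f_{2n-2}(X)`, which are the
coefficient vectors of `λ ^ i p` and `λ ^ i q̄` for `i < n - 1`, are linearly independent. -/
theorem fX_ne_zero {X : Matrix (Fin (N + 1)) (Fin (N + 1)) ℂ} (h1n : ent X 1 (N + 1) ≠ 0)
    (hX : psiTwo X ∈ RBar N) : fX (2 * N) X ≠ 0 := by
  have hcop := isCoprime_of_mem_RBar (monic_rowPoly_one h1n) (natDegree_rowPoly_one h1n) hX
  rw [fX_eq_det X (by omega)]
  intro h0
  obtain ⟨v, hv0, hv⟩ := exists_vecMul_eq_zero_iff.2 h0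
  set c : ℕ → ℂ := fun k => if h : k < 2 * N then v ⟨k, h⟩ else 0 with hc
  have hcv : ∀ a : Fin (2 * N), c a = v a := fun a => dif_pos a.2
  -- The coefficients of a linear dependency, collected into polynomials `A` and `B` with
  -- `A p + B q = 0`.
  set A : Polynomial ℂ := ∑ i ∈ range N, Polynomial.C (c (2 * i)) * Polynomial.X ^ i with hA
  set B : Polynomial ℂ := ∑ i ∈ range N, Polynomial.C (c (2 * i + 1)) * Polynomial.X ^ i with hB
  have hcoeff : ∀ (g : ℕ → ℂ) (r b : ℕ),
      ((∑ i ∈ range N, Polynomial.C (g i) * Polynomial.X ^ i) * rowPoly r X).coeff b =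
        ∑ i ∈ range N, g i * (ent X r (b + 1 - i) / ent X 1 (N + 1)) := by
    intro g r b
    rw [sum_mul, Polynomial.finsetSum_coeff]
    refine sum_congr rfl fun i _ => ?_
    rw [mul_assoc, Polynomial.coeff_C_mul, Polynomial.coeff_X_pow_mul', coeff_rowPoly]
    split_ifs with h
    · rw [show b - i + 1 = b + 1 - i by omega]
    · rw [show b + 1 - i = 0 by omega, ent_col_zero, zero_div]
  have hAB : A * rowPoly 1 X + B * rowPoly (N + 1) X = 0 := by
    refine Polynomial.ext fun b => ?_
    rw [Polynomial.coeff_add, hcoeff, hcoeff, Polynomial.coeff_zero]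
    by_cases hb : b < 2 * N
    · have hvb := congrFun hv ⟨b, hb⟩
      rw [Pi.zero_apply, vecMul, dotProduct] at hvb
      simp only [of_apply, ← hcv] at hvb
      rw [Fin.sum_univ_eq_sum_range (fun a => c a * if Even (2 * N + 1 - 2 * N + a) then
          ent X (N + 1) (2 * N + 1 - 2 * N + b + 1 - (2 * N + 1 - 2 * N + a) / 2)
        else ent X 1 (2 * N + 1 - 2 * N + b + 1 - (2 * N + 1 - 2 * N + a + 1) / 2)) (2 * N),
        sum_range_two_mul] at hvb
      simp only [← mul_div_assoc]
      rw [← sum_div, ← sum_div, ← add_div, div_eq_zero_iff]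
      left
      rw [← hvb]
      congr 1
      · refine sum_congr rfl fun i _ => ?_
        rw [if_neg (by rw [Nat.not_even_iff]; omega)]
        congr 2; omega
      · refine sum_congr rfl fun i _ => ?_
        rw [if_pos (by rw [Nat.even_iff]; omega)]
        congr 2; omega
    · have hz : ∀ (g : ℕ → ℂ) (r : ℕ),
          ∑ i ∈ range N, g i * (ent X r (b + 1 - i) / ent X 1 (N + 1)) = 0 := by
        intro g r
        refine sum_eq_zero fun i hi => ?_
        have := mem_range.1 hi
        rw [ent_of_col_gt _ _ (by omega), zero_div, mul_zero]
      rw [hz, hz, add_zero]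
  have hdeg : B.degree < (rowPoly 1 X).degree := by
    rw [Polynomial.degree_eq_natDegree (monic_rowPoly_one h1n).ne_zero,
      natDegree_rowPoly_one h1n, Polynomial.degree_lt_iff_coeff_zero]
    intro m hm
    rw [hB, Polynomial.finsetSum_coeff]
    refine sum_eq_zero fun i hi => ?_
    have := mem_range.1 hi
    rw [Polynomial.coeff_C_mul_X_pow, if_neg (by omega)]
  obtain ⟨hA0, hB0⟩ := eq_zero_of_mul_add_mul_eq_zero (monic_rowPoly_one h1n) hcop hdeg hAB
  have hg : ∀ (g : ℕ → ℂ), ∑ i ∈ range N, Polynomial.C (g i) * Polynomial.X ^ i = 0 →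
      ∀ i < N, g i = 0 := by
    intro g h i hi
    have := congrArg (fun r => Polynomial.coeff r i) h
    simp only [Polynomial.finsetSum_coeff, Polynomial.coeff_C_mul_X_pow,
      Polynomial.coeff_zero] at this
    rwa [Finset.sum_ite_eq, if_pos (mem_range.2 hi)] at this
  refine hv0 (funext fun a => ?_)
  rw [← hcv, Pi.zero_apply]
  obtain ⟨i, hi | hi⟩ := Nat.even_or_odd' (a : ℕ)
  · rw [hi]
    exact hg (fun i => c (2 * i)) hA0 i (by omega)
  · rw [hi]
    exact hg (fun i => c (2 * i + 1)) hB0 i (by omega)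

theorem tBarPlus_ne_zero {X : Matrix (Fin (N + 1)) (Fin (N + 1)) ℂ} (h1n : ent X 1 (N + 1) ≠ 0)
    (hX : psiTwo X ∈ RBar N) : tBarPlus N (psiTwo X) ≠ 0 := by
  rw [tBarPlus_eq h1n le_rfl]
  exact div_ne_zero (fX_ne_zero h1n hX) (pow_ne_zero _ h1n)

theorem tBarMinus_div_tBarPlus {X : Matrix (Fin (N + 1)) (Fin (N + 1)) ℂ}
    (h1n : ent X 1 (N + 1) ≠ 0) (hX : psiTwo X ∈ RBar N) :
    tBarMinus (N + 1) (psiTwo X) / tBarPlus N (psiTwo X) =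
      ent X (N + 1) 1 / ent X 1 (N + 1) := by
  have h := fX_ne_zero h1n hX
  rw [tBarMinus_eq h1n (by omega) le_rfl, tBarPlus_eq h1n le_rfl,
    show 2 * (N + 1) - 1 = 2 * N + 1 by omega, fX_last]
  field_simp
  ring

end HankelMinors

end CGPullback

theorem mainTheorem4 (n : ℕ) (hn : 3 ≤ n) (X : Matrix (Fin n) (Fin n) ℂ) (hX : IsUnit X)
    (h1n : ent X 1 n ≠ 0) :
    (ent X n 1 ≠ 0 →
      (∀ k l : ℕ, 1 ≤ k → 1 ≤ l → k + l ≤ n - 1 →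
        varphi k l (psiOne X) =
          (signPhi n k l : ℂ) * (phiX k l X / (ent X 1 n * X.det) ^ (n - k - l))) ∧
      (∀ i j : ℕ, 2 ≤ j → j ≤ i → i ≤ n - 1 →
        gFun i j (psiOne X) =
          (signG n i j : ℂ) * (gX i j X / (ent X 1 n ^ (j - 1) * X.det))) ∧
      (∀ r : ℕ, 1 ≤ r → r ≤ n - 1 →
        cFun r (psiOne X) = cX r X / (ent X 1 n * X.det)) ∧
      cFun (n - 1) (psiOne X) = (psiOne X).det ∧
      (psiOne X).det = ent X n 1 / ent X 1 n) ∧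
    (∀ m : ℕ, 1 ≤ m → m ≤ n →
      tBarMinus m (psiTwo X) = fX (2 * m - 1) X / ent X 1 n ^ (2 * m - 1)) ∧
    (∀ m : ℕ, 1 ≤ m → m ≤ n - 1 →
      tBarPlus m (psiTwo X) = fX (2 * m) X / ent X 1 n ^ (2 * m)) ∧
    (psiTwo X ∈ RBar (n - 1) →
      tBarPlus (n - 1) (psiTwo X) ≠ 0 ∧
      tBarMinus n (psiTwo X) / tBarPlus (n - 1) (psiTwo X) = ent X n 1 / ent X 1 n) := by
  obtain ⟨N, rfl⟩ : ∃ N, n = N + 1 := ⟨n - 1, by omega⟩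
  have hdet : X.det ≠ 0 := ((Matrix.isUnit_iff_isUnit_det X).1 hX).ne_zero
  exact ⟨fun hn1 => ⟨fun k l hk hl hkl => varphi_eq_of_shift hdet h1n hn1 hk hl hkl,
      fun i j hj hji hi => gFun_eq_of_shift hdet h1n hn1 hj hji hi,
      fun r _ _ => cFun_psiOne (by omega) hdet h1n hn1 r,
      cFun_self (N := N) (psiOne X), det_psiOne hdet h1n hn1⟩,
    fun m hm hmN => tBarMinus_eq h1n hm hmN,
    fun m _ hmN => tBarPlus_eq h1n hmN,
    fun hR => ⟨tBarPlus_ne_zero h1n hR, tBarMinus_div_tBarPlus h1n hR⟩⟩
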